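/- **Setting.** Let $k,m\in\mathbb N$, and for $p\in[m]=\{1,\dots,m\}$ let $F_p^c$ be a probability distribution with a density on a subset $\Xi_p$ of a Euclidean space; put $\mathbf F^c=(F^c_1,\dots,F^c_m)$. For $i\in[k]$ and $p\in[m]$ let $T_{ip}\ge 1$ be an integer and let $h_i:\Xi_1^{T_{i1}}\times\cdots\times\Xi_m^{T_{im}}\to\mathbb R$ be measurable. For $\mathbf F=(F_1,\dots,F_m)$ with $F_p$ a probability distribution on $\Xi_p$, one *replication of Solution $i$ under $\mathbf F$* draws independent inputs $\mathbf Z^i=(\mathbf Z^i_p(t))_{p\in[m],\,t\in[T_{ip}]}$ with $\mathbf Z^i_p(t)\sim F_p$ and returns $Y_i(\mathbf F)=h_i(\mathbf Z^i)$. Let $\eta_i(\mathbf F)=\mathrm E[Y_i(\mathbf F)]$ and $$\mathrm{IF}_{ip}(x;\mathbf F)=\lim_{\epsilon\to0^+}\epsilon^{-1}\big[\eta_i(F_1,\dots,F_{p-1},F_p+\epsilon(\delta_x-F_p),F_{p+1},\dots,F_m)-\eta_i(\mathbf F)\big],$$ where $\delta_x$ is the point mass at $x$. **Data and ambiguity set.**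 For sample sizes $n_1,\dots,n_m\ge1$ let $n=\frac1m\sum_{p}n_p$. The data $X_{pj}$, $p\in[m]$, $j\in[n_p]$, are independent with $X_{pj}\sim F^c_p$. A family of weights $\mathbf w=(w_{pj})$ with $\mathbf w_p=(w_{pj})_j$ in the probability simplex $\Delta_{n_p}\subset\mathbb R^{n_p}$ for every $p$ is identified with the input model $\big(\sum_j w_{pj}\delta_{X_{pj}}\big)_{p\in[m]}$; $\widehat{\mathbf F}$ is the one with $w_{pj}=1/n_p$. For $\alpha\in(0,1)$ let $$\mathcal U_\alpha=\Big\{\mathbf w:\ \mathbf w_p\in\Delta_{n_p}\ (p\in[m]),\ -2\sum_{p=1}^m\sum_{j=1}^{n_p}\log(n_pw_{pj})\le\chi^2_{k-1,1-\alpha}\Big\}\qquad(\log 0=-\infty),$$ where $\chi^2_{k-1,1-\alpha}$ is the $(1-\alpha)$-quantile of the chi-square distribution with $k-1$ degrees of freedom. **Procedure.** (1) For each $i\in[k]$ simulate, conditionally on the data, $R_1$ i.i.d. replications of Solution $i$ under $\widehat{\mathbf F}$, with inputs $\mathbf Z^{ir}$, $r\in[R_1]$. With $\bar h_i=R_1^{-1}\sum_r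 h_i(\mathbf Z^{ir})$, put $$\widehat{\mathrm{IF}}_{ip}(X_{pj})=\frac1{R_1}\sum_{r=1}^{R_1}\big(h_i(\mathbf Z^{ir})-\bar h_i\big)\Big(n_p\sum_{t=1}^{T_{ip}}\mathbf 1\{\mathbf Z^{ir}_p(t)=X_{pj}\}-T_{ip}\Big).$$ (2) For each ordered pair $i\ne\ell$ let $\widehat{\mathbf w}^*_{i\ell}$ be a (measurable) maximizer over $\mathbf w\in\mathcal U_\alpha$ of $\sum_{p}\sum_{j}\big(\widehat{\mathrm{IF}}_{ip}(X_{pj})-\widehat{\mathrm{IF}}_{\ell p}(X_{pj})\big)w_{pj}$. (3) Conditionally on the data and $\widehat{\mathbf w}^*_{i\ell}$, simulate $R_2$ i.i.d. replications $Y_{ir}(\widehat{\mathbf w}^*_{i\ell})$ of Solution $i$ and $R_2$ i.i.d. replications $Y_{\ell r}(\widehat{\mathbf w}^*_{i\ell})$ of Solution $\ell$ under $\widehat{\mathbf w}^*_{i\ell}$, and put $$\widehat U_{i\ell,n}=\frac1{R_2}\sum_{r=1}^{R_2}\big(Y_{ir}(\widehat{\mathbf w}^*_{i\ell})-Y_{\ell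 r}(\widehat{\mathbf w}^*_{i\ell})\big).$$ The simulations of different solutions and of different pairs may be dependent in any way (for instance, through common random numbers). **Proposition.** Assume: 1. $\mathrm E_{\mathbf F^c}[|h_i(\mathbf Z^i)|^2]<\infty$ for each $i\in[k]$. 2. Along the sequence of experiments $n\to\infty$, and $n_p/n\to\beta_p$ for some $\beta_p>0$, for each $p\in[m]$. 3. For each $p\in[m]$ the variance-covariance matrix of $\big(\mathrm{IF}_{ip}(X_p;\mathbf F^c)\big)_{i\in[k]}$, $X_p\sim F_p^c$, is positive definite. 4. For each $i\in[k]$ and each choice of sample sizes in the sequence, almost surely $\sup_{\mathbf w\in\mathcal U_\alpha}\mathrm E_{\mathbf w}[|h_i(\mathbf Z^i)|^4]<\infty$, where $\mathrm E_{\mathbf w}$ is the expectation over the inputs $\mathbf Z^i$ given the data. Moreover, for all $I^p=(I^p_1,\dots,I^p_{T_{ip}})\in[T_{ip}]^{T_{ip}}$, $p\in[m]$, $\ \mathrm E_{\mathbf F^c}\big[\big|h_i\big((\mathbf Z^i_p(I^p_t))_{p\in[m],\,t\in[T_{ip}]}\big)\big|^4\big]<\infty$. If $R_1$ and $R_2$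 (depending on the experiment) satisfy $R_1/n\to\infty$ and $R_2/n\to\infty$, then for every $i\in[k]$ $$\liminf_{n\to\infty}\Pr\big\{\eta_i(\mathbf F^c)-\eta_\ell(\mathbf F^c)\le\widehat U_{i\ell,n}\ \text{ for all }\ell\ne i\big\}\ \ge\ 1-\alpha .$$ -/

import Mathlib

open MeasureTheory ProbabilityTheory Filter Topology
open scoped ENNReal

noncomputable section

namespace InputUncertainty

section Model

variable {m : ℕ} {S : Fin m → Type*} [∀ p, MeasurableSpace (S p)]

/-- An array of points holding, for each input source `p`, `c p` points of the sample space `S p`.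
It serves both for the inputs consumed by one replication of the simulator (`c p` the number of
variates drawn from source `p`) and for the input data (`c p` the sample size of source `p`). -/
abbrev Sample (S : Fin m → Type*) (c : Fin m → ℕ) : Type _ := ∀ p, Fin (c p) → S p

/-- The law of an array whose entries are independent, those of source `p` having law `F p`. -/
def productLaw (c : Fin m → ℕ) (F : ∀ p, Measure (S p)) : Measure (Sample S c) :=
  Measure.pi fun p => Measure.pi fun _ => F p

/-- The mean performance `η(F)` of a solution with output function `h` under the input model `F`. -/
def meanPerf {c : Fin m → ℕ} (h : Sample S c → ℝ) (F : ∀ p, Measure (S p)) : ℝ :=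
  ∫ z, h z ∂productLaw c F

/-- The influence function `IF_p(x; F)` of the functional `η`: its one-sided directional derivative
at `F` when the `p`-th distribution moves from `F p` towards the point mass at `x`. -/
def influence {c : Fin m → ℕ} (h : Sample S c → ℝ) (F : ∀ p, Measure (S p)) (p : Fin m)
    (x : S p) : ℝ :=
  limUnder (𝓝[>] (0 : ℝ)) fun ε : ℝ =>
    (meanPerf h (Function.update F p
        (ENNReal.ofReal (1 - ε) • F p + ENNReal.ofReal ε • Measure.dirac x))
      - meanPerf h F) / ε

/-- The variance-covariance matrix of the vector of influence functions of all `k` solutions with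
respect to source `p`, evaluated at a random point of law `F p`. -/
def influenceCov {k : ℕ} {T : Fin k → Fin m → ℕ} (h : ∀ i, Sample S (T i) → ℝ)
    (F : ∀ p, Measure (S p)) (p : Fin m) : Matrix (Fin k) (Fin k) ℝ :=
  Matrix.of fun i i' => covariance (influence (h i) F p) (influence (h i') F p) (F p)

/-- The empirical input model with data `x` reweighted by `w`: its `p`-th component puts mass
`w p j` on the data point `x p j`. -/
def weightedEdf {n : Fin m → ℕ} (x : Sample S n) (w : ∀ p, Fin (n p) → ℝ) (p : Fin m) :
    Measure (S p) :=
  ∑ j, ENNReal.ofReal (w p j) • Measure.dirac (x p j)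

/-- The empirical distribution of the data, with weights `1 / n p`. -/
def edf {n : Fin m → ℕ} (x : Sample S n) : ∀ p, Measure (S p) :=
  weightedEdf x fun p _ => 1 / (n p : ℝ)

/-- The simulation estimator of the influence function at the data point `x p j`, computed from the
inputs `z r`, `r < R`, of `R` replications: the sample covariance of the output and of
`n p * #{τ | z r p τ = x p j} - c p`. -/
def influenceEstimate {c n : Fin m → ℕ} {R : ℕ} (h : Sample S c → ℝ) (x : Sample S n)
    (z : Fin R → Sample S c) (p : Fin m) (j : Fin (n p)) : ℝ :=
  1 / (R : ℝ) * ∑ r, (h (z r) - 1 / (R : ℝ) * ∑ s, h (z s)) *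
    ((n p : ℝ) * (∑ τ, ({x p j} : Set (S p)).indicator (fun _ => (1 : ℝ)) (z r p τ)) - (c p : ℝ))

end Model

/-- The chi-square distribution with `q` degrees of freedom: the law of the sum of the squares of
`q` independent standard normal variables. -/
def chiSqLaw (q : ℕ) : Measure ℝ :=
  (Measure.pi fun _ : Fin q => gaussianReal 0 1).map fun z => ∑ i, z i ^ 2

/-- The `u`-quantile of the chi-square distribution with `q` degrees of freedom. -/
def chiSqQuantile (q : ℕ) (u : ℝ) : ℝ := sInf {x : ℝ | u ≤ (chiSqLaw q).real (Set.Iic x)}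

/-- The average of the sample sizes of the `m` sources. -/
def avgSize {m : ℕ} (n : Fin m → ℕ) : ℝ := (∑ p, (n p : ℝ)) / (m : ℝ)

/-- The empirical-likelihood ambiguity set with `q` degrees of freedom at level `1 - α`. The weights
are required to be positive because a zero weight makes the log-likelihood equal to `-∞`. -/
def ambiguitySet {m : ℕ} (q : ℕ) (α : ℝ) (n : Fin m → ℕ) : Set (∀ p, Fin (n p) → ℝ) :=
  {w | (∀ p, w p ∈ stdSimplex ℝ (Fin (n p))) ∧ (∀ p j, 0 < w p j) ∧
    -2 * ∑ p, ∑ j, Real.log ((n p : ℝ) * w p j) ≤ chiSqQuantile q (1 - α)}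

/-- Conditionally on `Y`, the random elements `Z r`, `r < R`, are independent and each has
law `law Y`. -/
def IsCondIID {Ω 𝓨 E : Type*} [MeasurableSpace Ω] [MeasurableSpace 𝓨] [MeasurableSpace E] {R : ℕ}
    (Z : Fin R → Ω → E) (Y : Ω → 𝓨) (law : 𝓨 → Measure E) (P : Measure Ω) : Prop :=
  ∃ κ : Kernel 𝓨 (Fin R → E), IsMarkovKernel κ ∧
    (∀ᵐ y ∂P.map Y, κ y = Measure.pi fun _ => law y) ∧
    HasCondDistrib (fun ω r => Z r ω) Y κ P

/-- One run of the two-stage procedure on a probability space `(Ω, P)`, with sample sizes `n p`,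
`R₁` first-stage and `R₂` second-stage replications. No condition is imposed on the joint law of
replications of different solutions, or of different ordered pairs of solutions, so that
independent simulations and common random numbers are both covered. -/
structure Run {k m : ℕ} {S : Fin m → Type*} [∀ p, MeasurableSpace (S p)] {T : Fin k → Fin m → ℕ}
    (h : ∀ i, Sample S (T i) → ℝ) (F : ∀ p, Measure (S p)) (α : ℝ) (n : Fin m → ℕ) (R₁ R₂ : ℕ)
    {Ω : Type*} [MeasurableSpace Ω] (P : Measure Ω) where
  /-- The input data: `X ω p j` is the `j`-th observation from source `p`. -/
  X : Ω → Sample S n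
  measurable_X : Measurable X
  /-- The observations are independent, those from source `p` having law `F p`. -/
  map_X : P.map X = productLaw n F
  /-- The inputs of the `r`-th first-stage replication of Solution `i`. -/
  Z (i : Fin k) (r : Fin R₁) : Ω → Sample S (T i)
  measurable_Z : ∀ i r, Measurable (Z i r)
  /-- Given the data, the first-stage replications are i.i.d. under the empirical input model. -/
  cond_Z : ∀ i, IsCondIID (Z i) X (fun x => productLaw (T i) (edf x)) P
  /-- The weights computed for the ordered pair `(i, l)` of solutions. -/
  W (i l : Fin k) : Ω → ∀ p, Fin (n p) → ℝ
  measurable_W : ∀ i l, Measurable (W i l)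
  /-- The weights maximize, over the ambiguity set, the weighted sum of the differences of the
  estimated influence functions. -/
  isMax_W : ∀ i l, i ≠ l → ∀ᵐ ω ∂P, W i l ω ∈ ambiguitySet (k - 1) α n ∧
    IsMaxOn (fun w : ∀ p, Fin (n p) → ℝ => ∑ p, ∑ j,
        (influenceEstimate (h i) (X ω) (fun r => Z i r ω) p j
          - influenceEstimate (h l) (X ω) (fun r => Z l r ω) p j) * w p j)
      (ambiguitySet (k - 1) α n) (W i l ω)
  /-- The inputs of the `r`-th second-stage replication of Solution `i` for the pair `(i, l)`. -/
  ZL (i l : Fin k) (r : Fin R₂) : Ω → Sample S (T i)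
  /-- The inputs of the `r`-th second-stage replication of Solution `l` for the pair `(i, l)`. -/
  ZR (i l : Fin k) (r : Fin R₂) : Ω → Sample S (T l)
  measurable_ZL : ∀ i l r, Measurable (ZL i l r)
  measurable_ZR : ∀ i l r, Measurable (ZR i l r)
  /-- Given the data and the weights, the second-stage replications are i.i.d. under the reweighted
  empirical input model. -/
  cond_ZL : ∀ i l, i ≠ l → IsCondIID (ZL i l) (fun ω => (X ω, W i l ω))
    (fun y => productLaw (T i) (weightedEdf y.1 y.2)) P
  cond_ZR : ∀ i l, i ≠ l → IsCondIID (ZR i l) (fun ω => (X ω, W i l ω))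
    (fun y => productLaw (T l) (weightedEdf y.1 y.2)) P

/-- The simulation-estimated bound for the pair `(i, l)`: the average over the second-stage
replications of the differences of the outputs of Solutions `i` and `l`. -/
def Run.Uhat {k m : ℕ} {S : Fin m → Type*} [∀ p, MeasurableSpace (S p)] {T : Fin k → Fin m → ℕ}
    {h : ∀ i, Sample S (T i) → ℝ} {F : ∀ p, Measure (S p)} {α : ℝ} {n : Fin m → ℕ} {R₁ R₂ : ℕ}
    {Ω : Type*} [MeasurableSpace Ω] {P : Measure Ω} (run : Run h F α n R₁ R₂ P)
    (i l : Fin k) (ω : Ω) : ℝ :=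
  1 / (R₂ : ℝ) * ∑ r, (h i (run.ZL i l r ω) - h l (run.ZR i l r ω))

end InputUncertainty

end

/-!
# Coverage of the input-uncertainty confidence bounds

Everything happens on the scale `√N`, where `N` is the average sample size, and each quantity is
reduced to the linear statistic `V_l = √N ∑ p, 𝔼 j, a_l p (X p j)` of the data, where `a_l` is the
difference of the influence functions of Solutions `i` and `l`.

*Linearization.* The influence function of `h` is, almost everywhere, the sum `inflSum` over the slots
of source `p` of the centered projections of `h` (`influence_eq_inflSum`). The mean performance at a
reweighted empirical model is a V-statistic with weights. Its Hoeffding expansion, together with the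
bound `∑ j, (n p * w p j - 1) ^ 2 ≤ Q * (Q + 2)` on the ambiguity set (`ambiguitySet_bounds`, `Q` being
the chi-square quantile), shows that it equals `η + ∑ p, ∑ j, inflSum p (X p j) * w p j` up to `o(1 / √N)`
in probability, whatever weights are chosen (`abs_wMean_sub_le`, `tendsto_linearization_error`). The
second moments of `h` with repeated inputs enter through the coincidences of indices.

*Simulation.* The second-stage error is negligible since `R₂ / N → ∞`. In the first stage, the estimated
influence functions converge in mean square over the data, up to a constant on each source, since
`R₁ / N → ∞` (`tendsto_influenceEstimate_error`). As the data are almost surely distinct, the indicators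
`Z p t = X p j` identify the index that was drawn.

*Optimization.* The optimal weights are never compared with the exact maximizer. They do at least as well
for the estimated functional as the explicit weights `(1 + δ) / n`, where `δ` is proportional to the
centered values of `a_l` and of size just small enough for the weights to lie in the ambiguity set
(`mem_ambiguitySet`). By the Cauchy-Schwarz inequality the estimation error changes the comparison only
by a negligible amount (`sum_mul_weights_ge`), and the gain of these weights over the uniform ones is
`κ σ_l / √N`, for any chosen `κ < √Q`, `σ_l` being the standard deviation of the limit of `V_l`. Hence the
bound covers the difference, with probability tending to one, wherever `V_l > -κ' σ_l`, for any
`κ' < √Q` (`eventually_le_Uhat`).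

*Limit.* By the central limit theorem (`tendsto_sourceAverages`) the vector `(V_l)` converges to a
Gaussian vector `G` with `|G_l| ≤ σ_l ‖ξ‖`, where `ξ` is a standard Gaussian vector in dimension `k - 1`.
Thus all the events `V_l > -κ' σ_l` occur together with asymptotic probability at least that of
`‖ξ‖ < κ'`, which tends to `P(‖ξ‖ ^ 2 < Q) ≥ 1 - α` as `κ'` increases to `√Q`.
-/


noncomputable section

namespace InputUncertainty

set_option linter.unusedSectionVars false

/-! ### Laws of independent samples -/

section ProductLaws

variable {m : ℕ} {S : Fin m → Type*} [∀ p, MeasurableSpace (S p)]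

instance productLaw.instIsProbabilityMeasure (c : Fin m → ℕ) (F : ∀ p, Measure (S p))
    [∀ p, IsProbabilityMeasure (F p)] : IsProbabilityMeasure (productLaw c F) := by
  unfold productLaw; infer_instance

/-- Sampling i.i.d. coordinates along an injection gives i.i.d. coordinates. -/
theorem pi_map_comp_injective {ι κ α : Type*} [Fintype ι] [Fintype κ] [MeasurableSpace α]
    (μ : Measure α) [IsProbabilityMeasure μ] {f : ι → κ} (hf : Function.Injective f) :
    (Measure.pi fun _ : κ => μ).map (fun x i => x (f i)) = Measure.pi fun _ : ι => μ := by
  have h : iIndepFun (fun k (x : κ → α) => x k) (Measure.pi fun _ => μ) :=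
    iIndepFun_pi (X := fun _ => id) fun _ => aemeasurable_id
  have h2 := (iIndepFun_iff_map_fun_eq_pi_map
    (fun i => (measurable_pi_apply (f i)).aemeasurable)).1 (h.precomp hf)
  rw [h2]
  congr 1
  ext1 i
  exact (measurePreserving_eval (fun _ : κ => μ) (f i)).map_eq

/-- A tuple of indices, one for each of the `c p` slots of source `p`. -/
abbrev Idx (n c : Fin m → ℕ) : Type := ∀ s : (Σ p, Fin (c p)), Fin (n s.1)

/-- The array of the data points that a tuple of indices selects. -/
def pick {n c : Fin m → ℕ} (x : Sample S n) (J : Idx n c) : Sample S c :=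
  fun p t => x p (J ⟨p, t⟩)

@[fun_prop]
theorem measurable_pick {n c : Fin m → ℕ} (J : Idx n c) :
    Measurable fun x : Sample S n => pick x J := by
  unfold pick; fun_prop

/-- A tuple of indices selects distinct data points. -/
def Idx.Distinct {n c : Fin m → ℕ} (J : Idx n c) : Prop :=
  ∀ p, Function.Injective fun t => (show Fin (n p) from J ⟨p, t⟩)

theorem map_pick {n c : Fin m → ℕ} (F : ∀ p, Measure (S p)) [∀ p, IsProbabilityMeasure (F p)]
    {J : Idx n c} (hJ : J.Distinct) :
    (productLaw n F).map (fun x => pick x J) = productLaw c F := by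
  unfold productLaw pick
  rw [Measure.pi_map_pi (f := fun p (y : Fin (n p) → S p) t => y (J ⟨p, t⟩))]
  · congr 1
    ext1 p
    exact pi_map_comp_injective (F p) (hJ p)
  · intro p
    exact Measurable.aemeasurable (by fun_prop)

/-- Coordinates of an i.i.d. sample along any map `f` have the law of coordinates, possibly repeated, of an
i.i.d. sample on the index type of `f` itself: a representative of each fiber of `f` is repeated. -/
theorem exists_pi_map_comp_eq {ι κ α : Type*} [Fintype ι] [Fintype κ] [MeasurableSpace α]
    (μ : Measure α) [IsProbabilityMeasure μ] (f : ι → κ) :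
    ∃ g : ι → ι, (Measure.pi fun _ : κ => μ).map (fun x i => x (f i)) =
      (Measure.pi fun _ : ι => μ).map (fun x i => x (g i)) := by
  classical
  have hfac : Measurable fun (y : Set.range f → α) (i : ι) => y (Set.rangeFactorization f i) := by
    fun_prop
  refine ⟨fun i => Set.rangeSplitting f (Set.rangeFactorization f i), ?_⟩
  have h1 := pi_map_comp_injective μ (f := ((↑) : Set.range f → κ)) Subtype.val_injective
  have h2 := pi_map_comp_injective μ (Set.rangeSplitting_injective f)
  have h3 := congrArg (Measure.map fun (y : Set.range f → α) (i : ι) =>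
    y (Set.rangeFactorization f i)) (h1.trans h2.symm)
  rw [Measure.map_map hfac (by fun_prop), Measure.map_map hfac (by fun_prop)] at h3
  exact h3

/-- The law of the data points selected by a tuple of indices is that of an independent sample
with entries repeated in the pattern of the ties among the indices. -/
theorem exists_map_pick_eq {n c : Fin m → ℕ} (F : ∀ p, Measure (S p))
    [∀ p, IsProbabilityMeasure (F p)] (J : Idx n c) :
    ∃ I : ∀ p, Fin (c p) → Fin (c p), (productLaw n F).map (fun x => pick x J) =
      (productLaw c F).map fun z p t => z p (I p t) := by
  choose I hI using fun p => exists_pi_map_comp_eq (F p) fun t => (show Fin (n p) from J ⟨p, t⟩)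
  refine ⟨I, ?_⟩
  unfold productLaw pick
  rw [Measure.pi_map_pi (f := fun p (y : Fin (n p) → S p) t => y (J ⟨p, t⟩)),
    Measure.pi_map_pi (f := fun p (y : Fin (c p) → S p) t => y (I p t))]
  · congr 1
    ext1 p
    exact hI p
  all_goals
    intro p
    exact Measurable.aemeasurable (by fun_prop)

/-- The product law of an array, indexed by all its entries at once. -/
def flatLaw (c : Fin m → ℕ) (F : ∀ p, Measure (S p)) : Measure (∀ s : (Σ p, Fin (c p)), S s.1) :=
  Measure.pi fun s => F s.1

instance flatLaw.instIsProbabilityMeasure (c : Fin m → ℕ) (F : ∀ p, Measure (S p))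
    [∀ p, IsProbabilityMeasure (F p)] : IsProbabilityMeasure (flatLaw c F) := by
  unfold flatLaw; infer_instance

theorem measurePreserving_curry (c : Fin m → ℕ) (F : ∀ p, Measure (S p))
    [∀ p, IsProbabilityMeasure (F p)] :
    MeasurePreserving (fun (z : ∀ s : (Σ p, Fin (c p)), S s.1) p t => z ⟨p, t⟩)
      (flatLaw c F) (productLaw c F) := by
  refine ⟨by fun_prop, ?_⟩
  have h := Measure.infinitePi_map_piCurry (ι := Fin m) (κ := fun p => Fin (c p))
    (X := fun p _ => S p) (fun p _ => F p)
  simp only [Measure.infinitePi_eq_pi] at h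
  exact h

theorem pi_prod_map_ite {ι : Type*} [Fintype ι] {α : ι → Type*} [∀ i, MeasurableSpace (α i)]
    (μ : ∀ i, Measure (α i)) [∀ i, IsProbabilityMeasure (μ i)] (R : ι → Prop) [DecidablePred R] :
    ((Measure.pi μ).prod (Measure.pi μ)).map (fun x i => if R i then x.2 i else x.1 i) =
      Measure.pi μ := by
  symm
  refine Measure.pi_eq fun s hs => ?_
  have hm : Measurable fun (x : (∀ i, α i) × (∀ i, α i)) i => if R i then x.2 i else x.1 i := by
    refine measurable_pi_lambda _ fun i => ?_
    by_cases h : R i <;> simp only [h, if_true, if_false] <;> fun_prop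
  rw [Measure.map_apply hm (MeasurableSet.univ_pi hs)]
  have : (fun (x : (∀ i, α i) × (∀ i, α i)) i => if R i then x.2 i else x.1 i) ⁻¹'
      Set.univ.pi s = (Set.univ.pi fun i => if R i then Set.univ else s i) ×ˢ
        (Set.univ.pi fun i => if R i then s i else Set.univ) := by
    ext x
    simp only [Set.mem_preimage, Set.mem_pi, Set.mem_univ, true_imp_iff, Set.mem_prod,
      ← forall_and]
    refine forall_congr' fun i => ?_
    by_cases h : R i <;> simp [h]
  rw [this, Measure.prod_prod, Measure.pi_pi, Measure.pi_pi, ← Finset.prod_mul_distrib]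
  refine Finset.prod_congr rfl fun i _ => ?_
  by_cases h : R i <;> simp [h]

/-- Replacing some entries of an independent sample by those of an independent copy does not change
its law. -/
theorem map_resample (c : Fin m → ℕ) (F : ∀ p, Measure (S p)) [∀ p, IsProbabilityMeasure (F p)]
    (R : ∀ p, Fin (c p) → Prop) [∀ p, DecidablePred (R p)] :
    ((productLaw c F).prod (productLaw c F)).map
      (fun x p t => if R p t then x.2 p t else x.1 p t) = productLaw c F := by
  have h1 := (measurePreserving_curry c F).prod (measurePreserving_curry c F)
  have h2 := pi_prod_map_ite (fun s : (Σ p, Fin (c p)) => F s.1) (fun s => R s.1 s.2)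
  have hm1 : Measurable fun (x : Sample S c × Sample S c) p t =>
      if R p t then x.2 p t else x.1 p t := by
    refine measurable_pi_lambda _ fun p => measurable_pi_lambda _ fun t => ?_
    by_cases h : R p t <;> simp only [h, if_true, if_false] <;> fun_prop
  have hm2 : Measurable fun (x : (∀ s : (Σ p, Fin (c p)), S s.1) × (∀ s : (Σ p, Fin (c p)), S s.1))
      s => if R s.1 s.2 then x.2 s else x.1 s := by
    refine measurable_pi_lambda _ fun s => ?_
    by_cases h : R s.1 s.2 <;> simp only [h, if_true, if_false] <;> fun_prop
  rw [← h1.map_eq, Measure.map_map hm1 h1.measurable]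
  conv_rhs => rw [← (measurePreserving_curry c F).map_eq, flatLaw, ← h2,
    Measure.map_map (measurePreserving_curry c F).measurable hm2]
  rfl

/-- The array obtained from `z` by putting `y` into the slots `A` of source `p`. -/
def setSlots {c : Fin m → ℕ} (z : Sample S c) (p : Fin m) (A : Finset (Fin (c p))) (y : S p) :
    Sample S c :=
  Function.update z p fun t => if t ∈ A then y else z p t

theorem setSlots_same {c : Fin m → ℕ} (z : Sample S c) (p : Fin m) (A : Finset (Fin (c p)))
    (y : S p) (t : Fin (c p)) : setSlots z p A y p t = if t ∈ A then y else z p t := by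
  simp [setSlots]

theorem setSlots_of_ne {c : Fin m → ℕ} (z : Sample S c) {p p' : Fin m} (hp : p' ≠ p)
    (A : Finset (Fin (c p))) (y : S p) : setSlots z p A y p' = z p' := by
  simp [setSlots, hp]

theorem measurable_setSlots {c : Fin m → ℕ} (p : Fin m) (A : Finset (Fin (c p))) :
    Measurable fun zy : Sample S c × S p => setSlots zy.1 p A zy.2 := by
  refine measurable_pi_lambda _ fun p' => measurable_pi_lambda _ fun t => ?_
  by_cases hp : p' = p
  · subst hp
    by_cases ht : t ∈ A <;> simp only [setSlots_same, ht, if_true, if_false] <;> fun_prop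
  · simp only [setSlots_of_ne _ hp]; fun_prop

@[fun_prop]
theorem measurable_setSlots_left {c : Fin m → ℕ} (p : Fin m) (A : Finset (Fin (c p))) (y : S p) :
    Measurable fun z : Sample S c => setSlots z p A y :=
  (measurable_setSlots p A).comp (measurable_id.prodMk measurable_const)

theorem measurePreserving_eval_eval (c : Fin m → ℕ) (F : ∀ p, Measure (S p))
    [∀ p, IsProbabilityMeasure (F p)] (p : Fin m) (t : Fin (c p)) :
    MeasurePreserving (fun z : Sample S c => z p t) (productLaw c F) (F p) :=
  (measurePreserving_eval (fun _ : Fin (c p) => F p) t).comp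
    (measurePreserving_eval (fun p => Measure.pi fun _ : Fin (c p) => F p) p)

/-- Replacing one entry of an independent sample by an independent point of the same law does not
change the law of the sample. -/
theorem measurePreserving_setSlot (c : Fin m → ℕ) (F : ∀ p, Measure (S p))
    [∀ p, IsProbabilityMeasure (F p)] (p : Fin m) (t : Fin (c p)) :
    MeasurePreserving (fun zy : Sample S c × S p => setSlots zy.1 p {t} zy.2)
      ((productLaw c F).prod (F p)) (productLaw c F) := by
  classical
  refine ⟨measurable_setSlots p {t}, ?_⟩
  have h := map_resample c F fun p' t' => (⟨p', t'⟩ : Σ p, Fin (c p)) = ⟨p, t⟩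
  have h2 := (MeasurePreserving.id (productLaw c F)).prod (measurePreserving_eval_eval c F p t)
  rw [← h2.map_eq, Measure.map_map (measurable_setSlots p {t}) h2.measurable]
  conv_rhs => rw [← h]
  congr 1
  funext x p' t'
  by_cases hp : p' = p
  · subst hp
    by_cases ht : t' = t
    · subst ht; simp [setSlots]
    · simp [setSlots, ht]
  · simp [setSlots, hp]

/-- The projection of `g` onto one slot: its conditional mean given that slot, when the inputs are
independent. -/
def proj {c : Fin m → ℕ} (F : ∀ p, Measure (S p)) (g : Sample S c → ℝ)
    (s : Σ p, Fin (c p)) (y : S s.1) : ℝ :=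
  ∫ z, g (setSlots z s.1 {s.2} y) ∂productLaw c F

theorem measurable_proj {c : Fin m → ℕ} (F : ∀ p, Measure (S p)) [∀ p, IsProbabilityMeasure (F p)]
    {g : Sample S c → ℝ} (hg : Measurable g) (s : Σ p, Fin (c p)) : Measurable (proj F g s) := by
  have : StronglyMeasurable fun yz : S s.1 × Sample S c => g (setSlots yz.2 s.1 {s.2} yz.1) :=
    (hg.comp ((measurable_setSlots s.1 {s.2}).comp measurable_swap)).stronglyMeasurable
  exact (this.integral_prod_right (ν := productLaw c F)).measurable

/-- Square integrability under the law of an independent sample with repeated entries, for every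
pattern of ties. -/
def TieL2 {c : Fin m → ℕ} (F : ∀ p, Measure (S p)) (g : Sample S c → ℝ) : Prop :=
  Measurable g ∧ ∀ I : ∀ p, Fin (c p) → Fin (c p),
    MemLp (fun z : Sample S c => g fun p t => z p (I p t)) 2 (productLaw c F)

theorem measurable_reuse {c : Fin m → ℕ} (I : ∀ p, Fin (c p) → Fin (c p)) :
    Measurable fun (z : Sample S c) p t => z p (I p t) := by fun_prop

theorem TieL2.memLp {c : Fin m → ℕ} {F : ∀ p, Measure (S p)} {g : Sample S c → ℝ}
    (hg : TieL2 F g) : MemLp g 2 (productLaw c F) :=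
  hg.2 fun _ t => t

theorem TieL2.sub {c : Fin m → ℕ} {F : ∀ p, Measure (S p)} {g g' : Sample S c → ℝ}
    (hg : TieL2 F g) (hg' : TieL2 F g') : TieL2 F (fun z => g z - g' z) :=
  ⟨hg.1.sub hg'.1, fun I => (hg.2 I).sub (hg'.2 I)⟩

theorem TieL2.sum {ι : Type*} {c : Fin m → ℕ} {F : ∀ p, Measure (S p)} (A : Finset ι)
    {g : ι → Sample S c → ℝ} (hg : ∀ i, TieL2 F (g i)) : TieL2 F (fun z => ∑ i ∈ A, g i z) :=
  ⟨Finset.measurable_sum _ fun i _ => (hg i).1, fun I => memLp_finsetSum _ fun i _ => (hg i).2 I⟩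

theorem tieL2_const {c : Fin m → ℕ} {F : ∀ p, Measure (S p)} [∀ p, IsProbabilityMeasure (F p)]
    (a : ℝ) : TieL2 F (fun _ : Sample S c => a) :=
  ⟨measurable_const, fun _ => memLp_const a⟩

theorem tieL2_eval {c : Fin m → ℕ} {F : ∀ p, Measure (S p)} [∀ p, IsProbabilityMeasure (F p)]
    (s : Σ p, Fin (c p)) {f : S s.1 → ℝ} (hf : Measurable f) (hf2 : MemLp f 2 (F s.1)) :
    TieL2 F (fun z : Sample S c => f (z s.1 s.2)) :=
  ⟨by fun_prop, fun I => hf2.comp_measurePreserving (measurePreserving_eval_eval c F s.1 _)⟩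

theorem TieL2.memLp_pick {c n : Fin m → ℕ} {F : ∀ p, Measure (S p)}
    [∀ p, IsProbabilityMeasure (F p)] {g : Sample S c → ℝ} (hg : TieL2 F g) (J : Idx n c) :
    MemLp (fun x => g (pick x J)) 2 (productLaw n F) := by
  obtain ⟨I, hI⟩ := exists_map_pick_eq F J
  have h1 : MemLp g 2 ((productLaw c F).map fun z p t => z p (I p t)) :=
    (memLp_map_measure_iff hg.1.aestronglyMeasurable (measurable_reuse I).aemeasurable).2 (hg.2 I)
  rw [← hI] at h1
  exact h1.comp_of_map (measurable_pick J).aemeasurable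

/-- A bound for the second moments of `g` under all patterns of ties. -/
def tieBound {c : Fin m → ℕ} (F : ∀ p, Measure (S p)) (g : Sample S c → ℝ) : ℝ :=
  ∑ I : ∀ p, Fin (c p) → Fin (c p), ∫ z, g (fun p t => z p (I p t)) ^ 2 ∂productLaw c F

theorem tieBound_nonneg {c : Fin m → ℕ} (F : ∀ p, Measure (S p)) (g : Sample S c → ℝ) :
    0 ≤ tieBound F g :=
  Finset.sum_nonneg fun _ _ => integral_nonneg fun _ => sq_nonneg _

theorem integral_sq_pick_le {c n : Fin m → ℕ} {F : ∀ p, Measure (S p)}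
    [∀ p, IsProbabilityMeasure (F p)] {g : Sample S c → ℝ} (hg : Measurable g) (J : Idx n c) :
    ∫ x, g (pick x J) ^ 2 ∂productLaw n F ≤ tieBound F g := by
  obtain ⟨I, hI⟩ := exists_map_pick_eq F J
  have h2 : Measurable fun z => g z ^ 2 := hg.pow_const 2
  have : ∫ x, g (pick x J) ^ 2 ∂productLaw n F =
      ∫ z, g (fun p t => z p (I p t)) ^ 2 ∂productLaw c F := by
    rw [← integral_map (f := fun z => g z ^ 2) (measurable_pick J).aemeasurable
        h2.aestronglyMeasurable, hI,
      integral_map (measurable_reuse I).aemeasurable h2.aestronglyMeasurable]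
  rw [this]
  exact Finset.single_le_sum (f := fun I : ∀ p, Fin (c p) → Fin (c p) =>
    ∫ z, g (fun p t => z p (I p t)) ^ 2 ∂productLaw c F)
    (fun _ _ => integral_nonneg fun _ => sq_nonneg _) (Finset.mem_univ I)

end ProductLaws

/-! ### Averages over tuples of indices -/

section Averages

open scoped BigOperators

/-- A uniformly random tuple may have one of its coordinates drawn afresh. -/
theorem expect_update {ι : Type*} [Fintype ι] [DecidableEq ι] {α : ι → Type*}
    [∀ i, Fintype (α i)] (b : ι) [Nonempty (α b)] (f : (∀ i, α i) → ℝ) :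
    𝔼 J, f J = 𝔼 J, 𝔼 j, f (Function.update J b j) := by
  have h1 : 𝔼 J, 𝔼 j, f (Function.update J b j) =
      𝔼 x : (∀ i, α i) × α b, f (Function.update x.1 b x.2) :=
    (Finset.expect_product' (s := Finset.univ) (t := Finset.univ)
      (f := fun J j => f (Function.update J b j))).symm
  have h2 : 𝔼 x : (∀ i, α i) × α b, f x.1 = 𝔼 J, f J := by
    have := Finset.expect_product' (s := Finset.univ) (t := (Finset.univ : Finset (α b)))
      (f := fun (J : ∀ i, α i) _ => f J)
    simp only [Fintype.expect_const] at this
    exact this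
  rw [h1, ← h2]
  refine Fintype.expect_equiv
    ⟨fun x => (Function.update x.1 b x.2, x.1 b), fun x => (Function.update x.1 b x.2, x.1 b),
      fun x => by simp, fun x => by simp⟩ _ _ fun x => ?_
  simp

theorem expect_prod_eq {ι : Type*} [Fintype ι] [DecidableEq ι] {α : ι → Type*}
    [∀ i, Fintype (α i)] (f : ∀ i, α i → ℝ) :
    𝔼 J : ∀ i, α i, ∏ i, f i (J i) = ∏ i, 𝔼 j, f i j := by
  simp only [Fintype.expect_eq_sum_div_card]
  rw [Finset.prod_div_distrib, Finset.prod_univ_sum, Fintype.card_pi, Fintype.piFinset_univ]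
  push_cast
  rfl

theorem integral_expect {X ι : Type*} [MeasurableSpace X] {μ : Measure X} [Fintype ι]
    {f : ι → X → ℝ} (hf : ∀ i, Integrable (f i) μ) :
    ∫ x, 𝔼 i, f i x ∂μ = 𝔼 i, ∫ x, f i x ∂μ := by
  simp only [Fintype.expect_eq_sum_div_card]
  rw [integral_div, integral_finsetSum _ fun i _ => hf i]

theorem integrable_expect {X ι : Type*} [MeasurableSpace X] {μ : Measure X} [Fintype ι]
    {f : ι → X → ℝ} (hf : ∀ i, Integrable (f i) μ) :
    Integrable (fun x => 𝔼 i, f i x) μ := by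
  simp only [Fintype.expect_eq_sum_div_card]
  exact (integrable_finsetSum _ fun i _ => hf i).div_const _

theorem sq_expect_le {ι : Type*} [Fintype ι] (f g : ι → ℝ) :
    (𝔼 i, f i * g i) ^ 2 ≤ (𝔼 i, f i ^ 2) * 𝔼 i, g i ^ 2 :=
  Finset.expect_mul_sq_le_sq_mul_sq _ _ _

theorem sq_expect_eq {ι : Type*} [Fintype ι] (f : ι → ℝ) :
    (𝔼 i, f i) ^ 2 = 𝔼 i, 𝔼 j, f i * f j := by
  rw [sq, Fintype.expect_mul_expect]

variable {m : ℕ} {n c : Fin m → ℕ}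

/-- The data point, as a pair of a source and an index, that a tuple of indices selects in a
slot. -/
def tag (J : Idx n c) (s : Σ p, Fin (c p)) : Σ p, Fin (n p) := ⟨s.1, J s⟩

theorem tag_update_of_ne (J : Idx n c) {s b : Σ p, Fin (c p)} (h : s ≠ b) (j : Fin (n b.1)) :
    tag (Function.update J b j) s = tag J s := by
  simp [tag, h]

theorem Idx.distinct_iff (J : Idx n c) : J.Distinct ↔ Function.Injective (tag J) := by
  constructor
  · rintro h ⟨p, t⟩ ⟨p', t'⟩ hst
    obtain ⟨rfl, h2⟩ := Sigma.mk.inj_iff.1 hst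
    rw [h p (eq_of_heq h2)]
  · intro h p t t' htt
    have h2 : tag J ⟨p, t⟩ = tag J ⟨p, t'⟩ := by
      simp only [tag]
      exact congrArg (Sigma.mk p) htt
    simpa using h h2

theorem expect_indicator_sigma_le {b : Fin m} (hb : 0 < n b) (d : Σ p, Fin (n p)) :
    𝔼 j : Fin (n b), (if (⟨b, j⟩ : Σ p, Fin (n p)) = d then (1 : ℝ) else 0) ≤ 1 / n b := by
  rw [Fintype.expect_eq_sum_div_card, Fintype.card_fin]
  gcongr
  rw [Finset.sum_boole]
  have : (Finset.univ.filter fun j : Fin (n b) => (⟨b, j⟩ : Σ p, Fin (n p)) = d).card ≤ 1 := by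
    refine Finset.card_le_one.2 fun i hi j hj => ?_
    simp only [Finset.mem_filter, Finset.mem_univ, true_and] at hi hj
    simpa using hi.trans hj.symm
  exact_mod_cast this

/-- A uniformly random index tuple hits, in a given slot, a target that does not depend on the
index in that slot with probability at most the inverse of the sample size. -/
theorem expect_mul_tag_eq_le (hn : ∀ p, 0 < n p) (b : Σ p, Fin (c p)) (G : Idx n c → ℝ)
    (hG : ∀ J, 0 ≤ G J) (hGu : ∀ J j, G (Function.update J b j) = G J)
    (d : Idx n c → Σ p, Fin (n p)) (hd : ∀ J j, d (Function.update J b j) = d J) :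
    𝔼 J, G J * (if tag J b = d J then (1 : ℝ) else 0) ≤ (𝔼 J, G J) * (1 / n b.1) := by
  have : Nonempty (Fin (n b.1)) := ⟨⟨0, hn b.1⟩⟩
  rw [expect_update b, Finset.expect_mul]
  refine Finset.expect_le_expect fun J _ => ?_
  simp only [hGu, hd]
  rw [← Finset.mul_expect]
  refine mul_le_mul_of_nonneg_left ?_ (hG J)
  have h := expect_indicator_sigma_le (hn b.1) (d J)
  simpa [tag] using h

theorem expect_tag_eq_le (hn : ∀ p, 0 < n p) (b : Σ p, Fin (c p))
    (d : Idx n c → Σ p, Fin (n p)) (hd : ∀ J j, d (Function.update J b j) = d J) :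
    𝔼 J, (if tag J b = d J then (1 : ℝ) else 0) ≤ 1 / n b.1 := by
  have : ∀ s : Σ p, Fin (c p), Nonempty (Fin (n s.1)) := fun s => ⟨⟨0, hn s.1⟩⟩
  have h := expect_mul_tag_eq_le hn b (fun _ => 1) (fun _ => zero_le_one) (fun _ _ => rfl) d hd
  simpa using h

theorem expect_slot_eq (hn : ∀ p, 0 < n p) (s : Σ p, Fin (c p)) (f : Fin (n s.1) → ℝ) :
    𝔼 J : Idx n c, f (J s) = 𝔼 j, f j := by
  have : ∀ s : Σ p, Fin (c p), Nonempty (Fin (n s.1)) := fun s => ⟨⟨0, hn s.1⟩⟩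
  rw [expect_update s]
  simp

end Averages

/-! ### Degenerate V-statistics -/

section Degenerate

open scoped BigOperators

variable {m : ℕ} {S : Fin m → Type*} [∀ p, MeasurableSpace (S p)] {n c : Fin m → ℕ}
  {F : ∀ p, Measure (S p)} [∀ p, IsProbabilityMeasure (F p)] {g : Sample S c → ℝ}

/-- If the projection of `g` onto the slot `s₀` vanishes, then `g`, evaluated at distinct data
points, is uncorrelated with every statistic that, among these points, involves at most the one in
slot `s₀`. -/
theorem integral_mul_pick_eq_zero (hg : TieL2 F g) {J : Idx n c} (hJ : J.Distinct)
    (s₀ : Σ p, Fin (c p)) (hproj : ∀ᵐ y ∂F s₀.1, proj F g s₀ y = 0)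
    {u : Sample S n → ℝ} (hu : MemLp u 2 (productLaw n F)) (hum : Measurable u)
    (hdep : ∀ x x' : Sample S n,
      (∀ p j, (∀ s, s ≠ s₀ → tag J s ≠ ⟨p, j⟩) → x p j = x' p j) → u x = u x') :
    ∫ x, u x * g (pick x J) ∂productLaw n F = 0 := by
  classical
  have hinj := J.distinct_iff.1 hJ
  -- draw all the data points in slots other than `s₀` afresh: by independence this changes neither the
  -- law nor the value of `u`, and averaging over the new points gives the projection
  let R : ∀ p, Fin (n p) → Prop := fun p j => ∃ s, s ≠ s₀ ∧ tag J s = ⟨p, j⟩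
  let mix : Sample S n × Sample S n → Sample S n :=
    fun x p j => if R p j then x.2 p j else x.1 p j
  have hmix : ((productLaw n F).prod (productLaw n F)).map mix = productLaw n F :=
    map_resample n F R
  have hmixm : Measurable mix := by
    refine measurable_pi_lambda _ fun p => measurable_pi_lambda _ fun j => ?_
    by_cases h : R p j <;> simp only [mix, h, if_true, if_false] <;> fun_prop
  have hgm : Measurable fun x : Sample S n => g (pick x J) := hg.1.comp (measurable_pick J)
  have hpm : Measurable fun x : Sample S n => u x * g (pick x J) := hum.mul hgm
  have hint : Integrable (fun x => u x * g (pick x J)) (productLaw n F) :=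
    hu.integrable_mul (hg.memLp_pick J)
  have key : ∀ x : Sample S n × Sample S n, u (mix x) * g (pick (mix x) J) =
      u x.1 * g (setSlots (pick x.2 J) s₀.1 {s₀.2} (x.1 s₀.1 (J s₀))) := by
    intro x
    congr 1
    · refine hdep _ _ fun p j h => ?_
      have : ¬ R p j := by rintro ⟨s, hs, hst⟩; exact h s hs hst
      simp only [mix, this, if_false]
    · congr 1
      funext p t
      by_cases hs : (⟨p, t⟩ : Σ p, Fin (c p)) = s₀
      · subst hs
        have : ¬ R p (J ⟨p, t⟩) := by
          rintro ⟨s, hs, hst⟩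
          exact hs (hinj hst)
        simp only [pick, mix, this, if_false]
        simp [setSlots]
      · have : R p (J ⟨p, t⟩) := ⟨⟨p, t⟩, hs, rfl⟩
        simp only [pick, mix, this, if_true]
        by_cases hp : p = s₀.1
        · obtain ⟨p₀, t₀⟩ := s₀
          subst hp
          have ht : t ≠ t₀ := fun h => hs (by rw [h])
          simp [setSlots, ht, pick]
        · rw [setSlots_of_ne _ hp]; rfl
  calc ∫ x, u x * g (pick x J) ∂productLaw n F
      = ∫ x, u (mix x) * g (pick (mix x) J) ∂((productLaw n F).prod (productLaw n F)) := by
        conv_lhs => rw [← hmix]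
        exact integral_map hmixm.aemeasurable hpm.aestronglyMeasurable
    _ = ∫ x, u x.1 * g (setSlots (pick x.2 J) s₀.1 {s₀.2} (x.1 s₀.1 (J s₀)))
          ∂((productLaw n F).prod (productLaw n F)) := by simp only [key]
    _ = ∫ x, u x * proj F g s₀ (x s₀.1 (J s₀)) ∂productLaw n F := by
        have hint2 : Integrable (fun x : Sample S n × Sample S n =>
            u x.1 * g (setSlots (pick x.2 J) s₀.1 {s₀.2} (x.1 s₀.1 (J s₀))))
            ((productLaw n F).prod (productLaw n F)) := by
          simp only [← key]
          rw [← hmix] at hint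
          exact hint.comp_measurable hmixm
        rw [integral_prod _ hint2]
        refine integral_congr_ae (ae_of_all _ fun x => ?_)
        simp only
        rw [integral_const_mul]
        congr 1
        rw [proj, ← map_pick F hJ, integral_map (measurable_pick J).aemeasurable]
        exact (hg.1.comp (measurable_setSlots_left _ _ _)).aestronglyMeasurable
    _ = 0 := by
        refine integral_eq_zero_of_ae ?_
        have h := (measurePreserving_eval_eval n F s₀.1 (J s₀)).quasiMeasurePreserving.ae hproj
        filter_upwards [h] with x hx
        simp [hx]

theorem abs_integral_mul_pick_le (hg : TieL2 F g) (J J' : Idx n c) :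
    |∫ x, g (pick x J) * g (pick x J') ∂productLaw n F| ≤ tieBound F g := by
  have h1 := hg.memLp_pick (n := n) J
  have h2 := hg.memLp_pick (n := n) J'
  have i1 := h1.integrable_sq
  have i2 := h2.integrable_sq
  have b1 := integral_sq_pick_le (F := F) hg.1 J
  have b2 := integral_sq_pick_le (F := F) hg.1 J'
  calc |∫ x, g (pick x J) * g (pick x J') ∂productLaw n F|
      ≤ ∫ x, |g (pick x J) * g (pick x J')| ∂productLaw n F := abs_integral_le_integral_abs
    _ ≤ ∫ x, (g (pick x J) ^ 2 + g (pick x J') ^ 2) / 2 ∂productLaw n F := by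
        refine integral_mono (h1.integrable_mul h2).abs ((i1.add i2).div_const 2) fun x => ?_
        simp only [abs_mul]
        nlinarith [sq_nonneg (|g (pick x J)| - |g (pick x J')|), sq_abs (g (pick x J)),
          sq_abs (g (pick x J'))]
    _ = ((∫ x, g (pick x J) ^ 2 ∂productLaw n F) + ∫ x, g (pick x J') ^ 2 ∂productLaw n F) / 2 := by
        rw [integral_div, integral_add i1 i2]
    _ ≤ tieBound F g := by linarith

/-- Values of `g` at two index tuples are uncorrelated if the second tuple is distinct and meets the first
one at most in a slot onto which the projection of `g` vanishes. -/
theorem integral_mul_pick_eq_zero' (hg : TieL2 F g) {J J' : Idx n c} (hJ' : J'.Distinct)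
    (s₀ : Σ p, Fin (c p)) (hproj : ∀ᵐ y ∂F s₀.1, proj F g s₀ y = 0)
    (h : ∀ s a, s ≠ s₀ → tag J' s ≠ tag J a) :
    ∫ x, g (pick x J) * g (pick x J') ∂productLaw n F = 0 := by
  refine integral_mul_pick_eq_zero hg hJ' s₀ hproj (hg.memLp_pick J)
    (hg.1.comp (measurable_pick J)) fun x x' hx => ?_
  congr 1
  funext p t
  exact hx p _ fun s hs => h s ⟨p, t⟩ hs

/-- Two index tuples for which a completely degenerate kernel can have correlated values share at
least two coincidences. -/
theorem coincidences_of_integral_ne_zero (hg : TieL2 F g) (s₁ : Σ p, Fin (c p))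
    (hproj : ∀ s : Σ p, Fin (c p), ∀ᵐ y ∂F s.1, proj F g s y = 0) (J J' : Idx n c)
    (h : ∫ x, g (pick x J) * g (pick x J') ∂productLaw n F ≠ 0) :
    ∃ a b s t : Σ p, Fin (c p), (a ≠ b ∧ s ≠ t ∧ tag J a = tag J b ∧ tag J' s = tag J' t) ∨
      (s ≠ t ∧ tag J' s = tag J a ∧ tag J' t = tag J b) := by
  have main : ∀ J J' : Idx n c, J'.Distinct →
      (∫ x, g (pick x J) * g (pick x J') ∂productLaw n F ≠ 0) →
      ∃ a b s t : Σ p, Fin (c p), s ≠ t ∧ tag J' s = tag J a ∧ tag J' t = tag J b := by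
    intro J J' hJ' hne
    by_contra! hcon
    apply hne
    by_cases hex : ∃ s a, tag J' s = tag J a
    · obtain ⟨s, a, hsa⟩ := hex
      exact integral_mul_pick_eq_zero' hg hJ' s (hproj s) fun t b hts htb =>
        hcon a b s t hts.symm hsa htb
    · push Not at hex
      exact integral_mul_pick_eq_zero' hg hJ' s₁ (hproj s₁) fun t b _ => hex t b
  by_cases hJ' : J'.Distinct
  · obtain ⟨a, b, s, t, h1⟩ := main J J' hJ' h
    exact ⟨a, b, s, t, Or.inr h1⟩
  · by_cases hJ : J.Distinct
    · obtain ⟨a, b, s, t, h1, h2, h3⟩ := main J' J hJ (by simpa [mul_comm] using h)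
      refine ⟨s, t, a, b, Or.inr ⟨?_, h2.symm, h3.symm⟩⟩
      rintro rfl
      exact h1 (J.distinct_iff.1 hJ (h2.trans h3.symm))
    · rw [Idx.distinct_iff, Function.Injective] at hJ hJ'
      push Not at hJ hJ'
      obtain ⟨a, b, hab, hab'⟩ := hJ
      obtain ⟨s, t, hst, hst'⟩ := hJ'
      exact ⟨a, b, s, t, Or.inl ⟨hab', hst', hab, hst⟩⟩

/-- **Degenerate V-statistics.** If all projections of `g` onto single slots vanish, then the
V-statistic with kernel `g` has second moment of order `r⁻²`, where `r` bounds the sample sizes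
from below. -/
theorem integral_sq_vStat_le (hg : TieL2 F g) (s₁ : Σ p, Fin (c p))
    (hproj : ∀ s : Σ p, Fin (c p), ∀ᵐ y ∂F s.1, proj F g s y = 0)
    {r : ℝ} (hr : 0 < r) (hn : ∀ p, r ≤ n p) :
    ∫ x, (𝔼 J : Idx n c, g (pick x J)) ^ 2 ∂productLaw n F ≤
      2 * tieBound F g * (Fintype.card (Σ p, Fin (c p)) : ℝ) ^ 4 / r ^ 2 := by
  have hn0 : ∀ p, 0 < n p := fun p => by exact_mod_cast hr.trans_le (hn p)
  have hinv : ∀ p, 1 / (n p : ℝ) ≤ 1 / r := fun p => one_div_le_one_div_of_le hr (hn p)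
  have : ∀ s : Σ p, Fin (c p), Nonempty (Fin (n s.1)) := fun s => ⟨⟨0, hn0 s.1⟩⟩
  have hint : ∀ J J' : Idx n c, Integrable (fun x => g (pick x J) * g (pick x J'))
      (productLaw n F) := fun J J' => (hg.memLp_pick J).integrable_mul (hg.memLp_pick J')
  simp only [sq_expect_eq]
  rw [integral_expect fun J => integrable_expect fun J' => hint J J']
  simp only [integral_expect fun J' => hint _ J']
  -- `A` marks a coincidence inside one tuple, `B` a pair of coincidences between two tuples; each single
  -- coincidence has probability at most `1 / r`
  let A : Idx n c → (Σ p, Fin (c p)) → (Σ p, Fin (c p)) → ℝ := fun J a b =>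
    if a ≠ b then (if tag J b = tag J a then 1 else 0) else 0
  let B : Idx n c → Idx n c → (a b s t : Σ p, Fin (c p)) → ℝ := fun J J' a b s t =>
    if s ≠ t then (if tag J' s = tag J a then 1 else 0) * (if tag J' t = tag J b then 1 else 0)
      else 0
  have hA0 : ∀ J a b, 0 ≤ A J a b := fun J a b => by simp only [A]; split_ifs <;> simp
  have hB0 : ∀ J J' a b s t, 0 ≤ B J J' a b s t := fun J J' a b s t => by
    simp only [B]; split_ifs <;> simp
  have hAe : ∀ a b, 𝔼 J, A J a b ≤ 1 / r := by
    intro a b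
    by_cases hab : a = b
    · simp [A, hab, hr.le]
    · simp only [A, ne_eq, hab, not_false_eq_true, if_true]
      exact (expect_tag_eq_le hn0 b (fun J => tag J a)
        fun J j => tag_update_of_ne J hab j).trans (hinv _)
  have hBe : ∀ J a b s t, 𝔼 J', B J J' a b s t ≤ 1 / r * (1 / r) := by
    intro J a b s t
    by_cases hst : s = t
    · simp only [B, hst, ne_eq, not_true_eq_false, if_false, Finset.expect_const_zero]
      positivity
    · simp only [B, ne_eq, hst, not_false_eq_true, if_true]
      refine (expect_mul_tag_eq_le hn0 t (fun J' => if tag J' s = tag J a then (1 : ℝ) else 0)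
        (fun J => by split_ifs <;> simp) (fun J j => by rw [tag_update_of_ne J hst j])
        (fun _ => tag J b) (fun _ _ => rfl)).trans ?_
      refine mul_le_mul ?_ (hinv _) (by positivity) (by positivity)
      exact (expect_tag_eq_le hn0 s (fun _ => tag J a) fun _ _ => rfl).trans (hinv _)
  have hpt : ∀ J J' : Idx n c, ∫ x, g (pick x J) * g (pick x J') ∂productLaw n F ≤
      tieBound F g * ∑ a, ∑ b, ∑ s, ∑ t, (A J a b * A J' s t + B J J' a b s t) := by
    intro J J'
    have hnn : ∀ a b s t, 0 ≤ A J a b * A J' s t + B J J' a b s t := fun a b s t =>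
      add_nonneg (mul_nonneg (hA0 _ _ _) (hA0 _ _ _)) (hB0 _ _ _ _ _ _)
    by_cases h0 : ∫ x, g (pick x J) * g (pick x J') ∂productLaw n F = 0
    · rw [h0]
      exact mul_nonneg (tieBound_nonneg F g) (Finset.sum_nonneg fun a _ => Finset.sum_nonneg
        fun b _ => Finset.sum_nonneg fun s _ => Finset.sum_nonneg fun t _ => hnn a b s t)
    · obtain ⟨a, b, s, t, hex⟩ := coincidences_of_integral_ne_zero hg s₁ hproj J J' h0
      have h1 : (1 : ℝ) ≤ A J a b * A J' s t + B J J' a b s t := by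
        rcases hex with ⟨h1, h2, h3, h4⟩ | ⟨h1, h2, h3⟩
        · have : A J a b * A J' s t = 1 := by simp [A, h1, h2, h3, h4]
          linarith [hB0 J J' a b s t]
        · have : B J J' a b s t = 1 := by simp [B, h1, h2, h3]
          have := mul_nonneg (hA0 J a b) (hA0 J' s t)
          linarith
      have h2 : (1 : ℝ) ≤ ∑ a, ∑ b, ∑ s, ∑ t, (A J a b * A J' s t + B J J' a b s t) := by
        refine h1.trans ?_
        refine le_trans ?_ (Finset.single_le_sum (f := fun a => ∑ b, ∑ s, ∑ t,
          (A J a b * A J' s t + B J J' a b s t)) (fun a _ => Finset.sum_nonneg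
          fun b _ => Finset.sum_nonneg fun s _ => Finset.sum_nonneg fun t _ => hnn a b s t)
          (Finset.mem_univ a))
        refine le_trans ?_ (Finset.single_le_sum (f := fun b => ∑ s, ∑ t,
          (A J a b * A J' s t + B J J' a b s t)) (fun b _ => Finset.sum_nonneg
          fun s _ => Finset.sum_nonneg fun t _ => hnn a b s t) (Finset.mem_univ b))
        refine le_trans ?_ (Finset.single_le_sum (f := fun s => ∑ t,
          (A J a b * A J' s t + B J J' a b s t)) (fun s _ => Finset.sum_nonneg
          fun t _ => hnn a b s t) (Finset.mem_univ s))
        exact Finset.single_le_sum (f := fun t => A J a b * A J' s t + B J J' a b s t)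
          (fun t _ => hnn a b s t) (Finset.mem_univ t)
      have h3 := (le_abs_self _).trans (abs_integral_mul_pick_le hg J J')
      nlinarith [tieBound_nonneg F g]
  calc 𝔼 J : Idx n c, 𝔼 J' : Idx n c, ∫ x, g (pick x J) * g (pick x J') ∂productLaw n F
      ≤ 𝔼 J : Idx n c, 𝔼 J' : Idx n c, tieBound F g *
          ∑ a, ∑ b, ∑ s, ∑ t, (A J a b * A J' s t + B J J' a b s t) :=
        Finset.expect_le_expect fun J _ => Finset.expect_le_expect fun J' _ => hpt J J'
    _ = tieBound F g * ∑ a, ∑ b, ∑ s, ∑ t,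
          ((𝔼 J : Idx n c, A J a b) * (𝔼 J' : Idx n c, A J' s t) +
            𝔼 J : Idx n c, 𝔼 J' : Idx n c, B J J' a b s t) := by
        simp only [← Finset.mul_expect, Finset.expect_sum_comm, Finset.expect_add_distrib,
          Fintype.expect_mul_expect]
    _ ≤ tieBound F g * ∑ a : (Σ p, Fin (c p)), ∑ b : (Σ p, Fin (c p)), ∑ s : (Σ p, Fin (c p)),
          ∑ t : (Σ p, Fin (c p)), (1 / r * (1 / r) + 1 / r * (1 / r)) := by
        refine mul_le_mul_of_nonneg_left ?_ (tieBound_nonneg F g)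
        refine Finset.sum_le_sum fun a _ => Finset.sum_le_sum fun b _ => Finset.sum_le_sum
          fun s _ => Finset.sum_le_sum fun t _ => add_le_add ?_ ?_
        · exact mul_le_mul (hAe a b) (hAe s t)
            (Finset.expect_nonneg fun J _ => hA0 J s t) (by positivity)
        · exact Finset.expect_le Finset.univ_nonempty (fun J _ => hBe J a b s t)
    _ = 2 * tieBound F g * (Fintype.card (Σ p, Fin (c p)) : ℝ) ^ 4 / r ^ 2 := by
        simp only [Finset.sum_const, nsmul_eq_mul, Finset.card_univ]
        ring

/-- The mean of `g` over all index tuples with index `j` in the slot `s`. -/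
def slotMean (g : Sample S c → ℝ) (x : Sample S n) (s : Σ p, Fin (c p)) (j : Fin (n s.1)) : ℝ :=
  𝔼 J : Idx n c, (n s.1 * if J s = j then 1 else 0) * g (pick x J)

/-- If the projection of `g` onto the slot `s₀` vanishes, then so do the slot means of `g` at
`s₀`, in mean square and at the rate `r⁻¹`, where `r` bounds the sample sizes from below. -/
theorem integral_sq_slotMean_le (hg : TieL2 F g) (s₀ : Σ p, Fin (c p))
    (hproj : ∀ᵐ y ∂F s₀.1, proj F g s₀ y = 0)
    {r : ℝ} (hr : 0 < r) (hn : ∀ p, r ≤ n p) :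
    ∫ x, 𝔼 j, slotMean g x s₀ j ^ 2 ∂productLaw n F ≤
      2 * tieBound F g * (Fintype.card (Σ p, Fin (c p)) : ℝ) ^ 2 / r := by
  have hn0 : ∀ p, 0 < n p := fun p => by exact_mod_cast hr.trans_le (hn p)
  have hinv : ∀ p, 1 / (n p : ℝ) ≤ 1 / r := fun p => one_div_le_one_div_of_le hr (hn p)
  have hne : ∀ s : Σ p, Fin (c p), Nonempty (Fin (n s.1)) := fun s => ⟨⟨0, hn0 s.1⟩⟩
  have hint : ∀ J J' : Idx n c, Integrable (fun x => g (pick x J) * g (pick x J'))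
      (productLaw n F) := fun J J' => (hg.memLp_pick J).integrable_mul (hg.memLp_pick J')
  let e : Idx n c → Fin (n s₀.1) → ℝ := fun J j => if J s₀ = j then 1 else 0
  let N : ℝ := n s₀.1
  have hN : 0 < N := by simpa [N] using hn0 s₀.1
  have he0 : ∀ J j, 0 ≤ e J j := fun J j => by simp only [e]; split_ifs <;> simp
  have hee : ∀ j, 𝔼 J, e J j = 1 / N := by
    intro j
    rw [expect_slot_eq hn0 s₀ fun i => if i = j then (1 : ℝ) else 0,
      Fintype.expect_eq_sum_div_card]
    simp [N]
  have hsq : ∀ x j, slotMean g x s₀ j ^ 2 = 𝔼 J : Idx n c, 𝔼 J' : Idx n c,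
      N ^ 2 * e J j * e J' j * (g (pick x J) * g (pick x J')) := by
    intro x j
    rw [slotMean, sq_expect_eq]
    refine Finset.expect_congr rfl fun J _ => Finset.expect_congr rfl fun J' _ => ?_
    simp only [N, e]
    ring
  simp only [hsq]
  have hint2 : ∀ j (J J' : Idx n c), Integrable (fun x =>
      N ^ 2 * e J j * e J' j * (g (pick x J) * g (pick x J'))) (productLaw n F) :=
    fun j J J' => (hint J J').const_mul _
  rw [integral_expect fun j => integrable_expect fun J => integrable_expect fun J' => hint2 j J J']
  simp only [integral_expect fun J => integrable_expect fun J' => hint2 _ J J',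
    integral_expect fun J' => hint2 _ _ J', integral_const_mul]
  -- both tuples have index `j` in the slot `s₀`; here one further coincidence is needed, inside the second
  -- tuple (`A`) or between the tuples (`B`)
  let A : Idx n c → (Σ p, Fin (c p)) → (Σ p, Fin (c p)) → ℝ := fun J a b =>
    if b ≠ s₀ ∧ a ≠ b then (if tag J b = tag J a then 1 else 0) else 0
  let B : Idx n c → Idx n c → (a s : Σ p, Fin (c p)) → ℝ := fun J J' a s =>
    if s ≠ s₀ then (if tag J' s = tag J a then 1 else 0) else 0
  have hA0 : ∀ J a b, 0 ≤ A J a b := fun J a b => by simp only [A]; split_ifs <;> simp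
  have hB0 : ∀ J J' a b, 0 ≤ B J J' a b := fun J J' a s => by
    simp only [B]; split_ifs <;> simp
  have hAe : ∀ j a b, 𝔼 J, e J j * A J a b ≤ 1 / N * (1 / r) := by
    intro j a b
    by_cases hab : b ≠ s₀ ∧ a ≠ b
    · simp only [A, hab, ne_eq, not_false_eq_true, and_self, if_true]
      refine (expect_mul_tag_eq_le hn0 b (fun J => e J j) (fun J => he0 J j)
        (fun J i => by simp [e, hab.1.symm]) (fun J => tag J a)
        fun J j => tag_update_of_ne J hab.2 j).trans ?_
      rw [hee]
      exact mul_le_mul_of_nonneg_left (hinv _) (by positivity)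
    · simp only [A, hab, if_false, mul_zero, Finset.expect_const_zero]
      positivity
  have hBe : ∀ j J a s, 𝔼 J', e J' j * B J J' a s ≤ 1 / N * (1 / r) := by
    intro j J a s
    by_cases hs : s ≠ s₀
    · simp only [B, hs, ne_eq, not_false_eq_true, if_true]
      refine (expect_mul_tag_eq_le hn0 s (fun J => e J j) (fun J => he0 J j)
        (fun J i => by simp [e, hs.symm]) (fun _ => tag J a) fun _ _ => rfl).trans ?_
      rw [hee]
      exact mul_le_mul_of_nonneg_left (hinv _) (by positivity)
    · simp only [B, hs, if_false, mul_zero, Finset.expect_const_zero]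
      positivity
  have hpt : ∀ J J' : Idx n c, ∫ x, g (pick x J) * g (pick x J') ∂productLaw n F ≤
      tieBound F g * ∑ a, ∑ b, (A J' a b + B J J' a b) := by
    intro J J'
    have hnn : ∀ a b, 0 ≤ A J' a b + B J J' a b := fun a b => add_nonneg (hA0 _ _ _) (hB0 _ _ _ _)
    by_cases h0 : ∫ x, g (pick x J) * g (pick x J') ∂productLaw n F = 0
    · rw [h0]
      exact mul_nonneg (tieBound_nonneg F g)
        (Finset.sum_nonneg fun a _ => Finset.sum_nonneg fun b _ => hnn a b)
    · have hex : ∃ a b, 1 ≤ A J' a b + B J J' a b := by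
        by_cases hJ' : J'.Distinct
        · by_contra! hcon
          refine h0 (integral_mul_pick_eq_zero' hg hJ' s₀ hproj fun s a hs hsa => ?_)
          have h1 : B J J' a s = 1 := by simp [B, hs, hsa]
          linarith [hcon a s, hA0 J' a s]
        · rw [Idx.distinct_iff, Function.Injective] at hJ'
          push Not at hJ'
          obtain ⟨a, b, hab, hab'⟩ := hJ'
          by_cases hb : b = s₀
          · have : A J' b a = 1 := by simp [A, hab, ← hb, hab', hab'.symm]
            exact ⟨b, a, by linarith [hB0 J J' b a]⟩
          · have : A J' a b = 1 := by simp [A, hab, hb, hab']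
            exact ⟨a, b, by linarith [hB0 J J' a b]⟩
      obtain ⟨a, b, h1⟩ := hex
      have h2 : (1 : ℝ) ≤ ∑ a, ∑ b, (A J' a b + B J J' a b) := by
        refine h1.trans ?_
        refine le_trans ?_ (Finset.single_le_sum (f := fun a => ∑ b, (A J' a b + B J J' a b))
          (fun a _ => Finset.sum_nonneg fun b _ => hnn a b) (Finset.mem_univ a))
        exact Finset.single_le_sum (f := fun b => A J' a b + B J J' a b)
          (fun b _ => hnn a b) (Finset.mem_univ b)
      have h3 := (le_abs_self _).trans (abs_integral_mul_pick_le hg J J')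
      nlinarith [tieBound_nonneg F g]
  calc 𝔼 j, 𝔼 J : Idx n c, 𝔼 J' : Idx n c,
        N ^ 2 * e J j * e J' j * ∫ x, g (pick x J) * g (pick x J') ∂productLaw n F
      ≤ 𝔼 j, 𝔼 J : Idx n c, 𝔼 J' : Idx n c, N ^ 2 * e J j * e J' j *
          (tieBound F g * ∑ a, ∑ b, (A J' a b + B J J' a b)) :=
        Finset.expect_le_expect fun j _ => Finset.expect_le_expect fun J _ =>
          Finset.expect_le_expect fun J' _ => mul_le_mul_of_nonneg_left (hpt J J')
            (mul_nonneg (mul_nonneg (sq_nonneg _) (he0 _ _)) (he0 _ _))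
    _ = 𝔼 j, 𝔼 J : Idx n c, N ^ 2 * e J j * (tieBound F g * ∑ a, ∑ b,
          ((𝔼 J' : Idx n c, e J' j * A J' a b) + 𝔼 J' : Idx n c, e J' j * B J J' a b)) := by
        refine Finset.expect_congr rfl fun j _ => Finset.expect_congr rfl fun J _ => ?_
        simp only [← Finset.expect_add_distrib, ← Finset.expect_sum_comm, Finset.mul_expect]
        refine Finset.expect_congr rfl fun J' _ => ?_
        simp only [← mul_add, ← Finset.mul_sum]
        ring
    _ ≤ 𝔼 j, 𝔼 J : Idx n c, N ^ 2 * e J j * (tieBound F g * ∑ a : (Σ p, Fin (c p)),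
          ∑ b : (Σ p, Fin (c p)), (1 / N * (1 / r) + 1 / N * (1 / r))) := by
        refine Finset.expect_le_expect fun j _ => Finset.expect_le_expect fun J _ =>
          mul_le_mul_of_nonneg_left (mul_le_mul_of_nonneg_left ?_ (tieBound_nonneg F g))
            (mul_nonneg (sq_nonneg _) (he0 _ _))
        exact Finset.sum_le_sum fun a _ => Finset.sum_le_sum fun b _ =>
          add_le_add (hAe j a b) (hBe j J a b)
    _ = 2 * tieBound F g * (Fintype.card (Σ p, Fin (c p)) : ℝ) ^ 2 / r := by
        simp only [← Finset.expect_mul, ← Finset.mul_expect, hee, Fintype.expect_const,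
          Finset.sum_const, nsmul_eq_mul, Finset.card_univ]
        field_simp
        ring

end Degenerate

/-! ### Projections and the V-statistic expansion -/

section Projection

open scoped BigOperators

variable {m : ℕ} {S : Fin m → Type*} [∀ p, MeasurableSpace (S p)] {n c : Fin m → ℕ}
  {F : ∀ p, Measure (S p)} [∀ p, IsProbabilityMeasure (F p)] {h : Sample S c → ℝ}

theorem ae_integrable_setSlot (hh : Integrable h (productLaw c F)) (s : Σ p, Fin (c p)) :
    ∀ᵐ y ∂F s.1, Integrable (fun z => h (setSlots z s.1 {s.2} y)) (productLaw c F) :=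
  ((measurePreserving_setSlot c F s.1 s.2).integrable_comp_of_integrable hh).prod_left_ae

theorem integral_proj (hh : Integrable h (productLaw c F)) (s : Σ p, Fin (c p)) :
    ∫ y, proj F h s y ∂F s.1 = meanPerf h F := by
  have hmp := measurePreserving_setSlot c F s.1 s.2
  have h1 := hmp.integrable_comp_of_integrable hh
  have h2 : ∫ y, proj F h s y ∂F s.1 =
      ∫ zy, (h ∘ fun zy : Sample S c × S s.1 => setSlots zy.1 s.1 {s.2} zy.2) zy
        ∂((productLaw c F).prod (F s.1)) := (integral_prod_symm _ h1).symm
  rw [h2, meanPerf]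
  conv_rhs => rw [← hmp.map_eq]
  rw [integral_map hmp.measurable.aemeasurable]
  · rfl
  · rw [hmp.map_eq]; exact hh.aestronglyMeasurable

theorem memLp_four_proj (hm : Measurable h) (hh : MemLp h 4 (productLaw c F))
    (s : Σ p, Fin (c p)) : MemLp (proj F h s) 4 (F s.1) := by
  refine ⟨(measurable_proj F hm s).aestronglyMeasurable, ?_⟩
  have h4 : (4 : ℝ≥0∞) = ((4 : NNReal) : ℝ≥0∞) := by simp
  have hfin : ∫⁻ z, ‖h z‖ₑ ^ (4 : ℝ) ∂productLaw c F < ⊤ := by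
    have := hh.2
    rw [h4, eLpNorm_lt_top_iff_lintegral_rpow_enorm_lt_top (by simp) (by simp)] at this
    simpa using this
  rw [h4, eLpNorm_lt_top_iff_lintegral_rpow_enorm_lt_top (by simp) (by simp)]
  simp only [ENNReal.coe_toReal]
  refine lt_of_le_of_lt ?_ hfin
  have hmp := measurePreserving_setSlot c F s.1 s.2
  have hG : Measurable fun z => ‖h z‖ₑ ^ (4 : ℝ) := by fun_prop
  rw [← hmp.lintegral_comp hG,
    lintegral_prod_symm (fun zy : Sample S c × S s.1 => ‖h (setSlots zy.1 s.1 {s.2} zy.2)‖ₑ ^ (4 : ℝ))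
      (hG.comp hmp.measurable).aemeasurable]
  refine lintegral_mono fun y => ?_
  have hmy : Measurable fun z => h (setSlots z s.1 {s.2} y) := by fun_prop
  have e1 : ‖proj F h s y‖ₑ ≤ eLpNorm (fun z => h (setSlots z s.1 {s.2} y)) 4 (productLaw c F) := by
    refine (enorm_integral_le_lintegral_enorm _).trans ?_
    rw [← eLpNorm_one_eq_lintegral_enorm]
    exact eLpNorm_le_eLpNorm_of_exponent_le (by norm_num) hmy.aestronglyMeasurable
  have e2 := eLpNorm_nnreal_pow_eq_lintegral (f := fun z => h (setSlots z s.1 {s.2} y))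
    (μ := productLaw c F) (p := 4) (by simp)
  calc ‖proj F h s y‖ₑ ^ (4 : ℝ)
      ≤ eLpNorm (fun z => h (setSlots z s.1 {s.2} y)) 4 (productLaw c F) ^ (4 : ℝ) :=
        ENNReal.rpow_le_rpow e1 (by norm_num)
    _ = _ := by simpa using e2

theorem proj_eval_same (s : Σ p, Fin (c p)) (f : S s.1 → ℝ) (y : S s.1) :
    proj F (fun z : Sample S c => f (z s.1 s.2)) s y = f y := by
  simp [proj, setSlots_same]

theorem proj_eval_of_ne {s s' : Σ p, Fin (c p)} (hs : s' ≠ s) {f : S s'.1 → ℝ}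
    (hf : Measurable f) (y : S s.1) :
    proj F (fun z : Sample S c => f (z s'.1 s'.2)) s y = ∫ y', f y' ∂F s'.1 := by
  have : ∀ z : Sample S c, setSlots z s.1 {s.2} y s'.1 s'.2 = z s'.1 s'.2 := by
    intro z
    obtain ⟨p, t⟩ := s
    obtain ⟨p', t'⟩ := s'
    by_cases hp : p' = p
    · subst hp
      have : t' ≠ t := fun ht => hs (by rw [ht])
      simp [setSlots_same, this]
    · simp [setSlots_of_ne _ hp]
  simp only [proj, this]
  have hmp := measurePreserving_eval_eval c F s'.1 s'.2
  rw [← hmp.map_eq, integral_map hmp.measurable.aemeasurable]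
  exact hf.aestronglyMeasurable

/-- The explicit form of the influence function: the sum over the slots of source `p` of the
centred projections. -/
def inflSum (F : ∀ p, Measure (S p)) (h : Sample S c → ℝ) (p : Fin m) (y : S p) : ℝ :=
  ∑ t : Fin (c p), (proj F h ⟨p, t⟩ y - meanPerf h F)

theorem measurable_inflSum (hm : Measurable h) (p : Fin m) : Measurable (inflSum F h p) :=
  Finset.measurable_sum _ fun t _ => (measurable_proj F hm ⟨p, t⟩).sub_const _

theorem memLp_four_inflSum (hm : Measurable h) (hh : MemLp h 4 (productLaw c F)) (p : Fin m) :
    MemLp (inflSum F h p) 4 (F p) :=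
  memLp_finsetSum _ fun t _ => (memLp_four_proj hm hh ⟨p, t⟩).sub (memLp_const _)

theorem integral_inflSum (hm : Measurable h) (hh : MemLp h 4 (productLaw c F)) (p : Fin m) :
    ∫ y, inflSum F h p y ∂F p = 0 := by
  have hi : ∀ t : Fin (c p), Integrable (proj F h ⟨p, t⟩) (F p) := fun t =>
    (memLp_four_proj hm hh ⟨p, t⟩).integrable (by norm_num)
  unfold inflSum
  rw [integral_finsetSum _ fun t _ => (hi t).sub (integrable_const _)]
  refine Finset.sum_eq_zero fun t _ => ?_
  rw [integral_sub (hi t) (integrable_const _)]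
  have := integral_proj (hh.integrable (by norm_num)) ⟨p, t⟩
  simp only at this
  simp [this]

theorem memLp_expect {X ι : Type*} [MeasurableSpace X] {μ : Measure X} [Fintype ι]
    {q : ℝ≥0∞} {f : ι → X → ℝ} (hf : ∀ i, MemLp (f i) q μ) :
    MemLp (fun x => 𝔼 i, f i x) q μ := by
  simp only [Fintype.expect_eq_sum_div_card, div_eq_mul_inv]
  exact (memLp_finsetSum _ fun i _ => hf i).mul_const _

/-- **Linearization of V-statistics.** The performance under the empirical input model differs from
its first-order expansion by a remainder with second moment of order `r⁻²`. -/
theorem exists_vStat_bound (hT : TieL2 F h) (hh : MemLp h 4 (productLaw c F))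
    (s₁ : Σ p, Fin (c p)) :
    ∃ K : ℝ, 0 ≤ K ∧ ∀ (n : Fin m → ℕ) (r : ℝ), 0 < r → (∀ p, r ≤ n p) →
      ∫⁻ x, ENNReal.ofReal ((𝔼 J : Idx n c, h (pick x J) - meanPerf h F -
        ∑ p, 𝔼 j, inflSum F h p (x p j)) ^ 2) ∂productLaw n F ≤ ENNReal.ofReal (K / r ^ 2) := by
  have hp4 := memLp_four_proj (F := F) hT.1 hh
  have hi : Integrable h (productLaw c F) := hh.integrable (by norm_num)
  let g' : (Σ p, Fin (c p)) → Sample S c → ℝ := fun s z =>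
    proj F h s (z s.1 s.2) - meanPerf h F
  -- `h` minus its mean and its first-order projections is completely degenerate
  let g : Sample S c → ℝ := fun z => h z - meanPerf h F - ∑ s, g' s z
  have hg' : ∀ s, TieL2 F (g' s) := fun s =>
    (tieL2_eval s (measurable_proj F hT.1 s) ((hp4 s).mono_exponent (by norm_num))).sub
      (tieL2_const _)
  have hg : TieL2 F g := (hT.sub (tieL2_const _)).sub (TieL2.sum _ hg')
  have hproj : ∀ s : Σ p, Fin (c p), ∀ᵐ y ∂F s.1, proj F g s y = 0 := by
    intro s
    have hae : ∀ᵐ y ∂F s.1, ∀ s', Integrable (fun z => g' s' (setSlots z s.1 {s.2} y))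
        (productLaw c F) := ae_all_iff.2 fun s' =>
      ae_integrable_setSlot ((hg' s').memLp.integrable (by norm_num)) s
    filter_upwards [ae_integrable_setSlot hi s, hae] with y hy hy'
    have h1 : proj F g s y = proj F h s y - meanPerf h F - ∑ s', proj F (g' s') s y := by
      simp only [proj, g]
      have hc : Integrable (fun z => h (setSlots z s.1 {s.2} y) - meanPerf h F) (productLaw c F) :=
        hy.sub (integrable_const _)
      rw [integral_sub hc (integrable_finsetSum _ fun s' _ => hy' s'),
        integral_sub hy (integrable_const _), integral_finsetSum _ fun s' _ => hy' s']
      simp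
    have h2 : ∀ s', s' ≠ s → proj F (g' s') s y = 0 := by
      intro s' hs
      have := proj_eval_of_ne (F := F) hs (f := fun y => proj F h s' y - meanPerf h F)
        ((measurable_proj F hT.1 s').sub_const _) y
      rw [this, integral_sub ((hp4 s').integrable (by norm_num)) (integrable_const _),
        integral_proj hi s']
      simp
    have h3 : proj F (g' s) s y = proj F h s y - meanPerf h F :=
      proj_eval_same s (fun y => proj F h s y - meanPerf h F) y
    rw [h1, Finset.sum_eq_single s (fun s' _ hs => h2 s' hs) (by simp), h3]
    ring
  refine ⟨2 * tieBound F g * (Fintype.card (Σ p, Fin (c p)) : ℝ) ^ 4,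
    mul_nonneg (mul_nonneg zero_le_two (tieBound_nonneg F g)) (by positivity), ?_⟩
  intro n r hr hn
  have hn0 : ∀ p, 0 < n p := fun p => by exact_mod_cast hr.trans_le (hn p)
  have hne : ∀ s : Σ p, Fin (c p), Nonempty (Fin (n s.1)) := fun s => ⟨⟨0, hn0 s.1⟩⟩
  have hne' : ∀ p, Nonempty (Fin (n p)) := fun s => ⟨⟨0, hn0 s⟩⟩
  have hb := integral_sq_vStat_le hg s₁ hproj hr hn
  have heq : ∀ x : Sample S n, 𝔼 J : Idx n c, g (pick x J) = 𝔼 J : Idx n c, h (pick x J) -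
      meanPerf h F - ∑ p, 𝔼 j, inflSum F h p (x p j) := by
    intro x
    simp only [g, Finset.expect_sub_distrib, Fintype.expect_const, Finset.expect_sum_comm]
    congr 1
    rw [Fintype.sum_sigma]
    refine Finset.sum_congr rfl fun p _ => ?_
    simp only [inflSum, Finset.expect_sum_comm]
    refine Finset.sum_congr rfl fun t _ => ?_
    exact expect_slot_eq hn0 ⟨p, t⟩ fun j => proj F h ⟨p, t⟩ (x p j) - meanPerf h F
  simp only [← heq]
  rw [← ofReal_integral_eq_lintegral_ofReal
    (memLp_expect fun J => hg.memLp_pick J).integrable_sq (ae_of_all _ fun x => sq_nonneg _)]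
  exact ENNReal.ofReal_le_ofReal hb

/-- The slot means of `h` converge to the projection of `h`, in mean square over the data. -/
theorem exists_slotMean_bound (hT : TieL2 F h) (hh : MemLp h 4 (productLaw c F))
    (s : Σ p, Fin (c p)) :
    ∃ K : ℝ, 0 ≤ K ∧ ∀ (n : Fin m → ℕ) (r : ℝ), 0 < r → (∀ p, r ≤ n p) →
      ∫⁻ x, ENNReal.ofReal (𝔼 j, (slotMean h x s j - proj F h s (x s.1 j)) ^ 2)
        ∂productLaw n F ≤ ENNReal.ofReal (K / r) := by
  have hp2 : MemLp (proj F h s) 2 (F s.1) :=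
    (memLp_four_proj (F := F) hT.1 hh s).mono_exponent (by norm_num)
  have hi : Integrable h (productLaw c F) := hh.integrable (by norm_num)
  let g' : Sample S c → ℝ := fun z => proj F h s (z s.1 s.2)
  let g : Sample S c → ℝ := fun z => h z - g' z
  have hg' : TieL2 F g' := tieL2_eval s (measurable_proj F hT.1 s) hp2
  have hg : TieL2 F g := hT.sub hg'
  have hproj : ∀ᵐ y ∂F s.1, proj F g s y = 0 := by
    filter_upwards [ae_integrable_setSlot hi s,
      ae_integrable_setSlot (hg'.memLp.integrable (by norm_num)) s] with y hy hy'
    have h3 : proj F g' s y = proj F h s y := proj_eval_same s (fun y => proj F h s y) y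
    have h1 : proj F g s y = proj F h s y - proj F g' s y := integral_sub hy hy'
    rw [h1, h3, sub_self]
  refine ⟨2 * tieBound F g * (Fintype.card (Σ p, Fin (c p)) : ℝ) ^ 2,
    mul_nonneg (mul_nonneg zero_le_two (tieBound_nonneg F g)) (by positivity), ?_⟩
  intro n r hr hn
  have hn0 : ∀ p, 0 < n p := fun p => by exact_mod_cast hr.trans_le (hn p)
  have hne : ∀ s : Σ p, Fin (c p), Nonempty (Fin (n s.1)) := fun s => ⟨⟨0, hn0 s.1⟩⟩
  have hb := integral_sq_slotMean_le hg s hproj hr hn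
  have heq : ∀ (x : Sample S n) j, slotMean g x s j =
      slotMean h x s j - proj F h s (x s.1 j) := by
    intro x j
    simp only [slotMean, g, mul_sub, Finset.expect_sub_distrib]
    congr 1
    have : ∀ J : Idx n c, ((n s.1 : ℝ) * if J s = j then 1 else 0) * g' (pick x J) =
        (n s.1 * if J s = j then 1 else 0) * proj F h s (x s.1 j) := by
      intro J
      by_cases hJ : J s = j
      · simp only [g', pick, ← hJ]
      · simp [hJ]
    simp only [this]
    rw [expect_slot_eq hn0 s fun i => ((n s.1 : ℝ) * if i = j then 1 else 0) *
      proj F h s (x s.1 j), ← Finset.expect_mul, ← Finset.mul_expect,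
      Fintype.expect_eq_sum_div_card]
    have := hn0 s.1
    simp
    field_simp
  simp only [← heq]
  have hml : ∀ j, MemLp (fun x : Sample S n => slotMean g x s j) 2 (productLaw n F) := fun j =>
    memLp_expect fun J => (hg.memLp_pick J).const_mul _
  rw [← ofReal_integral_eq_lintegral_ofReal (integrable_expect fun j => (hml j).integrable_sq)
    (ae_of_all _ fun x => Finset.expect_nonneg fun j _ => sq_nonneg _)]
  exact ENNReal.ofReal_le_ofReal hb

/-- The mean of the squared output over all index tuples has bounded expectation. -/
theorem lintegral_expect_sq_le (hT : TieL2 F h) (n : Fin m → ℕ) (hn : ∀ p, 0 < n p) :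
    ∫⁻ x, ENNReal.ofReal (𝔼 J : Idx n c, h (pick x J) ^ 2) ∂productLaw n F ≤
      ENNReal.ofReal (tieBound F h) := by
  have hne : ∀ s : Σ p, Fin (c p), Nonempty (Fin (n s.1)) := fun s => ⟨⟨0, hn s.1⟩⟩
  rw [← ofReal_integral_eq_lintegral_ofReal
    (integrable_expect fun J => (hT.memLp_pick J).integrable_sq)
    (ae_of_all _ fun x => Finset.expect_nonneg fun j _ => sq_nonneg _),
    integral_expect fun J => (hT.memLp_pick J).integrable_sq]
  exact ENNReal.ofReal_le_ofReal (Finset.expect_le Finset.univ_nonempty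
    fun J _ => integral_sq_pick_le hT.1 J)

end Projection

/-! ### Reweighted empirical models -/

section WeightedModel

open scoped BigOperators

theorem pi_sum_smul_dirac {ι : Type*} [Fintype ι] [DecidableEq ι] {κ : ι → Type*}
    [∀ i, Fintype (κ i)] {α : ι → Type*} [∀ i, MeasurableSpace (α i)] (a : ∀ i, κ i → ℝ)
    (ha : ∀ i j, 0 ≤ a i j) (y : ∀ i, κ i → α i) :
    Measure.pi (fun i => ∑ j, ENNReal.ofReal (a i j) • Measure.dirac (y i j)) =
      ∑ J : ∀ i, κ i, ENNReal.ofReal (∏ i, a i (J i)) • Measure.dirac fun i => y i (J i) := by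
  have hfin : ∀ i, IsFiniteMeasure (∑ j, ENNReal.ofReal (a i j) • Measure.dirac (y i j)) := by
    intro i
    refine ⟨?_⟩
    simp only [Measure.coe_finsetSum, Finset.sum_apply, Measure.smul_apply, measure_univ,
      smul_eq_mul, mul_one]
    exact ENNReal.sum_lt_top.2 fun j _ => ENNReal.ofReal_lt_top
  refine Measure.pi_eq fun s hs => ?_
  simp only [Measure.coe_finsetSum, Finset.sum_apply, Measure.smul_apply, smul_eq_mul]
  rw [Finset.prod_univ_sum, Fintype.piFinset_univ]
  refine Finset.sum_congr rfl fun J _ => ?_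
  rw [Finset.prod_mul_distrib, ENNReal.ofReal_prod_of_nonneg fun i _ => ha i (J i)]
  congr 1
  rw [Measure.dirac_apply' _ (MeasurableSet.univ_pi hs)]
  have : ∀ i, Measure.dirac (y i (J i)) (s i) = (s i).indicator 1 (y i (J i)) := fun i =>
    Measure.dirac_apply' _ (hs i)
  classical
  simp only [this, Set.indicator_apply, Pi.one_apply, Set.mem_pi, Set.mem_univ, true_imp_iff,
    Fintype.prod_boole]

variable {m : ℕ} {S : Fin m → Type*} [∀ p, MeasurableSpace (S p)] {n c : Fin m → ℕ}

theorem isProbabilityMeasure_weightedEdf (x : Sample S n) {w : ∀ p, Fin (n p) → ℝ}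
    (hw : ∀ p, w p ∈ stdSimplex ℝ (Fin (n p))) (p : Fin m) :
    IsProbabilityMeasure (weightedEdf x w p) := by
  refine ⟨?_⟩
  simp only [weightedEdf, Measure.coe_finsetSum, Finset.sum_apply, Measure.smul_apply,
    measure_univ, smul_eq_mul, mul_one]
  rw [← ENNReal.ofReal_sum_of_nonneg fun j _ => (hw p).1 j, (hw p).2, ENNReal.ofReal_one]

/-- The joint law of the simulation inputs: independent draws of indices with the given weights. -/
theorem productLaw_weightedEdf (x : Sample S n) {w : ∀ p, Fin (n p) → ℝ}
    (hw : ∀ p, w p ∈ stdSimplex ℝ (Fin (n p))) :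
    productLaw c (weightedEdf x w) = ∑ J : Idx n c,
      ENNReal.ofReal (∏ s, w s.1 (J s)) • Measure.dirac (pick x J) := by
  have := isProbabilityMeasure_weightedEdf x hw
  have hmp := measurePreserving_curry c (weightedEdf x w)
  have hflat : flatLaw c (weightedEdf x w) = ∑ J : Idx n c,
      ENNReal.ofReal (∏ s, w s.1 (J s)) • Measure.dirac fun s => x s.1 (J s) :=
    pi_sum_smul_dirac (fun (s : Σ p, Fin (c p)) j => w s.1 j) (fun s j => (hw s.1).1 j)
      fun s j => x s.1 j
  rw [← hmp.map_eq, hflat, Measure.map_finset_sum hmp.measurable.aemeasurable]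
  refine Finset.sum_congr rfl fun J _ => ?_
  rw [Measure.map_smul, Measure.map_dirac' hmp.measurable]
  rfl

/-- The performance under the reweighted empirical input model, as a finite sum. -/
def wMean (h : Sample S c → ℝ) (x : Sample S n) (w : ∀ p, Fin (n p) → ℝ) : ℝ :=
  ∑ J : Idx n c, (∏ s, w s.1 (J s)) * h (pick x J)

theorem integrable_weighted {h : Sample S c → ℝ} (hh : Measurable h) (x : Sample S n)
    {w : ∀ p, Fin (n p) → ℝ} (hw : ∀ p, w p ∈ stdSimplex ℝ (Fin (n p))) :
    Integrable h (productLaw c (weightedEdf x w)) := by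
  rw [productLaw_weightedEdf x hw, integrable_finsetSum_measure]
  exact fun J _ => (integrable_dirac' hh.stronglyMeasurable (by simp)).smul_measure
    ENNReal.ofReal_ne_top

theorem integral_weighted {h : Sample S c → ℝ} (hh : Measurable h) (x : Sample S n)
    {w : ∀ p, Fin (n p) → ℝ} (hw : ∀ p, w p ∈ stdSimplex ℝ (Fin (n p))) :
    ∫ z, h z ∂productLaw c (weightedEdf x w) = wMean h x w := by
  rw [productLaw_weightedEdf x hw, integral_finsetSum_measure fun J _ =>
    (integrable_dirac' hh.stronglyMeasurable (by simp)).smul_measure ENNReal.ofReal_ne_top]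
  refine Finset.sum_congr rfl fun J _ => ?_
  rw [integral_smul_measure, integral_dirac' _ _ hh.stronglyMeasurable,
    ENNReal.toReal_ofReal (Finset.prod_nonneg fun s _ => (hw s.1).1 (J s)), smul_eq_mul]

/-- The performance under weights `w` as a mean over uniformly random index tuples with likelihood
ratios `∏ n p * w p j`. -/
theorem wMean_eq_expect (hn : ∀ p, 0 < n p) (h : Sample S c → ℝ) (x : Sample S n)
    (w : ∀ p, Fin (n p) → ℝ) :
    wMean h x w = 𝔼 J : Idx n c, (∏ s, (n s.1 * w s.1 (J s))) * h (pick x J) := by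
  rw [Fintype.expect_eq_sum_div_card, wMean, Finset.sum_div]
  refine Finset.sum_congr rfl fun J _ => ?_
  rw [Finset.prod_mul_distrib, Fintype.card_pi]
  have : (∏ s : (Σ p, Fin (c p)), (n s.1 : ℝ)) ≠ 0 :=
    Finset.prod_ne_zero_iff.2 fun s _ => by exact_mod_cast (hn s.1).ne'
  simp only [Fintype.card_fin]
  push_cast
  field_simp

theorem measurable_wMean {Ω : Type*} [MeasurableSpace Ω] {h : Sample S c → ℝ} (hh : Measurable h)
    {X : Ω → Sample S n} (hX : Measurable X) {W : Ω → ∀ p, Fin (n p) → ℝ} (hW : Measurable W) :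
    Measurable fun ω => wMean h (X ω) (W ω) := by
  unfold wMean
  refine Finset.measurable_sum _ fun J _ => Measurable.mul ?_ ?_
  · fun_prop
  · exact hh.comp ((measurable_pick J).comp hX)

theorem edf_mem_simplex (hn : ∀ p, 0 < n p) (p : Fin m) :
    (fun _ : Fin (n p) => 1 / (n p : ℝ)) ∈ stdSimplex ℝ (Fin (n p)) := by
  have : (n p : ℝ) ≠ 0 := by exact_mod_cast (hn p).ne'
  exact ⟨fun _ => by positivity, by simp [this]⟩

theorem wMean_uniform (hn : ∀ p, 0 < n p) (h : Sample S c → ℝ) (x : Sample S n) :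
    wMean h x (fun p _ => 1 / (n p : ℝ)) = 𝔼 J : Idx n c, h (pick x J) := by
  rw [wMean_eq_expect hn]
  refine Finset.expect_congr rfl fun J _ => ?_
  rw [Finset.prod_eq_one fun s _ => ?_, one_mul]
  have : (n s.1 : ℝ) ≠ 0 := by exact_mod_cast (hn s.1).ne'
  field_simp

theorem wMean_le_of_weights_le (hn : ∀ p, 0 < n p) {h : Sample S c → ℝ} (h0 : ∀ z, 0 ≤ h z)
    (x : Sample S n) {w : ∀ p, Fin (n p) → ℝ} (hw0 : ∀ p j, 0 ≤ w p j) {C : ℝ}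
    (hw : ∀ p j, n p * w p j ≤ C) :
    wMean h x w ≤ C ^ Fintype.card (Σ p, Fin (c p)) * 𝔼 J : Idx n c, h (pick x J) := by
  rw [wMean_eq_expect hn, Finset.mul_expect]
  refine Finset.expect_le_expect fun J _ => mul_le_mul_of_nonneg_right ?_ (h0 _)
  have : ∏ s : (Σ p, Fin (c p)), ((n s.1 : ℝ) * w s.1 (J s)) ≤ ∏ _s : (Σ p, Fin (c p)), C :=
    Finset.prod_le_prod (fun s _ => mul_nonneg (by positivity) (hw0 _ _)) fun s _ => hw _ _
  simpa using this

theorem expect_slot_mul_eq (hn : ∀ p, 0 < n p) (h : Sample S c → ℝ) (x : Sample S n)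
    (s : Σ p, Fin (c p)) (δ : Fin (n s.1) → ℝ) :
    𝔼 J : Idx n c, δ (J s) * h (pick x J) = 𝔼 j, δ j * slotMean h x s j := by
  have hns : (n s.1 : ℝ) ≠ 0 := by exact_mod_cast (hn s.1).ne'
  simp only [slotMean, Finset.mul_expect]
  rw [Finset.expect_comm]
  refine Finset.expect_congr rfl fun J _ => ?_
  rw [Fintype.expect_eq_sum_div_card, Finset.sum_eq_single (J s)]
  · simp; field_simp
  · intro j _ hj; simp [hj.symm]
  · simp

/-- For independent centred weights the second moment of `∏ (1 + δ) - 1 - ∑ δ` is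
`∏ (1 + v) - 1 - ∑ v`, with `v` the variances. -/
theorem expect_sq_prod_sub {ι : Type*} [Fintype ι] [DecidableEq ι] {α : ι → Type*}
    [∀ i, Fintype (α i)] [∀ i, Nonempty (α i)] (δ : ∀ i, α i → ℝ) (hδ : ∀ i, 𝔼 j, δ i j = 0) :
    𝔼 J : ∀ i, α i, (∏ i, (1 + δ i (J i)) - 1 - ∑ i, δ i (J i)) ^ 2 =
      ∏ i, (1 + 𝔼 j, δ i j ^ 2) - 1 - ∑ i, 𝔼 j, δ i j ^ 2 := by
  have slot : ∀ i (f : α i → ℝ), 𝔼 J : ∀ i, α i, f (J i) = 𝔼 j, f j := fun i f => by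
    rw [expect_update i]; simp
  have e1 : 𝔼 J : ∀ i, α i, (∏ i, (1 + δ i (J i))) ^ 2 = ∏ i, (1 + 𝔼 j, δ i j ^ 2) := by
    simp only [← Finset.prod_pow]
    rw [expect_prod_eq fun i j => (1 + δ i j) ^ 2]
    refine Finset.prod_congr rfl fun i _ => ?_
    have : ∀ j, (1 + δ i j) ^ 2 = 1 + 2 * δ i j + δ i j ^ 2 := fun j => by ring
    simp only [this, Finset.expect_add_distrib, ← Finset.mul_expect, hδ, Fintype.expect_const]
    ring
  have e2 : 𝔼 J : ∀ i, α i, ∏ i, (1 + δ i (J i)) = 1 := by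
    rw [expect_prod_eq fun i j => 1 + δ i j]
    simp [Finset.expect_add_distrib, hδ]
  have e3 : ∀ i, 𝔼 J : ∀ i, α i, (∏ i, (1 + δ i (J i))) * δ i (J i) = 𝔼 j, δ i j ^ 2 := by
    intro i
    rw [expect_update i]
    have : ∀ (J : ∀ i, α i) j, (∏ i', (1 + δ i' (Function.update J i j i'))) *
        δ i (Function.update J i j i) = (∏ i' ∈ Finset.univ.erase i, (1 + δ i' (J i'))) *
          (δ i j + δ i j ^ 2) := by
      intro J j
      rw [← Finset.mul_prod_erase _ _ (Finset.mem_univ i), Function.update_self,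
        Finset.prod_congr rfl (g := fun i' => 1 + δ i' (J i')) fun i' hi' => ?_]
      · ring
      · rw [Function.update_of_ne (Finset.ne_of_mem_erase hi')]
    simp only [this, ← Finset.mul_expect, Finset.expect_add_distrib, hδ, zero_add]
    rw [← Finset.expect_mul]
    have e4 : 𝔼 J : ∀ i, α i, ∏ i' ∈ Finset.univ.erase i, (1 + δ i' (J i')) = 1 := by
      have : ∀ J : ∀ i, α i, ∏ i' ∈ Finset.univ.erase i, (1 + δ i' (J i')) =
          ∏ i', (if i' = i then 1 else 1 + δ i' (J i')) := by
        intro J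
        rw [← Finset.mul_prod_erase Finset.univ _ (Finset.mem_univ i)]
        simp only [if_true, one_mul]
        exact Finset.prod_congr rfl fun i' hi' => by simp [Finset.ne_of_mem_erase hi']
      simp only [this]
      rw [expect_prod_eq fun i' j => if i' = i then 1 else 1 + δ i' j]
      refine Finset.prod_eq_one fun i' _ => ?_
      by_cases hi : i' = i
      · simp [hi]
      · simp [hi, Finset.expect_add_distrib, hδ]
    rw [e4, one_mul]
  have e5 : ∀ i i', 𝔼 J : ∀ i, α i, δ i (J i) * δ i' (J i') =
      if i = i' then 𝔼 j, δ i j ^ 2 else 0 := by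
    intro i i'
    by_cases h : i = i'
    · subst h
      rw [if_pos rfl, slot i fun j => δ i j * δ i j]
      simp only [sq]
    · rw [if_neg h, expect_update i']
      simp [h, ← Finset.mul_expect, hδ]
  have key : ∀ J : ∀ i, α i, (∏ i, (1 + δ i (J i)) - 1 - ∑ i, δ i (J i)) ^ 2 =
      (∏ i, (1 + δ i (J i))) ^ 2 + 1 + (∑ i, ∑ i', δ i (J i) * δ i' (J i'))
        - 2 * ∏ i, (1 + δ i (J i)) - 2 * (∑ i, (∏ i, (1 + δ i (J i))) * δ i (J i))
        + 2 * ∑ i, δ i (J i) := by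
    intro J
    rw [← Finset.sum_mul_sum, ← Finset.mul_sum]
    ring
  simp only [key, Finset.expect_add_distrib, Finset.expect_sub_distrib, Finset.expect_sum_comm,
    ← Finset.mul_expect, e1, e2, e3, e5, slot, hδ, Fintype.expect_const]
  simp
  ring

theorem prod_one_add_sub_le {ι : Type*} [Fintype ι] {v : ι → ℝ} (hv : ∀ i, 0 ≤ v i)
    (h1 : ∑ i, v i ≤ 1) : ∏ i, (1 + v i) - 1 - ∑ i, v i ≤ (∑ i, v i) ^ 2 := by
  have hV : 0 ≤ ∑ i, v i := Finset.sum_nonneg fun i _ => hv i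
  have h2 : ∏ i, (1 + v i) ≤ Real.exp (∑ i, v i) := by
    rw [Real.exp_sum]
    refine Finset.prod_le_prod (fun i _ => by linarith [hv i]) fun i _ => ?_
    linarith [Real.add_one_le_exp (v i)]
  have h3 := Real.abs_exp_sub_one_sub_id_le (x := ∑ i, v i) (by rwa [abs_of_nonneg hV])
  linarith [le_abs_self (Real.exp (∑ i, v i) - 1 - ∑ i, v i)]

/-- **Linearization in the weights.** The deviation of the performance under a reweighted empirical
model from its first-order expansion around the true model, for weights whose relative deviations
from uniform have square sum at most `C`: a linearization error of the empirical model, the error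
of the slot means, and a second-order term. -/
theorem abs_wMean_sub_le {F : ∀ p, Measure (S p)} (h : Sample S c → ℝ) (x : Sample S n)
    {w : ∀ p, Fin (n p) → ℝ} (hw : ∀ p, w p ∈ stdSimplex ℝ (Fin (n p))) {C r : ℝ}
    (hC : ∀ p, ∑ j, (n p * w p j - 1) ^ 2 ≤ C) (hr : 0 < r) (hn : ∀ p, r ≤ n p)
    (hrC : Fintype.card (Σ p, Fin (c p)) * (C / r) ≤ 1) :
    |wMean h x w - meanPerf h F - ∑ p, ∑ j, inflSum F h p (x p j) * w p j| ≤
      |𝔼 J : Idx n c, h (pick x J) - meanPerf h F - ∑ p, 𝔼 j, inflSum F h p (x p j)| +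
      ∑ s : (Σ p, Fin (c p)),
        √(C / r) * √(𝔼 j, (slotMean h x s j - proj F h s (x s.1 j)) ^ 2) +
      Fintype.card (Σ p, Fin (c p)) * (C / r) * √(𝔼 J : Idx n c, h (pick x J) ^ 2) := by
  have hn0 : ∀ p, 0 < n p := fun p => by exact_mod_cast hr.trans_le (hn p)
  have hnr : ∀ p, (n p : ℝ) ≠ 0 := fun p => by exact_mod_cast (hn0 p).ne'
  have hne : ∀ s : Σ p, Fin (c p), Nonempty (Fin (n s.1)) := fun s => ⟨⟨0, hn0 s.1⟩⟩
  have hne' : ∀ p, Nonempty (Fin (n p)) := fun s => ⟨⟨0, hn0 s⟩⟩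
  let δ : ∀ p, Fin (n p) → ℝ := fun p j => n p * w p j - 1
  have hδ : ∀ p, 𝔼 j, δ p j = 0 := by
    intro p
    simp only [δ, Finset.expect_sub_distrib, ← Finset.mul_expect, Fintype.expect_const]
    rw [Fintype.expect_eq_sum_div_card, (hw p).2, Fintype.card_fin]
    field_simp [hnr p]
    ring
  have hC0 : ∀ p : Fin m, 0 ≤ C := fun p =>
    (Finset.sum_nonneg fun j _ => sq_nonneg _).trans (hC p)
  have hv : ∀ p, 𝔼 j, δ p j ^ 2 ≤ C / r := by
    intro p
    rw [Fintype.expect_eq_sum_div_card, Fintype.card_fin]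
    exact div_le_div₀ (hC0 p) (hC p) hr (hn p)
  have hv0 : ∀ p, 0 ≤ 𝔼 j, δ p j ^ 2 := fun p => Finset.expect_nonneg fun j _ => sq_nonneg _
  -- the terms of order at least two in the expansion of the likelihood ratio
  let rem : Idx n c → ℝ := fun J =>
    ∏ s : (Σ p, Fin (c p)), (1 + δ s.1 (J s)) - 1 - ∑ s : (Σ p, Fin (c p)), δ s.1 (J s)
  have h1 : wMean h x w = 𝔼 J : Idx n c, h (pick x J) +
      (∑ s : (Σ p, Fin (c p)), 𝔼 j, δ s.1 j * slotMean h x s j) +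
      𝔼 J : Idx n c, rem J * h (pick x J) := by
    rw [wMean_eq_expect hn0]
    simp only [← expect_slot_mul_eq hn0 h x _ (δ _), ← Finset.expect_sum_comm,
      ← Finset.expect_add_distrib]
    refine Finset.expect_congr rfl fun J _ => ?_
    simp only [rem, δ, add_sub_cancel, ← Finset.sum_mul]
    ring
  have h2 : ∑ p, ∑ j, inflSum F h p (x p j) * w p j = ∑ p, 𝔼 j, inflSum F h p (x p j) +
      ∑ s : (Σ p, Fin (c p)), 𝔼 j, δ s.1 j * proj F h s (x s.1 j) := by
    rw [Fintype.sum_sigma, ← Finset.sum_add_distrib]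
    refine Finset.sum_congr rfl fun p _ => ?_
    have e1 : ∑ j, inflSum F h p (x p j) * w p j =
        𝔼 j, (inflSum F h p (x p j) + inflSum F h p (x p j) * δ p j) := by
      rw [Fintype.expect_eq_sum_div_card, Finset.sum_div, Fintype.card_fin]
      refine Finset.sum_congr rfl fun j _ => ?_
      have := hnr p
      simp only [δ]
      field_simp
      ring
    rw [e1, Finset.expect_add_distrib]
    congr 1
    simp only [inflSum, Finset.sum_mul, Finset.expect_sum_comm]
    refine Finset.sum_congr rfl fun t _ => ?_
    have e2 : ∀ j, (proj F h ⟨p, t⟩ (x p j) - meanPerf h F) * δ p j =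
        δ p j * proj F h ⟨p, t⟩ (x p j) - meanPerf h F * δ p j := fun j => by ring
    simp only [e2, Finset.expect_sub_distrib, ← Finset.mul_expect, hδ, mul_zero, sub_zero]
  have h3 : wMean h x w - meanPerf h F - ∑ p, ∑ j, inflSum F h p (x p j) * w p j =
      (𝔼 J : Idx n c, h (pick x J) - meanPerf h F - ∑ p, 𝔼 j, inflSum F h p (x p j)) +
      (∑ s : (Σ p, Fin (c p)), 𝔼 j, δ s.1 j * (slotMean h x s j - proj F h s (x s.1 j))) +
      𝔼 J : Idx n c, rem J * h (pick x J) := by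
    simp only [mul_sub, Finset.expect_sub_distrib, Finset.sum_sub_distrib]
    rw [h1, h2]
    ring
  rw [h3]
  refine (abs_add_le _ _).trans (add_le_add ((abs_add_le _ _).trans (add_le_add le_rfl ?_)) ?_)
  · refine (Finset.abs_sum_le_sum_abs _ _).trans (Finset.sum_le_sum fun s _ => ?_)
    have := sq_expect_le (δ s.1) fun j => slotMean h x s j - proj F h s (x s.1 j)
    refine (Real.abs_le_sqrt this).trans ?_
    rw [Real.sqrt_mul (hv0 _)]
    exact mul_le_mul_of_nonneg_right (Real.sqrt_le_sqrt (hv _)) (Real.sqrt_nonneg _)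
  · have e := sq_expect_le rem fun J => h (pick x J)
    have hrem : 𝔼 J : Idx n c, rem J ^ 2 ≤ (Fintype.card (Σ p, Fin (c p)) * (C / r)) ^ 2 := by
      have hs := expect_sq_prod_sub (fun (s : Σ p, Fin (c p)) j => δ s.1 j) fun s => hδ s.1
      have hV : ∑ s : (Σ p, Fin (c p)), 𝔼 j, δ s.1 j ^ 2 ≤
          Fintype.card (Σ p, Fin (c p)) * (C / r) := by
        refine (Finset.sum_le_sum fun (s : Σ p, Fin (c p)) _ => hv s.1).trans ?_
        simp
      have hp := prod_one_add_sub_le (fun s : (Σ p, Fin (c p)) => hv0 s.1) (hV.trans hrC)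
      have hV0 : 0 ≤ ∑ s : (Σ p, Fin (c p)), 𝔼 j, δ s.1 j ^ 2 :=
        Finset.sum_nonneg fun s _ => hv0 s.1
      calc 𝔼 J : Idx n c, rem J ^ 2 = _ := hs
        _ ≤ _ := hp
        _ ≤ _ := pow_le_pow_left₀ hV0 hV 2
    have hcr : 0 ≤ Fintype.card (Σ p, Fin (c p)) * (C / r) := by
      rcases isEmpty_or_nonempty (Σ p, Fin (c p)) with he | ⟨⟨s⟩⟩
      · simp
      · exact mul_nonneg (by positivity) (div_nonneg (hC0 s.1) hr.le)
    refine (Real.abs_le_sqrt e).trans ?_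
    rw [Real.sqrt_mul (Finset.expect_nonneg fun J _ => sq_nonneg _)]
    refine mul_le_mul_of_nonneg_right ?_ (Real.sqrt_nonneg _)
    exact Real.sqrt_le_iff.2 ⟨hcr, hrem⟩

end WeightedModel

/-! ### The empirical-likelihood ambiguity set -/

section Ambiguity

/-- For `x` bounded above, `x - log (1 + x)` controls the square of `x`. -/
theorem sq_le_mul_sub_log {x Q : ℝ} (hx : -1 < x) (hQ : 0 ≤ Q) (hxQ : x ≤ Q + 1) :
    x ^ 2 ≤ 2 * (Q + 2) * (x - Real.log (1 + x)) := by
  rcases le_total 0 x with h0 | h0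
  · have h1 : 0 < 1 + x := by linarith
    have h2 : Real.log (1 + x) ≤ Real.sinh (Real.log (1 + x)) :=
      Real.self_le_sinh_iff.2 (Real.log_nonneg (by linarith))
    rw [Real.sinh_log h1] at h2
    have h3 : x - (1 + x - (1 + x)⁻¹) / 2 = x ^ 2 / (2 * (1 + x)) := by field_simp; ring
    have h4 : x ^ 2 / (2 * (1 + x)) ≤ x - Real.log (1 + x) := by linarith
    rw [div_le_iff₀ (by linarith)] at h4
    have h5 : 0 ≤ x - Real.log (1 + x) := by linarith [Real.log_le_sub_one_of_pos h1]
    nlinarith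
  · have h1 : 0 < 1 + x := by linarith
    have h2 := Real.le_log_one_add_of_nonneg (x := (1 + x)⁻¹ - 1)
      (by rw [sub_nonneg]; exact (one_le_inv₀ h1).2 (by linarith))
    have e1 : 1 + ((1 + x)⁻¹ - 1) = (1 + x)⁻¹ := by ring
    rw [e1, Real.log_inv] at h2
    have e2 : 2 * ((1 + x)⁻¹ - 1) / ((1 + x)⁻¹ - 1 + 2) = -2 * x / (2 + x) := by
      have : (2 + x) ≠ 0 := by linarith
      have : (1 + x)⁻¹ - 1 + 2 = (2 + x) / (1 + x) := by field_simp; ring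
      rw [this]
      field_simp
      ring
    rw [e2] at h2
    have h3 : -x + x ^ 2 / 2 ≤ -2 * x / (2 + x) := by
      rw [le_div_iff₀ (by linarith)]
      nlinarith [mul_nonneg (neg_nonneg.2 h0) (sq_nonneg x)]
    nlinarith

/-- A bound on `x - log (1 + x)` bounds `x` from above. -/
theorem le_of_sub_log_le {x Q : ℝ} (hx : -1 < x) (hQ : 0 ≤ Q)
    (h : x - Real.log (1 + x) ≤ Q / 2) : x ≤ Q + 1 := by
  by_contra! hlt
  have h0 : 0 ≤ x := by linarith
  have h1 : 0 < 1 + x := by linarith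
  have h2 := sq_le_mul_sub_log (Q := x) hx h0 (by linarith)
  have h3 : Real.log (1 + x) ≤ Real.sinh (Real.log (1 + x)) :=
    Real.self_le_sinh_iff.2 (Real.log_nonneg (by linarith))
  rw [Real.sinh_log h1] at h3
  have e : x - (1 + x - (1 + x)⁻¹) / 2 = x ^ 2 / (2 * (1 + x)) := by field_simp; ring
  have h4 : x ^ 2 / (2 * (1 + x)) ≤ Q / 2 := by linarith
  rw [div_le_iff₀ (by linarith)] at h4
  nlinarith

variable {m : ℕ} {n : Fin m → ℕ}

/-- The relative deviations from uniform of the weights in the ambiguity set are bounded in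
square sum, uniformly over the sample sizes. -/
theorem ambiguitySet_bounds {q : ℕ} {α : ℝ} (hn : ∀ p, 0 < n p) {w : ∀ p, Fin (n p) → ℝ}
    (hQ : 0 ≤ chiSqQuantile q (1 - α)) (hw : w ∈ ambiguitySet q α n) :
    (∀ p j, n p * w p j ≤ chiSqQuantile q (1 - α) + 2) ∧
    ∀ p, ∑ j, (n p * w p j - 1) ^ 2 ≤
      chiSqQuantile q (1 - α) * (chiSqQuantile q (1 - α) + 2) := by
  obtain ⟨h1, h2, h3⟩ := hw
  set Q := chiSqQuantile q (1 - α)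
  have hnr : ∀ p, (0 : ℝ) < n p := fun p => by exact_mod_cast hn p
  have hgt : ∀ p j, -1 < n p * w p j - 1 := fun p j => by
    have := mul_pos (hnr p) (h2 p j)
    linarith
  have hnn : ∀ p j, 0 ≤ (n p * w p j - 1) - Real.log (1 + (n p * w p j - 1)) := fun p j => by
    have := Real.log_le_sub_one_of_pos (x := 1 + (n p * w p j - 1)) (by linarith [hgt p j])
    linarith
  have hsum0 : ∀ p, ∑ j, (n p * w p j - 1) = 0 := fun p => by
    rw [Finset.sum_sub_distrib, ← Finset.mul_sum, (h1 p).2]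
    simp
  have hsum : ∑ p, ∑ j, ((n p * w p j - 1) - Real.log (1 + (n p * w p j - 1))) ≤ Q / 2 := by
    simp only [Finset.sum_sub_distrib (f := fun j => _ - (1 : ℝ)), hsum0, add_sub_cancel,
      zero_sub, Finset.sum_neg_distrib]
    linarith
  have hsump : ∀ p, ∑ j, ((n p * w p j - 1) - Real.log (1 + (n p * w p j - 1))) ≤ Q / 2 :=
    fun p => (Finset.single_le_sum (f := fun p => ∑ j, ((n p * w p j - 1) -
      Real.log (1 + (n p * w p j - 1)))) (fun p _ => Finset.sum_nonneg fun j _ => hnn p j)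
      (Finset.mem_univ p)).trans hsum
  have hle : ∀ p j, n p * w p j - 1 ≤ Q + 1 := fun p j =>
    le_of_sub_log_le (hgt p j) hQ ((Finset.single_le_sum (f := fun j => (n p * w p j - 1) -
      Real.log (1 + (n p * w p j - 1))) (fun j _ => hnn p j) (Finset.mem_univ j)).trans (hsump p))
  refine ⟨fun p j => by linarith [hle p j], fun p => ?_⟩
  calc ∑ j, (n p * w p j - 1) ^ 2
      ≤ ∑ j, 2 * (Q + 2) * ((n p * w p j - 1) - Real.log (1 + (n p * w p j - 1))) :=
        Finset.sum_le_sum fun j _ => sq_le_mul_sub_log (hgt p j) hQ (hle p j)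
    _ = 2 * (Q + 2) * ∑ j, ((n p * w p j - 1) - Real.log (1 + (n p * w p j - 1))) := by
        rw [Finset.mul_sum]
    _ ≤ 2 * (Q + 2) * (Q / 2) := mul_le_mul_of_nonneg_left (hsump p) (by linarith)
    _ = Q * (Q + 2) := by ring

theorem neg_two_mul_log_le {δ ε : ℝ} (hε : ε ≤ 1 / 2) (hδ : |δ| ≤ ε) :
    -2 * Real.log (1 + δ) ≤ -2 * δ + δ ^ 2 * (1 + 4 * ε) := by
  have h1 : |-δ| < 1 := by rw [abs_neg]; linarith
  have h2 := Real.abs_log_sub_add_sum_range_le h1 2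
  simp only [Finset.sum_range_succ, Finset.sum_range_zero, sub_neg_eq_add, abs_neg] at h2
  have h3 : |δ| ^ (2 + 1) / (1 - |δ|) ≤ 2 * (δ ^ 2 * ε) := by
    rw [div_le_iff₀ (by linarith)]
    have h4 : |δ| ^ (2 + 1) = δ ^ 2 * |δ| := by rw [pow_succ, sq_abs]
    have h5 := mul_le_mul_of_nonneg_left hδ (sq_nonneg δ)
    have h6 : 0 ≤ δ ^ 2 * ε := mul_nonneg (sq_nonneg δ) ((abs_nonneg δ).trans hδ)
    rw [h4]
    nlinarith
  have h4 := (abs_le.1 (h2.trans h3)).1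
  norm_num at h4
  nlinarith

/-- Weights with small relative deviations `δ` from uniform lie in the ambiguity set as soon as the
square sum of the deviations is slightly below the chi-square quantile. -/
theorem mem_ambiguitySet {q : ℕ} {α : ℝ} (hn : ∀ p, 0 < n p) {δ : ∀ p, Fin (n p) → ℝ}
    (hδ : ∀ p, ∑ j, δ p j = 0) {ε : ℝ} (hε : ε ≤ 1 / 2) (hδε : ∀ p j, |δ p j| ≤ ε)
    (hsq : (∑ p, ∑ j, δ p j ^ 2) * (1 + 4 * ε) ≤ chiSqQuantile q (1 - α)) :
    (fun p j => (1 + δ p j) / n p) ∈ ambiguitySet q α n := by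
  have hnr : ∀ p, (0 : ℝ) < n p := fun p => by exact_mod_cast hn p
  have hpos : ∀ p j, 0 < (1 + δ p j) / n p := fun p j =>
    div_pos (by linarith [(abs_le.1 (hδε p j)).1]) (hnr p)
  refine ⟨fun p => ⟨fun j => (hpos p j).le, ?_⟩, hpos, le_trans ?_ hsq⟩
  · rw [← Finset.sum_div, Finset.sum_add_distrib, hδ]
    have := (hnr p).ne'
    simp [this]
  · rw [Finset.mul_sum, Finset.sum_mul]
    refine Finset.sum_le_sum fun p _ => ?_
    rw [Finset.mul_sum, Finset.sum_mul]
    calc ∑ j, -2 * Real.log (n p * ((1 + δ p j) / n p))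
        ≤ ∑ j, (-2 * δ p j + δ p j ^ 2 * (1 + 4 * ε)) := by
          refine Finset.sum_le_sum fun j _ => ?_
          rw [mul_div_cancel₀ _ (hnr p).ne']
          exact neg_two_mul_log_le hε (hδε p j)
      _ = ∑ j, δ p j ^ 2 * (1 + 4 * ε) := by
          rw [Finset.sum_add_distrib, ← Finset.mul_sum, hδ, mul_zero, zero_add]

end Ambiguity

/-! ### Influence functions -/

section Influence

/-- A power of a mixture of two laws is a mixture over the set `A` of coordinates that are drawn
from the second law. -/
theorem pi_add_smul {ι α : Type*} [Fintype ι] [DecidableEq ι] [MeasurableSpace α]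
    (μ ν : Measure α) [IsFiniteMeasure μ] [IsFiniteMeasure ν] {a b : ℝ≥0∞} (ha : a ≠ ⊤)
    (hb : b ≠ ⊤) :
    Measure.pi (fun _ : ι => a • μ + b • ν) = ∑ A : Finset ι,
      (b ^ A.card * a ^ (Fintype.card ι - A.card)) •
        Measure.pi (fun i => if i ∈ A then ν else μ) := by
  have : IsFiniteMeasure (a • μ) := Measure.smul_finite μ ha
  have : IsFiniteMeasure (b • ν) := Measure.smul_finite ν hb
  refine Measure.pi_eq fun s hs => ?_
  simp only [Measure.coe_finsetSum, Finset.sum_apply, smul_eq_mul,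
    Measure.coe_add, Pi.add_apply, Measure.coe_smul, Pi.smul_apply]
  simp only [add_comm (a * _)]
  rw [Finset.prod_add, Finset.powerset_univ]
  refine Finset.sum_congr rfl fun A _ => ?_
  have : ∀ i, IsFiniteMeasure (if i ∈ A then ν else μ) := fun i => by
    split_ifs <;> infer_instance
  rw [Measure.pi_pi, Finset.prod_mul_distrib, Finset.prod_mul_distrib, Finset.prod_const,
    Finset.prod_const, ← Finset.compl_eq_univ_sdiff, Finset.card_compl,
    ← Finset.prod_mul_prod_compl A fun i => (if i ∈ A then ν else μ) (s i)]
  have e1 : ∏ i ∈ A, (if i ∈ A then ν else μ) (s i) = ∏ i ∈ A, ν (s i) :=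
    Finset.prod_congr rfl fun i hi => by rw [if_pos hi]
  have e2 : ∏ i ∈ Aᶜ, (if i ∈ A then ν else μ) (s i) = ∏ i ∈ Aᶜ, μ (s i) :=
    Finset.prod_congr rfl fun i hi => by rw [if_neg (Finset.mem_compl.1 hi)]
  rw [e1, e2]
  ring

theorem pi_update_sum {ι κ : Type*} [Fintype ι] [DecidableEq ι] [Fintype κ] {α : ι → Type*}
    [∀ i, MeasurableSpace (α i)] (μ : ∀ i, Measure (α i)) [∀ i, IsFiniteMeasure (μ i)] (p : ι)
    (a : κ → ℝ≥0∞) (ha : ∀ k, a k ≠ ⊤) (ρ : κ → Measure (α p)) [∀ k, IsFiniteMeasure (ρ k)] :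
    Measure.pi (Function.update μ p (∑ k, a k • ρ k)) =
      ∑ k, a k • Measure.pi (Function.update μ p (ρ k)) := by
  have hf : ∀ σ : Measure (α p), IsFiniteMeasure σ → ∀ i,
      IsFiniteMeasure (Function.update μ p σ i) := by
    intro σ hσ i
    by_cases h : i = p
    · subst h; simpa using hσ
    · simp only [ne_eq, h, not_false_eq_true, Function.update_of_ne]; infer_instance
  have hsum : IsFiniteMeasure (∑ k, a k • ρ k) := by
    refine ⟨?_⟩
    simp only [Measure.coe_finsetSum, Finset.sum_apply, Measure.smul_apply, smul_eq_mul]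
    exact ENNReal.sum_lt_top.2 fun k _ => ENNReal.mul_lt_top (ha k).lt_top (measure_lt_top _ _)
  have := hf _ hsum
  refine Measure.pi_eq fun s hs => ?_
  simp only [Measure.coe_finsetSum, Finset.sum_apply, Measure.smul_apply, smul_eq_mul]
  have key : ∀ σ : Measure (α p), ∏ i, Function.update μ p σ i (s i) =
      σ (s p) * ∏ i ∈ Finset.univ.erase p, μ i (s i) := by
    intro σ
    rw [← Finset.mul_prod_erase _ _ (Finset.mem_univ p), Function.update_self]
    congr 1
    exact Finset.prod_congr rfl fun i hi => by rw [Function.update_of_ne (Finset.ne_of_mem_erase hi)]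
  rw [key]
  simp only [Measure.coe_finsetSum, Finset.sum_apply, Measure.smul_apply, smul_eq_mul,
    Finset.sum_mul]
  refine Finset.sum_congr rfl fun k _ => ?_
  have := hf (ρ k) inferInstance
  rw [Measure.pi_pi, key, mul_assoc]

variable {m : ℕ} {S : Fin m → Type*} [∀ p, MeasurableSpace (S p)] {c : Fin m → ℕ}
  {F : ∀ p, Measure (S p)} [∀ p, IsProbabilityMeasure (F p)] {h : Sample S c → ℝ}

theorem productLaw_update (c : Fin m → ℕ) (F : ∀ p, Measure (S p)) (p : Fin m)
    (ν : Measure (S p)) : productLaw c (Function.update F p ν) =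
      Measure.pi (Function.update (fun p' => Measure.pi fun _ : Fin (c p') => F p') p
        (Measure.pi fun _ => ν)) := by
  unfold productLaw
  congr 1
  funext p'
  by_cases hp : p' = p
  · subst hp; simp
  · simp [hp]

/-- Planting `y` in the slots `A` replaces the law of each of these slots by a point mass. -/
theorem map_setSlots_eq (p : Fin m) (A : Finset (Fin (c p))) (y : S p) :
    (productLaw c F).map (fun z => setSlots z p A y) =
      Measure.pi (Function.update (fun p' => Measure.pi fun _ : Fin (c p') => F p') p
        (Measure.pi fun t => if t ∈ A then Measure.dirac y else F p)) := by
  let f : ∀ p', (Fin (c p') → S p') → (Fin (c p') → S p') :=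
    Function.update (fun _ z => z) p fun z t => if t ∈ A then y else z t
  have hf : (fun z : Sample S c => setSlots z p A y) = fun z p' => f p' (z p') := by
    funext z p'
    by_cases hp : p' = p
    · subst hp; simp [f, setSlots]
    · simp [f, hp, setSlots]
  have h1 : (Measure.pi fun _ : Fin (c p) => F p).map (fun z t => if t ∈ A then y else z t) =
      Measure.pi fun t => if t ∈ A then Measure.dirac y else F p := by
    let k : Fin (c p) → S p → S p := fun t => if t ∈ A then fun _ => y else id
    have hk : (fun (z : Fin (c p) → S p) t => if t ∈ A then y else z t) = fun z t => k t (z t) := by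
      funext z t
      by_cases ht : t ∈ A <;> simp [k, ht]
    have hkm : ∀ t, Measurable (k t) := fun t => by
      by_cases ht : t ∈ A <;> simp only [k, ht, if_true, if_false] <;> fun_prop
    have hmap : ∀ t, (F p).map (k t) = if t ∈ A then Measure.dirac y else F p := fun t => by
      by_cases ht : t ∈ A <;> simp [k, ht]
    have : ∀ t, SigmaFinite ((F p).map (k t)) := fun t => by
      rw [hmap]; split_ifs <;> infer_instance
    rw [hk, Measure.pi_map_pi fun t => (hkm t).aemeasurable]
    simp only [hmap]
  have hprob : ∀ t, IsProbabilityMeasure (if t ∈ A then Measure.dirac y else F p) := fun t => by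
    split_ifs <;> infer_instance
  have hfm : ∀ p', Measurable (f p') := by
    intro p'
    by_cases hp : p' = p
    · subst hp
      simp only [f, Function.update_self]
      refine measurable_pi_lambda _ fun t => ?_
      by_cases ht : t ∈ A <;> simp only [ht, if_true, if_false] <;> fun_prop
    · simp only [f, ne_eq, hp, not_false_eq_true, Function.update_of_ne]
      exact measurable_id
  have hmap : ∀ p', (Measure.pi fun _ : Fin (c p') => F p').map (f p') =
      Function.update (fun p' => Measure.pi fun _ : Fin (c p') => F p') p
        (Measure.pi fun t => if t ∈ A then Measure.dirac y else F p) p' := by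
    intro p'
    by_cases hp : p' = p
    · subst hp
      simp only [f, Function.update_self]
      exact h1
    · simp only [f, ne_eq, hp, not_false_eq_true, Function.update_of_ne]
      exact Measure.map_id
  have : ∀ p', SigmaFinite ((Measure.pi fun _ : Fin (c p') => F p').map (f p')) := fun p' => by
    have := Measure.isProbabilityMeasure_map (μ := Measure.pi fun _ : Fin (c p') => F p')
      (hfm p').aemeasurable
    infer_instance
  rw [hf, productLaw, Measure.pi_map_pi fun p' => (hfm p').aemeasurable]
  simp only [hmap]

/-- Under the contaminated input model `a F p + b δ_y`, the inputs arise by planting `y` in a random set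
of slots of source `p`. -/
theorem productLaw_mixture (p : Fin m) (y : S p) {a b : ℝ≥0∞} (ha : a ≠ ⊤) (hb : b ≠ ⊤) :
    productLaw c (Function.update F p (a • F p + b • Measure.dirac y)) =
      ∑ A : Finset (Fin (c p)), (b ^ A.card * a ^ (c p - A.card)) •
        (productLaw c F).map fun z => setSlots z p A y := by
  simp only [map_setSlots_eq]
  have : ∀ A : Finset (Fin (c p)), IsFiniteMeasure
      (Measure.pi fun t => if t ∈ A then Measure.dirac y else F p) := fun A => by
    have : ∀ t, IsFiniteMeasure (if t ∈ A then Measure.dirac y else F p) := fun t => by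
      split_ifs <;> infer_instance
    infer_instance
  rw [productLaw_update, pi_add_smul _ _ ha hb, pi_update_sum]
  · simp
  · exact fun A => ENNReal.mul_ne_top (ENNReal.pow_ne_top hb) (ENNReal.pow_ne_top ha)

/-- Planting the same random point in several slots is a pattern of ties, so the moment conditions with
repeated inputs give integrability. -/
theorem ae_integrable_setSlots (hT : TieL2 F h) (p : Fin m) (A : Finset (Fin (c p))) :
    ∀ᵐ y ∂F p, Integrable (fun z => h (setSlots z p A y)) (productLaw c F) := by
  rcases A.eq_empty_or_nonempty with rfl | ⟨t₀, ht₀⟩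
  · refine ae_of_all _ fun y => ?_
    simpa [setSlots] using hT.memLp.integrable (by norm_num)
  · let I : ∀ p', Fin (c p') → Fin (c p') :=
      Function.update (fun _ t => t) p fun t => if t ∈ A then t₀ else t
    have h1 := ae_integrable_setSlot (F := F) ((hT.2 I).integrable (by norm_num)) ⟨p, t₀⟩
    filter_upwards [h1] with y hy
    convert hy using 3 with z
    funext p' t
    by_cases hp : p' = p
    · subst hp
      by_cases ht : t ∈ A
      · simp [I, setSlots_same, ht]
      · have : t ≠ t₀ := fun h => ht (h ▸ ht₀)
        simp [I, setSlots_same, ht, this]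
    · simp [I, setSlots_of_ne _ hp, hp]

theorem meanPerf_mixture (hm : Measurable h) (p : Fin m) (y : S p)
    (hy : ∀ A, Integrable (fun z => h (setSlots z p A y)) (productLaw c F))
    {ε : ℝ} (h0 : 0 ≤ ε) (h1 : ε ≤ 1) :
    meanPerf h (Function.update F p
      (ENNReal.ofReal (1 - ε) • F p + ENNReal.ofReal ε • Measure.dirac y)) =
      ∑ A : Finset (Fin (c p)), (ε ^ A.card * (1 - ε) ^ (c p - A.card)) *
        ∫ z, h (setSlots z p A y) ∂productLaw c F := by
  rw [meanPerf, productLaw_mixture p y ENNReal.ofReal_ne_top ENNReal.ofReal_ne_top]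
  have hms : ∀ A : Finset (Fin (c p)), Measurable fun z : Sample S c => setSlots z p A y :=
    fun A => measurable_setSlots_left p A y
  have hint : ∀ A : Finset (Fin (c p)), Integrable h
      ((productLaw c F).map fun z => setSlots z p A y) := fun A =>
    (integrable_map_measure hm.aestronglyMeasurable (hms A).aemeasurable).2 (hy A)
  rw [integral_finsetSum_measure fun A _ => (hint A).smul_measure
    (ENNReal.mul_ne_top (ENNReal.pow_ne_top ENNReal.ofReal_ne_top)
      (ENNReal.pow_ne_top ENNReal.ofReal_ne_top))]
  refine Finset.sum_congr rfl fun A _ => ?_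
  rw [integral_smul_measure, integral_map (hms A).aemeasurable hm.aestronglyMeasurable,
    ENNReal.toReal_mul, ENNReal.toReal_pow, ENNReal.toReal_pow, ENNReal.toReal_ofReal h0,
    ENNReal.toReal_ofReal (by linarith), smul_eq_mul]

/-- At `ε = 0` only the sets of at most one contaminated slot contribute to the derivative. -/
theorem hasDerivAt_mixture_weight (k l : ℕ) :
    HasDerivAt (fun ε : ℝ => ε ^ k * (1 - ε) ^ l)
      (if k = 0 then -(l : ℝ) else if k = 1 then 1 else 0) 0 := by
  have h1 := (hasDerivAt_id (0 : ℝ)).pow k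
  have h2 := ((hasDerivAt_id (0 : ℝ)).const_sub 1).pow l
  have h3 := h1.mul h2
  refine (h3.congr_deriv ?_)
  rcases k with _ | _ | k
  · simp
  · simp
  · simp

/-- The performance under an `ε`-contamination is a polynomial in `ε`, whose derivative at `0` is the sum
of the effects of contaminating a single slot. -/
theorem influence_eq_inflSum (hT : TieL2 F h) (p : Fin m) :
    influence h F p =ᵐ[F p] inflSum F h p := by
  have hae : ∀ᵐ y ∂F p, ∀ A, Integrable (fun z => h (setSlots z p A y)) (productLaw c F) :=
    ae_all_iff.2 fun A => ae_integrable_setSlots hT p A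
  filter_upwards [hae] with y hy
  let f : ℝ → ℝ := fun ε => ∑ A : Finset (Fin (c p)), (ε ^ A.card * (1 - ε) ^ (c p - A.card)) *
    ∫ z, h (setSlots z p A y) ∂productLaw c F
  have hempty : ∫ z, h (setSlots z p ∅ y) ∂productLaw c F = meanPerf h F := by
    simp [setSlots, meanPerf]
  have hderiv : HasDerivAt f (inflSum F h p y) 0 := by
    have h1 : HasDerivAt f (∑ A : Finset (Fin (c p)),
        (if A.card = 0 then -((c p - A.card : ℕ) : ℝ) else if A.card = 1 then 1 else 0) *
          ∫ z, h (setSlots z p A y) ∂productLaw c F) 0 :=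
      HasDerivAt.fun_sum fun A _ => (hasDerivAt_mixture_weight _ _).mul_const _
    refine h1.congr_deriv ?_
    have h2 : ∀ A : Finset (Fin (c p)),
        (if A.card = 0 then -((c p - A.card : ℕ) : ℝ) else if A.card = 1 then 1 else 0) *
          (∫ z, h (setSlots z p A y) ∂productLaw c F) =
        (if A = ∅ then -(c p * meanPerf h F) else 0) +
          ∑ t, if A = {t} then proj F h ⟨p, t⟩ y else 0 := by
      intro A
      by_cases h0 : A = ∅
      · subst h0
        simp [hempty, eq_comm (a := (∅ : Finset (Fin (c p))))]
      · by_cases h1 : A.card = 1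
        · obtain ⟨t, rfl⟩ := Finset.card_eq_one.1 h1
          simp [proj, Finset.singleton_inj]
        · have h3 : ∀ t, A ≠ {t} := fun t ht => h1 (by rw [ht]; simp)
          simp [h0, h1, h3]
    simp only [h2, Finset.sum_add_distrib]
    rw [Finset.sum_comm]
    simp [inflSum]
    ring
  have hzero : f 0 = meanPerf h F := by
    have := meanPerf_mixture hT.1 p y hy le_rfl zero_le_one
    simp only [f]
    rw [← this]
    simp
  have hlim := hderiv.tendsto_slope_zero_right
  unfold influence
  refine Tendsto.limUnder_eq (hlim.congr' ?_)
  filter_upwards [Ioo_mem_nhdsGT (zero_lt_one' ℝ)] with ε hε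
  rw [meanPerf_mixture hT.1 p y hy hε.1.le hε.2.le, zero_add, hzero, smul_eq_mul, div_eq_inv_mul]

end Influence

/-! ### Simulation errors -/

section ConditionalSampling

open scoped BigOperators

/-- Integrals over conditionally i.i.d. replications, by conditioning. -/
theorem IsCondIID.lintegral_eq {Ω 𝓨 E : Type*} [MeasurableSpace Ω] [MeasurableSpace 𝓨]
    [MeasurableSpace E] {R : ℕ} {Z : Fin R → Ω → E} {Y : Ω → 𝓨} {law : 𝓨 → Measure E}
    {P : Measure Ω} [IsProbabilityMeasure P] (h : IsCondIID Z Y law P) (hY : Measurable Y)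
    {G : 𝓨 × (Fin R → E) → ℝ≥0∞} (hG : Measurable G) :
    ∫⁻ ω, G (Y ω, fun r => Z r ω) ∂P =
      ∫⁻ ω, ∫⁻ z, G (Y ω, z) ∂(Measure.pi fun _ => law (Y ω)) ∂P := by
  obtain ⟨κ, hκ, hlaw, hcond⟩ := h
  have h1 : ∫⁻ ω, G (Y ω, fun r => Z r ω) ∂P = ∫⁻ y, ∫⁻ z, G (y, z) ∂κ y ∂(P.map Y) := by
    rw [← Measure.lintegral_compProd hG, ← hcond.map_eq,
      lintegral_map' hG.aemeasurable hcond.aemeasurable]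
  rw [h1, lintegral_map hG.lintegral_kernel_prod_right' hY]
  refine lintegral_congr_ae ?_
  filter_upwards [ae_of_ae_map hY.aemeasurable hlaw] with ω hω
  rw [hω]

/-- The mean square error of an average of `R` independent draws is at most `1 / R` times the
second moment. -/
theorem lintegral_sq_average_sub_le {E : Type*} [MeasurableSpace E] {μ : Measure E}
    [IsProbabilityMeasure μ] {f : E → ℝ} (hf : MemLp f 2 μ) {R : ℕ} (hR : 0 < R) :
    ∫⁻ z, ENNReal.ofReal ((1 / (R : ℝ) * ∑ r, f (z r) - ∫ y, f y ∂μ) ^ 2)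
      ∂(Measure.pi fun _ : Fin R => μ) ≤ ENNReal.ofReal ((∫ y, f y ^ 2 ∂μ) / R) := by
  have hR' : (R : ℝ) ≠ 0 := by exact_mod_cast hR.ne'
  have hmp : ∀ r : Fin R, MeasurePreserving (Function.eval r) (Measure.pi fun _ : Fin R => μ) μ :=
    fun r => measurePreserving_eval _ r
  have hfr : ∀ r : Fin R, MemLp (fun z : Fin R → E => f (z r)) 2 (Measure.pi fun _ => μ) :=
    fun r => hf.comp_measurePreserving (hmp r)
  have hs : MemLp (fun z : Fin R → E => 1 / (R : ℝ) * ∑ r, f (z r)) 2 (Measure.pi fun _ => μ) :=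
    (memLp_finsetSum _ fun r _ => hfr r).const_mul _
  have hmean : ∫ z, 1 / (R : ℝ) * ∑ r, f (z r) ∂(Measure.pi fun _ : Fin R => μ) =
      ∫ y, f y ∂μ := by
    rw [integral_const_mul, integral_finsetSum _ fun r _ => (hfr r).integrable (by norm_num)]
    have : ∀ r : Fin R, ∫ z, f (z r) ∂(Measure.pi fun _ : Fin R => μ) = ∫ y, f y ∂μ := by
      intro r
      have := integral_map (μ := Measure.pi fun _ : Fin R => μ) (hmp r).measurable.aemeasurable
        (f := f) (by rw [(hmp r).map_eq]; exact hf.1)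
      rw [(hmp r).map_eq] at this
      exact this.symm
    simp only [this]
    simp [hR']
  have hvar : Var[fun z : Fin R → E => 1 / (R : ℝ) * ∑ r, f (z r); Measure.pi fun _ => μ] =
      Var[f; μ] / R := by
    rw [variance_const_mul]
    have := variance_sum_pi (μ := fun _ : Fin R => μ) (X := fun _ => f) fun _ => hf
    have e : (∑ r : Fin R, fun z : Fin R → E => f (z r)) = fun z => ∑ r, f (z r) := by
      funext z; simp
    rw [e] at this
    rw [this]
    simp
    field_simp
  have hsub : MemLp (fun z : Fin R → E => 1 / (R : ℝ) * ∑ r, f (z r) - ∫ y, f y ∂μ) 2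
      (Measure.pi fun _ => μ) := hs.sub (memLp_const _)
  rw [← ofReal_integral_eq_lintegral_ofReal hsub.integrable_sq
    (ae_of_all _ fun z => sq_nonneg _)]
  refine ENNReal.ofReal_le_ofReal ?_
  have h2 := variance_eq_integral hs.aestronglyMeasurable.aemeasurable
  rw [hmean] at h2
  rw [← h2, hvar]
  gcongr
  have := variance_le_expectation_sq hf.1
  simpa using this

theorem lintegral_ofReal_expect_le {X ι : Type*} [MeasurableSpace X] {μ : Measure X} [Fintype ι]
    {g : ι → X → ℝ} (hg0 : ∀ i x, 0 ≤ g i x) (hgm : ∀ i, Measurable (g i)) {b : ι → ℝ}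
    (hb0 : ∀ i, 0 ≤ b i) (hb : ∀ i, ∫⁻ x, ENNReal.ofReal (g i x) ∂μ ≤ ENNReal.ofReal (b i)) :
    ∫⁻ x, ENNReal.ofReal (𝔼 i, g i x) ∂μ ≤ ENNReal.ofReal (𝔼 i, b i) := by
  have e : ∀ f : ι → ℝ, (∀ i, 0 ≤ f i) → ENNReal.ofReal (𝔼 i, f i) =
      ENNReal.ofReal ((Fintype.card ι : ℝ)⁻¹) * ∑ i, ENNReal.ofReal (f i) := by
    intro f hf
    rw [Fintype.expect_eq_sum_div_card, div_eq_inv_mul, ENNReal.ofReal_mul (by positivity),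
      ENNReal.ofReal_sum_of_nonneg fun i _ => hf i]
  rw [e b hb0]
  simp only [fun x => e (fun i => g i x) fun i => hg0 i x]
  rw [lintegral_const_mul _ (Finset.measurable_sum _ fun i _ => (hgm i).ennreal_ofReal),
    lintegral_finsetSum _ fun i _ => (hgm i).ennreal_ofReal]
  gcongr with i
  exact hb i

variable {m : ℕ} {S : Fin m → Type*} [∀ p, MeasurableSpace (S p)] {n c : Fin m → ℕ}
  {F : ∀ p, Measure (S p)} [∀ p, IsProbabilityMeasure (F p)] {h : Sample S c → ℝ}
  {Ω : Type*} [MeasurableSpace Ω] {P : Measure Ω} [IsProbabilityMeasure P] {R : ℕ}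
  {X : Ω → Sample S n}

theorem isProbabilityMeasure_productLaw_weightedEdf (x : Sample S n) {w : ∀ p, Fin (n p) → ℝ}
    (hw : ∀ p, w p ∈ stdSimplex ℝ (Fin (n p))) :
    IsProbabilityMeasure (productLaw c (weightedEdf x w)) := by
  have := isProbabilityMeasure_weightedEdf x hw
  infer_instance

theorem memLp_weighted {f : Sample S c → ℝ} (hf : Measurable f) (x : Sample S n)
    {w : ∀ p, Fin (n p) → ℝ} (hw : ∀ p, w p ∈ stdSimplex ℝ (Fin (n p))) :
    MemLp f 2 (productLaw c (weightedEdf x w)) :=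
  (memLp_two_iff_integrable_sq hf.aestronglyMeasurable).2
    (integrable_weighted (hf.pow_const 2) x hw)

/-- The error of a simulation average under a reweighted empirical model. -/
theorem lintegral_simulation_error_le (hh : Measurable h) (hX : Measurable X)
    (hXlaw : P.map X = productLaw n F) (hn : ∀ p, 0 < n p) (hR : 0 < R)
    {W : Ω → ∀ p, Fin (n p) → ℝ} (hW : Measurable W)
    (hWs : ∀ᵐ ω ∂P, ∀ p, W ω p ∈ stdSimplex ℝ (Fin (n p))) {C : ℝ} (hC : 0 ≤ C)
    (hWC : ∀ᵐ ω ∂P, ∀ p j, n p * W ω p j ≤ C) {Z : Fin R → Ω → Sample S c}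
    (hcond : IsCondIID Z (fun ω => (X ω, W ω)) (fun y => productLaw c (weightedEdf y.1 y.2)) P) :
    ∫⁻ ω, ENNReal.ofReal ((1 / (R : ℝ) * ∑ r, h (Z r ω) - wMean h (X ω) (W ω)) ^ 2) ∂P ≤
      ENNReal.ofReal (C ^ Fintype.card (Σ p, Fin (c p)) / R) *
        ∫⁻ x, ENNReal.ofReal (𝔼 J : Idx n c, h (pick x J) ^ 2) ∂productLaw n F := by
  let G : (Sample S n × (∀ p, Fin (n p) → ℝ)) × (Fin R → Sample S c) → ℝ≥0∞ := fun y =>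
    ENNReal.ofReal ((1 / (R : ℝ) * ∑ r, h (y.2 r) - wMean h y.1.1 y.1.2) ^ 2)
  have hG : Measurable G := by
    have h1 : Measurable fun y : (Sample S n × (∀ p, Fin (n p) → ℝ)) × (Fin R → Sample S c) =>
        wMean h y.1.1 y.1.2 := measurable_wMean hh (by fun_prop) (by fun_prop)
    have h2 : Measurable fun y : (Sample S n × (∀ p, Fin (n p) → ℝ)) × (Fin R → Sample S c) =>
        1 / (R : ℝ) * ∑ r, h (y.2 r) := by fun_prop
    exact ((h2.sub h1).pow_const 2).ennreal_ofReal
  have hφ : Measurable fun x : Sample S n => ENNReal.ofReal (𝔼 J : Idx n c, h (pick x J) ^ 2) := by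
    simp only [Fintype.expect_eq_sum_div_card]
    fun_prop
  rw [← hXlaw, lintegral_map hφ hX]
  refine le_trans ?_ (lintegral_const_mul _ (hφ.comp hX)).le
  refine (hcond.lintegral_eq (hX.prodMk hW) hG).le.trans ?_
  refine lintegral_mono_ae ?_
  filter_upwards [hWs, hWC] with ω h1 h2
  have := isProbabilityMeasure_productLaw_weightedEdf (c := c) (X ω) h1
  have h3 := lintegral_sq_average_sub_le (memLp_weighted hh (X ω) h1) hR
  rw [integral_weighted hh (X ω) h1, integral_weighted (hh.pow_const 2) (X ω) h1] at h3
  refine h3.trans ?_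
  simp only [Function.comp_apply]
  rw [← ENNReal.ofReal_mul (by positivity)]
  refine ENNReal.ofReal_le_ofReal ?_
  have h4 := wMean_le_of_weights_le (c := c) hn (h := fun z => h z ^ 2) (fun z => sq_nonneg _) (X ω)
    (fun p j => (h1 p).1 j) h2
  rw [div_mul_eq_mul_div]
  gcongr

/-- Laws without atoms almost surely produce distinct data. -/
theorem ae_injective_data [∀ p, MeasurableEq (S p)] [∀ p, NullSingletonClass (F p)] :
    ∀ᵐ x ∂productLaw n F, ∀ p, Function.Injective (x p) := by
  have key : ∀ p (j j' : Fin (n p)), ∀ᵐ x ∂productLaw n F, x p j = x p j' → j = j' := by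
    intro p j j'
    by_cases hj : j = j'
    · exact ae_of_all _ fun x _ => hj
    · have hmp := measurePreserving_setSlot n F p j
      have hms : MeasurableSet {x : Sample S n | x p j = x p j'} :=
        measurableSet_eq_fun (by fun_prop) (by fun_prop)
      have h0 : productLaw n F {x : Sample S n | x p j = x p j'} = 0 := by
        rw [← hmp.measure_preimage hms.nullMeasurableSet,
          Measure.prod_apply (hmp.measurable hms)]
        have : ∀ z : Sample S n, F p (Prod.mk z ⁻¹' ((fun zy : Sample S n × S p =>
            setSlots zy.1 p {j} zy.2) ⁻¹' {x : Sample S n | x p j = x p j'})) = 0 := by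
          intro z
          have : Prod.mk z ⁻¹' ((fun zy : Sample S n × S p =>
            setSlots zy.1 p {j} zy.2) ⁻¹' {x : Sample S n | x p j = x p j'}) = {z p j'} := by
            ext y
            simp [setSlots_same, Ne.symm hj]
          rw [this, measure_singleton]
        exact (lintegral_congr this).trans (by simp)
      have := measure_eq_zero_iff_ae_notMem.1 h0
      filter_upwards [this] with x hx hxj
      exact absurd hxj hx
  simp only [Function.Injective]
  refine ae_all_iff.2 fun p => ae_all_iff.2 fun j => ae_all_iff.2 fun j' => key p j j'

/-- The simulation estimate of the slot mean of `h` at the data point `x p j`. -/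
def slotEstimate (h : Sample S c → ℝ) (x : Sample S n) (z : Fin R → Sample S c)
    (s : Σ p, Fin (c p)) (j : Fin (n s.1)) : ℝ :=
  1 / (R : ℝ) * ∑ r, h (z r) *
    (n s.1 * ({x s.1 j} : Set (S s.1)).indicator (fun _ => (1 : ℝ)) (z r s.1 s.2))

theorem measurable_slotMean (hh : Measurable h) (s : Σ p, Fin (c p)) (j : Fin (n s.1)) :
    Measurable fun x : Sample S n => slotMean h x s j := by
  unfold slotMean
  simp only [Fintype.expect_eq_sum_div_card]
  fun_prop

theorem measurable_slotEstimate [∀ p, MeasurableEq (S p)] (hh : Measurable h)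
    (s : Σ p, Fin (c p)) (j : Fin (n s.1)) :
    Measurable fun y : Sample S n × (Fin R → Sample S c) => slotEstimate h y.1 y.2 s j := by
  classical
  unfold slotEstimate
  refine measurable_const.mul (Finset.measurable_sum _ fun r _ => ?_)
  refine Measurable.mul (by fun_prop) (measurable_const.mul ?_)
  simp only [Set.indicator_apply, Set.mem_singleton_iff]
  exact Measurable.ite (measurableSet_eq_fun (by fun_prop) (by fun_prop)) measurable_const
    measurable_const

/-- The slot means are estimated by simulation with mean square error of order `n / R`. -/
theorem lintegral_slotEstimate_error_le [∀ p, MeasurableEq (S p)] [∀ p, NullSingletonClass (F p)]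
    (hh : Measurable h) (hX : Measurable X)
    (hXlaw : P.map X = productLaw n F) (hn : ∀ p, 0 < n p) (hR : 0 < R)
    {Z : Fin R → Ω → Sample S c}
    (hcond : IsCondIID Z X (fun x => productLaw c (edf x)) P) (s : Σ p, Fin (c p)) :
    ∫⁻ ω, ENNReal.ofReal (𝔼 j, (slotEstimate h (X ω) (fun r => Z r ω) s j -
        slotMean h (X ω) s j) ^ 2) ∂P ≤
      ENNReal.ofReal (n s.1 / R) *
        ∫⁻ x, ENNReal.ofReal (𝔼 J : Idx n c, h (pick x J) ^ 2) ∂productLaw n F := by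
  have hns : (n s.1 : ℝ) ≠ 0 := by exact_mod_cast (hn s.1).ne'
  let g : Fin (n s.1) → Sample S n × (Fin R → Sample S c) → ℝ := fun j y =>
    (slotEstimate h y.1 y.2 s j - slotMean h y.1 s j) ^ 2
  have hgm : ∀ j, Measurable (g j) := fun j =>
    ((measurable_slotEstimate hh s j).sub
      ((measurable_slotMean hh s j).comp measurable_fst)).pow_const 2
  have hG : Measurable fun y => ENNReal.ofReal (𝔼 j, g j y) := by
    simp only [Fintype.expect_eq_sum_div_card]
    exact ((Finset.measurable_sum _ fun j _ => hgm j).div_const _).ennreal_ofReal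
  have hφ : Measurable fun x : Sample S n => ENNReal.ofReal (𝔼 J : Idx n c, h (pick x J) ^ 2) := by
    simp only [Fintype.expect_eq_sum_div_card]
    fun_prop
  rw [← hXlaw, lintegral_map hφ hX]
  refine le_trans ?_ (lintegral_const_mul _ (hφ.comp hX)).le
  refine (hcond.lintegral_eq hX hG).le.trans ?_
  refine lintegral_mono_ae ?_
  have hinj : ∀ᵐ ω ∂P, ∀ p, Function.Injective (X ω p) := by
    have := ae_injective_data (n := n) (F := F)
    rw [← hXlaw] at this
    exact ae_of_ae_map hX.aemeasurable this
  filter_upwards [hinj] with ω hω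
  have hw := edf_mem_simplex (n := n) hn
  have : IsProbabilityMeasure (productLaw c (edf (X ω))) :=
    isProbabilityMeasure_productLaw_weightedEdf (c := c) (X ω) hw
  let f : Fin (n s.1) → Sample S c → ℝ := fun j z =>
    h z * (n s.1 * ({X ω s.1 j} : Set (S s.1)).indicator (fun _ => (1 : ℝ)) (z s.1 s.2))
  have hfm : ∀ j, Measurable (f j) := fun j => hh.mul (measurable_const.mul
    ((measurable_const.indicator (measurableSet_singleton _)).comp (by fun_prop)))
  have hpick : ∀ j (J : Idx n c), ({X ω s.1 j} : Set (S s.1)).indicator (fun _ => (1 : ℝ))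
      (pick (X ω) J s.1 s.2) = if J s = j then 1 else 0 := by
    intro j J
    have e : (X ω s.1 (J s) = X ω s.1 j) ↔ J s = j := (hω s.1).eq_iff
    change Set.indicator _ _ (X ω s.1 (J s)) = _
    by_cases hJ : J s = j
    · simp [hJ]
    · rw [Set.indicator_of_notMem (by simpa using fun h => hJ (e.1 h)), if_neg hJ]
  have hmean : ∀ j, ∫ z, f j z ∂productLaw c (edf (X ω)) = slotMean h (X ω) s j := by
    intro j
    rw [edf, integral_weighted (hfm j) (X ω) hw, wMean_uniform hn, slotMean]
    refine Finset.expect_congr rfl fun J _ => ?_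
    simp only [f, hpick]
    ring
  have hsq : ∀ j, ∫ z, f j z ^ 2 ∂productLaw c (edf (X ω)) =
      𝔼 J : Idx n c, ((n s.1 : ℝ) ^ 2 * if J s = j then 1 else 0) * h (pick (X ω) J) ^ 2 := by
    intro j
    rw [edf, integral_weighted ((hfm j).pow_const 2) (X ω) hw, wMean_uniform hn]
    refine Finset.expect_congr rfl fun J _ => ?_
    simp only [f, hpick]
    split_ifs <;> ring
  have hb : ∀ j, ∫⁻ z, ENNReal.ofReal (g j (X ω, z))
      ∂(Measure.pi fun _ : Fin R => productLaw c (edf (X ω))) ≤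
      ENNReal.ofReal ((𝔼 J : Idx n c, ((n s.1 : ℝ) ^ 2 * if J s = j then 1 else 0) *
        h (pick (X ω) J) ^ 2) / R) := by
    intro j
    have := isProbabilityMeasure_productLaw_weightedEdf (c := c) (X ω) hw
    have := lintegral_sq_average_sub_le (memLp_weighted (hfm j) (X ω) hw) hR
    have e1 := hmean j
    have e2 := hsq j
    unfold edf at e1 e2
    rw [e1, e2] at this
    exact this
  refine (lintegral_ofReal_expect_le (fun j z => sq_nonneg _)
    (fun j => (hgm j).comp measurable_prodMk_left) (fun j => ?_) hb).trans ?_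
  · exact div_nonneg (Finset.expect_nonneg fun J _ => mul_nonneg (mul_nonneg (sq_nonneg _)
      (by split_ifs <;> simp)) (sq_nonneg _)) (by positivity)
  · simp only [Function.comp_apply]
    rw [← ENNReal.ofReal_mul (by positivity)]
    refine ENNReal.ofReal_le_ofReal (le_of_eq ?_)
    rw [← Finset.expect_div, Finset.expect_comm, div_mul_eq_mul_div]
    congr 1
    rw [Finset.mul_expect]
    refine Finset.expect_congr rfl fun J _ => ?_
    rw [← Finset.expect_mul, ← Finset.mul_expect, Fintype.expect_eq_sum_div_card]
    simp
    field_simp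
    simp

theorem lintegral_sq_outputMean_le (hh : Measurable h) (hX : Measurable X)
    (hXlaw : P.map X = productLaw n F) (hn : ∀ p, 0 < n p) (hR : 0 < R)
    {Z : Fin R → Ω → Sample S c}
    (hcond : IsCondIID Z X (fun x => productLaw c (edf x)) P) :
    ∫⁻ ω, ENNReal.ofReal ((1 / (R : ℝ) * ∑ r, h (Z r ω)) ^ 2) ∂P ≤
        ∫⁻ x, ENNReal.ofReal (𝔼 J : Idx n c, h (pick x J) ^ 2) ∂productLaw n F := by
  have hφ : Measurable fun x : Sample S n => ENNReal.ofReal (𝔼 J : Idx n c, h (pick x J) ^ 2) := by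
    simp only [Fintype.expect_eq_sum_div_card]
    fun_prop
  have hne : Nonempty (Fin R) := ⟨⟨0, hR⟩⟩
  rw [← hXlaw, lintegral_map hφ hX]
  have hG : Measurable fun y : Sample S n × (Fin R → Sample S c) =>
      ENNReal.ofReal (𝔼 r, h (y.2 r) ^ 2) := by
    simp only [Fintype.expect_eq_sum_div_card]
    fun_prop
  calc ∫⁻ ω, ENNReal.ofReal ((1 / (R : ℝ) * ∑ r, h (Z r ω)) ^ 2) ∂P
      ≤ ∫⁻ ω, ENNReal.ofReal (𝔼 r, h (Z r ω) ^ 2) ∂P := by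
        refine lintegral_mono fun ω => ENNReal.ofReal_le_ofReal ?_
        have := sq_expect_le (fun _ : Fin R => (1 : ℝ)) fun r => h (Z r ω)
        simp only [one_mul, one_pow, Fintype.expect_const] at this
        refine le_trans (le_of_eq ?_) this
        rw [Fintype.expect_eq_sum_div_card, Fintype.card_fin, one_div, div_eq_inv_mul]
    _ ≤ _ := by
        refine (hcond.lintegral_eq hX hG).le.trans (lintegral_mono fun ω => ?_)
        have hw := edf_mem_simplex (n := n) hn
        have : IsProbabilityMeasure (productLaw c (edf (X ω))) :=
          isProbabilityMeasure_productLaw_weightedEdf (c := c) (X ω) hw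
        refine (lintegral_ofReal_expect_le (fun r z => sq_nonneg _) (fun r => by fun_prop)
          (b := fun _ => 𝔼 J : Idx n c, h (pick (X ω) J) ^ 2)
          (fun r => Finset.expect_nonneg fun J _ => sq_nonneg _) fun r => ?_).trans ?_
        · have hmp := measurePreserving_eval (fun _ : Fin R => productLaw c (edf (X ω))) r
          have h2 : Measurable fun z => ENNReal.ofReal (h z ^ 2) := by fun_prop
          refine (hmp.lintegral_comp h2).le.trans ?_
          unfold edf
          rw [← ofReal_integral_eq_lintegral_ofReal
            (integrable_weighted (hh.pow_const 2) (X ω) hw) (ae_of_all _ fun z => sq_nonneg _),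
            integral_weighted (hh.pow_const 2) (X ω) hw, wMean_uniform hn]
        · simp

/-- The mean square error of the influence function estimates, up to a constant that the
optimization over the weights does not see, in terms of the errors of the slot estimates. -/
theorem expect_sq_influenceEstimate_sub_le (F : ∀ p, Measure (S p)) (h : Sample S c → ℝ)
    (hn : ∀ p, 0 < n p) (hR : 0 < R) (x : Sample S n) (z : Fin R → Sample S c) (p : Fin m) :
    𝔼 j, (influenceEstimate h x z p j - inflSum F h p (x p j) +
        (c p : ℝ) * (1 / (R : ℝ) * ∑ r, h (z r) - meanPerf h F)) ^ 2 ≤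
      3 * (c p : ℝ) * ∑ t : Fin (c p), ((𝔼 j, (slotEstimate h x z ⟨p, t⟩ j - slotMean h x ⟨p, t⟩ j) ^ 2) +
        (𝔼 j, (slotMean h x ⟨p, t⟩ j - proj F h ⟨p, t⟩ (x p j)) ^ 2) +
        (1 / (R : ℝ) * ∑ r, h (z r)) ^ 2 * 𝔼 j, (slotEstimate (fun _ => 1) x z ⟨p, t⟩ j -
          slotMean (fun _ => 1) x ⟨p, t⟩ j) ^ 2) := by
  have hR' : (R : ℝ) ≠ 0 := by exact_mod_cast hR.ne'
  have hns : (n p : ℝ) ≠ 0 := by exact_mod_cast (hn p).ne'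
  have hne : ∀ s : Σ p, Fin (c p), Nonempty (Fin (n s.1)) := fun s => ⟨⟨0, hn s.1⟩⟩
  set hb := 1 / (R : ℝ) * ∑ r, h (z r) with hhb
  have hone : ∀ t j, slotMean (fun _ : Sample S c => 1) x ⟨p, t⟩ j = 1 := by
    intro t j
    simp only [slotMean, mul_one]
    rw [expect_slot_eq hn ⟨p, t⟩ fun i => (n p : ℝ) * if i = j then 1 else 0,
      Fintype.expect_eq_sum_div_card]
    simp [hns]
  have hdecomp : ∀ j, influenceEstimate h x z p j - inflSum F h p (x p j) +
      (c p : ℝ) * (hb - meanPerf h F) = ∑ t : Fin (c p),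
        ((slotEstimate h x z ⟨p, t⟩ j - slotMean h x ⟨p, t⟩ j) +
        (slotMean h x ⟨p, t⟩ j - proj F h ⟨p, t⟩ (x p j)) -
        hb * (slotEstimate (fun _ => 1) x z ⟨p, t⟩ j - slotMean (fun _ => 1) x ⟨p, t⟩ j)) := by
    intro j
    have e1 : influenceEstimate h x z p j = ∑ t : Fin (c p),
        (slotEstimate h x z ⟨p, t⟩ j - hb * slotEstimate (fun _ => 1) x z ⟨p, t⟩ j) := by
      have hc0 : ∑ r, (h (z r) - hb) = 0 := by
        rw [Finset.sum_sub_distrib, hhb]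
        simp
        field_simp
        simp
      simp only [influenceEstimate, slotEstimate, ← hhb]
      simp only [mul_sub, Finset.sum_sub_distrib, ← Finset.sum_mul, hc0, zero_mul, sub_zero,
        one_mul]
      rw [← Finset.mul_sum, ← Finset.mul_sum, ← Finset.mul_sum, mul_left_comm hb, ← mul_sub]
      congr 1
      rw [Finset.sum_comm, Finset.sum_comm (s := (Finset.univ : Finset (Fin (c p)))),
        Finset.mul_sum, ← Finset.sum_sub_distrib]
      refine Finset.sum_congr rfl fun r _ => ?_
      simp only [← Finset.mul_sum]
      ring
    rw [e1, inflSum]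
    simp only [hone, Finset.sum_sub_distrib, Finset.sum_add_distrib, mul_sub, mul_one]
    simp
    ring
  simp only [hdecomp]
  calc 𝔼 j, (∑ t : Fin (c p),
        ((slotEstimate h x z ⟨p, t⟩ j - slotMean h x ⟨p, t⟩ j) +
        (slotMean h x ⟨p, t⟩ j - proj F h ⟨p, t⟩ (x p j)) -
        hb * (slotEstimate (fun _ => 1) x z ⟨p, t⟩ j - slotMean (fun _ => 1) x ⟨p, t⟩ j))) ^ 2
      ≤ 𝔼 j, 3 * (c p : ℝ) * ∑ t : Fin (c p), ((slotEstimate h x z ⟨p, t⟩ j - slotMean h x ⟨p, t⟩ j) ^ 2 +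
        (slotMean h x ⟨p, t⟩ j - proj F h ⟨p, t⟩ (x p j)) ^ 2 +
        hb ^ 2 * (slotEstimate (fun _ => 1) x z ⟨p, t⟩ j -
          slotMean (fun _ => 1) x ⟨p, t⟩ j) ^ 2) := by
        refine Finset.expect_le_expect fun j _ => ?_
        refine (sq_sum_le_card_mul_sum_sq).trans ?_
        rw [Finset.card_univ, Fintype.card_fin, mul_comm (3 : ℝ), mul_assoc, Finset.mul_sum _ _ (3 : ℝ)]
        refine mul_le_mul_of_nonneg_left (Finset.sum_le_sum fun t _ => ?_) (by positivity)
        generalize slotEstimate h x z ⟨p, t⟩ j - slotMean h x ⟨p, t⟩ j = a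
        generalize slotMean h x ⟨p, t⟩ j - proj F h ⟨p, t⟩ (x p j) = b
        generalize slotEstimate (fun _ => 1) x z ⟨p, t⟩ j - slotMean (fun _ => 1) x ⟨p, t⟩ j = d
        nlinarith [sq_nonneg (a - b), sq_nonneg (a + hb * d), sq_nonneg (b + hb * d)]
    _ = _ := by
        simp only [← Finset.mul_expect, Finset.expect_sum_comm, Finset.expect_add_distrib]

end ConditionalSampling

/-! ### The central limit theorem -/

section CentralLimit

/-- Second-order expansion at `0` of the characteristic function of a centered distribution. -/
theorem charFun_sub_isLittleO {μ : Measure ℝ} [IsProbabilityMeasure μ] (hμ : MemLp id 2 μ)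
    (h0 : ∫ x, x ∂μ = 0) :
    (fun t => charFun μ t - (1 - ((∫ x, x ^ 2 ∂μ : ℝ) : ℂ) * (t : ℂ) ^ 2 / 2)) =o[𝓝 0]
      fun t : ℝ => t ^ 2 := by
  have h := taylor_isLittleO_univ (n := 2) (x₀ := (0 : ℝ)) (contDiff_charFun hμ)
  have e := fun t : ℝ => taylorWithinEval_charFun_two_zero (P := μ) (X := id) aemeasurable_id
    (by simpa using hμ) t
  simp only [Measure.map_id] at e
  simp only [e, sub_zero] at h
  refine h.congr_left fun t => ?_
  have h1 : ∫ x, id x ∂μ = 0 := h0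
  have h2 : ∫ x, (id ^ 2 : ℝ → ℝ) x ∂μ = ∫ x, x ^ 2 ∂μ := rfl
  rw [h1, h2]
  simp

theorem norm_pow_sub_pow_le {z w : ℂ} (hz : ‖z‖ ≤ 1) (hw : ‖w‖ ≤ 1) (n : ℕ) :
    ‖z ^ n - w ^ n‖ ≤ n * ‖z - w‖ := by
  induction n with
  | zero => simp
  | succ n ih =>
    have e : z ^ (n + 1) - w ^ (n + 1) = z ^ n * (z - w) + (z ^ n - w ^ n) * w := by ring
    rw [e]
    refine (norm_add_le _ _).trans ?_
    rw [norm_mul, norm_mul, norm_pow]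
    have h1 : ‖z‖ ^ n * ‖z - w‖ ≤ 1 * ‖z - w‖ :=
      mul_le_mul_of_nonneg_right (pow_le_one₀ (norm_nonneg _) hz) (norm_nonneg _)
    have h2 : ‖z ^ n - w ^ n‖ * ‖w‖ ≤ ‖z ^ n - w ^ n‖ * 1 :=
      mul_le_mul_of_nonneg_left hw (norm_nonneg _)
    push_cast
    linarith

/-- The characteristic function of a scaled sum of i.i.d. centered variables converges to the
Gaussian one, for any scaling `s` with `n s ^ 2` convergent. -/
theorem tendsto_charFun_pow {μ : Measure ℝ} [IsProbabilityMeasure μ] (hμ : MemLp id 2 μ)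
    (h0 : ∫ x, x ∂μ = 0) {n : ℕ → ℕ} {s : ℕ → ℝ} {γ : ℝ}
    (hs : Tendsto s atTop (𝓝 0)) (hns : Tendsto (fun ν => (n ν : ℝ) * s ν ^ 2) atTop (𝓝 γ)) :
    Tendsto (fun ν => charFun μ (s ν) ^ n ν) atTop
      (𝓝 (Complex.exp (-(γ * ∫ x, x ^ 2 ∂μ : ℝ) / 2))) := by
  set v := ∫ x, x ^ 2 ∂μ with hv
  have hv0 : 0 ≤ v := integral_nonneg fun x => sq_nonneg x
  -- the Gaussian distribution with the same variance has the same expansion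
  have hg2 : MemLp id 2 (gaussianReal 0 v.toNNReal) := memLp_id_gaussianReal 2
  have hgv : ∫ x, x ^ 2 ∂gaussianReal 0 v.toNNReal = v := by
    have h1 := variance_eq_integral (μ := gaussianReal 0 v.toNNReal) (X := id) aemeasurable_id
    rw [variance_id_gaussianReal] at h1
    simp only [id, integral_id_gaussianReal, sub_zero] at h1
    rw [← h1, Real.coe_toNNReal _ hv0]
  have hexp := (charFun_sub_isLittleO hμ h0).sub
    (charFun_sub_isLittleO hg2 integral_id_gaussianReal)
  rw [hgv, ← hv] at hexp
  simp only [sub_sub_sub_cancel_right] at hexp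
  have hdiff : Tendsto (fun ν => charFun μ (s ν) ^ n ν -
      charFun (gaussianReal 0 v.toNNReal) (s ν) ^ n ν) atTop (𝓝 0) := by
    have h2 : Tendsto (fun ν => (n ν : ℝ) * ‖charFun μ (s ν) -
        charFun (gaussianReal 0 v.toNNReal) (s ν)‖) atTop (𝓝 0) := by
      have h3 : (fun ν => (n ν : ℝ) * ‖charFun μ (s ν) -
          charFun (gaussianReal 0 v.toNNReal) (s ν)‖) =o[atTop]
          fun ν => (n ν : ℝ) * s ν ^ 2 := by
        refine (Asymptotics.isBigO_refl (fun ν => (n ν : ℝ)) atTop).mul_isLittleO ?_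
        exact (hexp.comp_tendsto hs).norm_left
      exact (Asymptotics.isLittleO_one_iff ℝ).1 (h3.trans_isBigO (hns.isBigO_one ℝ))
    exact squeeze_zero_norm (fun ν => norm_pow_sub_pow_le (norm_charFun_le_one _)
      (norm_charFun_le_one _) _) h2
  have hgauss : Tendsto (fun ν => charFun (gaussianReal 0 v.toNNReal) (s ν) ^ n ν) atTop
      (𝓝 (Complex.exp (-(γ * v : ℝ) / 2))) := by
    simp only [charFun_gaussianReal, ← Complex.exp_nat_mul]
    refine (Complex.continuous_exp.tendsto _).comp ?_
    have h4 : Tendsto (fun ν => ((-((n ν : ℝ) * s ν ^ 2 * v) / 2 : ℝ) : ℂ)) atTop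
        (𝓝 ((-(γ * v) / 2 : ℝ) : ℂ)) :=
      (Complex.continuous_ofReal.tendsto _).comp ((hns.mul_const v).neg.div_const 2)
    convert h4 using 2
    · simp [hv0]
      ring
    · push_cast
      rfl
  simpa using hdiff.add hgauss

variable {m : ℕ} {S : Fin m → Type*} [∀ p, MeasurableSpace (S p)]
  {F : ∀ p, Measure (S p)} [∀ p, IsProbabilityMeasure (F p)]

theorem integral_cexp_sum_productLaw {c : Fin m → ℕ} {g : ∀ p, S p → ℝ}
    (hg : ∀ p, Measurable (g p)) (s : Fin m → ℝ) :
    ∫ x, Complex.exp ((∑ p, s p * ∑ j, g p (x p j) : ℝ) * Complex.I) ∂productLaw c F =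
      ∏ p, charFun ((F p).map (g p)) (s p) ^ c p := by
  have e : ∀ x : Sample S c, Complex.exp ((∑ p, s p * ∑ j, g p (x p j) : ℝ) * Complex.I) =
      ∏ p, ∏ j, Complex.exp ((s p * g p (x p j) : ℝ) * Complex.I) := by
    intro x
    simp only [← Complex.exp_sum]
    congr 1
    push_cast
    simp only [Finset.mul_sum, Finset.sum_mul]
  simp only [e]
  unfold productLaw
  rw [integral_fintype_prod_eq_prod (μ := fun p => Measure.pi fun _ : Fin (c p) => F p)
    (f := fun p (y : Fin (c p) → S p) => ∏ j, Complex.exp ((s p * g p (y j) : ℝ) * Complex.I))]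
  refine Finset.prod_congr rfl fun p _ => ?_
  rw [integral_fintype_prod_eq_prod (μ := fun _ : Fin (c p) => F p)
    (f := fun _ y => Complex.exp ((s p * g p y : ℝ) * Complex.I))]
  rw [charFun_apply_real, integral_map (hg p).aemeasurable (by fun_prop)]
  simp

theorem integral_sq_sum {X ι : Type*} [MeasurableSpace X] {μ : Measure X} [Fintype ι]
    {f : X → ι → ℝ} (hf2 : ∀ l, MemLp (fun y => f y l) 2 μ) (t : ι → ℝ) :
    ∫ y, (∑ l, t l * f y l) ^ 2 ∂μ = ∑ l, ∑ l', t l * t l' * ∫ y, f y l * f y l' ∂μ := by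
  have hi : ∀ l l', Integrable (fun y => t l * t l' * (f y l * f y l')) μ :=
    fun l l' => ((hf2 l).integrable_mul (hf2 l')).const_mul _
  have e : ∀ y, (∑ l, t l * f y l) ^ 2 = ∑ l, ∑ l', t l * t l' * (f y l * f y l') := fun y => by
    simp only [sq, Finset.sum_mul_sum]
    exact Finset.sum_congr rfl fun l _ => Finset.sum_congr rfl fun l' _ => by ring
  simp only [e]
  rw [integral_finsetSum _ fun l _ => integrable_finsetSum _ fun l' _ => hi l l']
  refine Finset.sum_congr rfl fun l _ => ?_
  rw [integral_finsetSum _ fun l' _ => hi l l']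
  exact Finset.sum_congr rfl fun l' _ => integral_const_mul _ _

/-- **Central limit theorem** for the sum over the sources of the averages of independent samples:
the probability of an open orthant-like event is asymptotically at least the probability that a
standard Gaussian vector lies in a ball. -/
theorem tendsto_sourceAverages {ι : Type*} [Fintype ι] [DecidableEq ι] {f : ∀ p, S p → ι → ℝ}
    (hf : ∀ p, Measurable (f p)) (hf2 : ∀ p l, MemLp (fun y => f p y l) 2 (F p))
    (hf0 : ∀ p l, ∫ y, f p y l ∂F p = 0) {n : ℕ → Fin m → ℕ} {N : ℕ → ℝ} (hN : ∀ ν, 0 ≤ N ν)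
    (hn : ∀ p, Tendsto (fun ν => n ν p) atTop atTop) {γ : Fin m → ℝ}
    (hγ : ∀ p, Tendsto (fun ν => N ν / n ν p) atTop (𝓝 (γ p))) {C : Matrix ι ι ℝ}
    (hCdef : ∀ l l', C l l' = ∑ p, γ p * ∫ y, f p y l * f p y l' ∂F p) (hC : C.PosSemidef)
    {V : ∀ ν, Sample S (n ν) → EuclideanSpace ℝ ι} (hVm : ∀ ν, Measurable (V ν))
    (hV : ∀ ν x l, V ν x l = √(N ν) * ∑ p, 1 / (n ν p : ℝ) * ∑ j, f p (x p j) l)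
    {G : Set (EuclideanSpace ℝ ι)} (hG : IsOpen G) :
    multivariateGaussian 0 C G ≤ liminf (fun ν => productLaw (n ν) F (V ν ⁻¹' G)) atTop := by
  have hprob : ∀ ν, IsProbabilityMeasure ((productLaw (n ν) F).map (V ν)) := fun ν =>
    Measure.isProbabilityMeasure_map (hVm ν).aemeasurable
  let μs : ℕ → ProbabilityMeasure (EuclideanSpace ℝ ι) := fun ν => ⟨_, hprob ν⟩
  let μ₀ : ProbabilityMeasure (EuclideanSpace ℝ ι) := ⟨multivariateGaussian 0 C, inferInstance⟩
  have key : Tendsto μs atTop (𝓝 μ₀) := by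
    refine ProbabilityMeasure.tendsto_of_tendsto_charFun fun t => ?_
    let g : ∀ p, S p → ℝ := fun p y => ∑ l, t l * f p y l
    have hg : ∀ p, Measurable (g p) := fun p => by
      have := fun l => (measurable_pi_apply l).comp (hf p)
      exact Finset.measurable_sum _ fun l _ => (this l).const_mul _
    have hg2 : ∀ p, MemLp (g p) 2 (F p) := fun p =>
      memLp_finsetSum _ fun l _ => (hf2 p l).const_mul _
    have hg0 : ∀ p, ∫ y, g p y ∂F p = 0 := fun p => by
      simp only [g]
      rw [integral_finsetSum _ fun l _ => ((hf2 p l).integrable (by norm_num)).const_mul _]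
      simp [integral_const_mul, hf0]
    have hgsq : ∀ p, ∫ y, g p y ^ 2 ∂F p =
        ∑ l, ∑ l', t l * t l' * ∫ y, f p y l * f p y l' ∂F p := fun p => integral_sq_sum (hf2 p) t
    have hlim : charFun (multivariateGaussian 0 C) t =
        ∏ p, Complex.exp (-(γ p * ∫ y, g p y ^ 2 ∂F p : ℝ) / 2) := by
      rw [charFun_multivariateGaussian hC, ← Complex.exp_sum]
      congr 1
      have e : (t.ofLp ⬝ᵥ C.mulVec t.ofLp) = ∑ p, γ p * ∫ y, g p y ^ 2 ∂F p := by
        simp only [hgsq, dotProduct, Matrix.mulVec, hCdef, Finset.mul_sum, Finset.sum_mul]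
        rw [Finset.sum_comm]
        refine (Finset.sum_congr rfl fun l _ => Finset.sum_comm).trans ?_
        rw [Finset.sum_comm]
        refine Finset.sum_congr rfl fun p _ => ?_
        rw [Finset.sum_comm]
        exact Finset.sum_congr rfl fun l _ => Finset.sum_congr rfl fun l' _ => by ring
      rw [e]
      simp only [← Finset.sum_div, Finset.sum_neg_distrib]
      push_cast
      simp
      ring
    change Tendsto (fun ν => charFun ((productLaw (n ν) F).map (V ν)) t) atTop
      (𝓝 (charFun (multivariateGaussian 0 C) t))
    have hchar : ∀ ν, charFun ((productLaw (n ν) F).map (V ν)) t =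
        ∏ p, charFun ((F p).map (g p)) (√(N ν) / n ν p) ^ n ν p := by
      intro ν
      rw [charFun_apply, integral_map (hVm ν).aemeasurable (by fun_prop),
        ← integral_cexp_sum_productLaw hg]
      refine integral_congr_ae (ae_of_all _ fun x => ?_)
      have : inner ℝ (V ν x) t = ∑ p, √(N ν) / n ν p * ∑ j, g p (x p j) := by
        simp only [PiLp.inner_apply, hV, g]
        simp only [RCLike.inner_apply, conj_trivial, Finset.mul_sum]
        rw [Finset.sum_comm]
        refine Finset.sum_congr rfl fun p _ => ?_
        rw [Finset.sum_comm]
        exact Finset.sum_congr rfl fun j _ => Finset.sum_congr rfl fun l _ => by ring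
      simp only [this]
    rw [hlim]
    simp only [hchar]
    refine tendsto_finsetProd _ fun p _ => ?_
    have : IsProbabilityMeasure ((F p).map (g p)) :=
      Measure.isProbabilityMeasure_map (hg p).aemeasurable
    have h1 : MemLp id 2 ((F p).map (g p)) :=
      (memLp_map_measure_iff aestronglyMeasurable_id (hg p).aemeasurable).2 (hg2 p)
    have h2 : ∫ x, x ∂(F p).map (g p) = 0 := by
      rw [integral_map (hg p).aemeasurable (by fun_prop)]
      exact hg0 p
    have h3 : ∫ x, x ^ 2 ∂(F p).map (g p) = ∫ y, g p y ^ 2 ∂F p := by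
      rw [integral_map (hg p).aemeasurable (by fun_prop)]
    rw [← h3]
    have hcast : Tendsto (fun ν => (n ν p : ℝ)) atTop atTop :=
      tendsto_natCast_atTop_atTop.comp (hn p)
    have hsq : ∀ ν, (√(N ν) / n ν p) ^ 2 = N ν / n ν p * (n ν p : ℝ)⁻¹ := fun ν => by
      rw [div_pow, Real.sq_sqrt (hN ν)]
      ring
    refine tendsto_charFun_pow h1 h2 ?_ ?_
    · have h4 : Tendsto (fun ν => √((√(N ν) / n ν p) ^ 2)) atTop (𝓝 √0) := by
        refine (Real.continuous_sqrt.tendsto _).comp ?_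
        simp only [hsq]
        simpa using (hγ p).mul hcast.inv_tendsto_atTop
      simpa [Real.sqrt_sq (div_nonneg (Real.sqrt_nonneg _) (Nat.cast_nonneg _))] using h4
    · refine (hγ p).congr' ?_
      filter_upwards [hcast.eventually_gt_atTop 0] with ν hν
      rw [hsq]
      field_simp
  have h := ProbabilityMeasure.le_liminf_measure_open_of_tendsto key hG
  refine h.trans (le_of_eq ?_)
  congr 1
  funext ν
  exact Measure.map_apply (hVm ν) hG.measurableSet

end CentralLimit

/-! ### Chi-square quantiles and Gaussian balls -/

section ChiSquare

theorem isProbabilityMeasure_chiSqLaw (r : ℕ) : IsProbabilityMeasure (chiSqLaw r) :=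
  Measure.isProbabilityMeasure_map (Measurable.aemeasurable (by fun_prop))

theorem chiSqLaw_real_Iic_of_neg (r : ℕ) {x : ℝ} (hx : x < 0) :
    (chiSqLaw r).real (Set.Iic x) = 0 := by
  rw [measureReal_def, chiSqLaw, Measure.map_apply (by fun_prop) measurableSet_Iic]
  have : (fun z : Fin r → ℝ => ∑ i, z i ^ 2) ⁻¹' Set.Iic x = ∅ := by
    ext z
    simp only [Set.mem_preimage, Set.mem_Iic, Set.mem_empty_iff_false, iff_false, not_le]
    exact hx.trans_le (Finset.sum_nonneg fun i _ => sq_nonneg _)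
  simp [this]

theorem nonneg_of_le_chiSqLaw (r : ℕ) {u : ℝ} (hu : 0 < u) {x : ℝ}
    (hx : u ≤ (chiSqLaw r).real (Set.Iic x)) : 0 ≤ x := by
  by_contra! h
  rw [chiSqLaw_real_Iic_of_neg r h] at hx
  linarith

theorem chiSqQuantile_nonneg (r : ℕ) {u : ℝ} (hu : 0 < u) : 0 ≤ chiSqQuantile r u :=
  Real.sInf_nonneg fun _ hx => nonneg_of_le_chiSqLaw r hu hx

/-- The quantile is attained, by right continuity of the distribution function. -/
theorem le_chiSqLaw_Iic_quantile (r : ℕ) {u : ℝ} (hu : u ∈ Set.Ioo (0 : ℝ) 1) :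
    u ≤ (chiSqLaw r).real (Set.Iic (chiSqQuantile r u)) := by
  have := isProbabilityMeasure_chiSqLaw r
  have hne : {x : ℝ | u ≤ (chiSqLaw r).real (Set.Iic x)}.Nonempty := by
    have h := (tendsto_cdf_atTop (chiSqLaw r)).eventually (lt_mem_nhds hu.2)
    obtain ⟨x, hx⟩ := h.exists
    rw [cdf_eq_real] at hx
    exact ⟨x, hx.le⟩
  have hc := ((cdf (chiSqLaw r)).right_continuous (chiSqQuantile r u)).mono_left
    (nhdsWithin_mono _ Set.Ioi_subset_Ici_self)
  rw [cdf_eq_real] at hc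
  refine ge_of_tendsto hc ?_
  filter_upwards [self_mem_nhdsWithin] with x hx
  obtain ⟨y, hy, hyx⟩ := exists_lt_of_csInf_lt hne hx
  rw [cdf_eq_real]
  exact le_trans hy (measureReal_mono (Set.Iic_subset_Iic.2 hyx.le))

/-- The chi-square distributions with at least one degree of freedom have no atoms. -/
theorem chiSqLaw_singleton (r : ℕ) (x : ℝ) : chiSqLaw (r + 1) {x} = 0 := by
  rw [chiSqLaw, Measure.map_apply (by fun_prop) (measurableSet_singleton x)]
  have hmp := measurePreserving_piFinSuccAbove (fun _ : Fin (r + 1) => gaussianReal 0 1) 0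
  have hms : MeasurableSet {y : ℝ × (Fin r → ℝ) | y.1 ^ 2 + ∑ i, y.2 i ^ 2 = x} :=
    measurableSet_eq_fun (by fun_prop) (by fun_prop)
  have e : (fun z : Fin (r + 1) → ℝ => ∑ i, z i ^ 2) ⁻¹' {x} =
      (MeasurableEquiv.piFinSuccAbove (fun _ : Fin (r + 1) => ℝ) 0) ⁻¹'
        {y : ℝ × (Fin r → ℝ) | y.1 ^ 2 + ∑ i, y.2 i ^ 2 = x} := by
    ext z
    simp [Fin.sum_univ_succ, MeasurableEquiv.piFinSuccAbove, Fin.tail]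
  rw [e, hmp.measure_preimage hms.nullMeasurableSet, Measure.prod_apply_symm hms]
  refine (lintegral_congr fun y => ?_).trans lintegral_zero
  have hfin : {z : ℝ | z ^ 2 + ∑ i, y i ^ 2 = x} ⊆
      {√(x - ∑ i, y i ^ 2), -√(x - ∑ i, y i ^ 2)} := by
    intro z hz
    have hz' : x - ∑ i, y i ^ 2 = z ^ 2 := by
      rw [← show z ^ 2 + ∑ i, y i ^ 2 = x from hz]
      ring
    rw [hz', Real.sqrt_sq_eq_abs]
    rcases abs_choice z with h | h <;> simp [h]
  have := nullSingletonClass_gaussianReal (μ := 0) (v := 1) one_ne_zero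
  exact ((Set.toFinite _).subset hfin).measure_zero _

/-- A standard Gaussian vector lies in the open ball of radius `√Q` with probability at least the
level of the chi-square quantile `Q`. -/
theorem le_stdGaussian_ball {ι : Type*} [Fintype ι] {r : ℕ} (hr : Fintype.card ι = r + 1) {u : ℝ}
    (hu : u ∈ Set.Ioo (0 : ℝ) 1) :
    ENNReal.ofReal u ≤ stdGaussian (EuclideanSpace ℝ ι)
      (Metric.ball 0 √(chiSqQuantile (r + 1) u)) := by
  classical
  have := isProbabilityMeasure_chiSqLaw (r + 1)
  set Q := chiSqQuantile (r + 1) u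
  have hQ : 0 ≤ Q := chiSqQuantile_nonneg (r + 1) hu.1
  let e : ι ≃ Fin (r + 1) := Fintype.equivFinOfCardEq hr
  rw [← stdGaussian_map (LinearIsometryEquiv.piLpCongrLeft 2 ℝ ℝ e.symm), ← map_pi_eq_stdGaussian,
    Measure.map_apply (LinearIsometryEquiv.continuous _).measurable Metric.isOpen_ball.measurableSet,
    Measure.map_apply (by fun_prop) (Metric.isOpen_ball.measurableSet.preimage
      (LinearIsometryEquiv.continuous _).measurable)]
  have e2 : (WithLp.toLp 2 : (Fin (r + 1) → ℝ) → EuclideanSpace ℝ (Fin (r + 1))) ⁻¹'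
      ((LinearIsometryEquiv.piLpCongrLeft 2 ℝ ℝ e.symm) ⁻¹'
        (Metric.ball (0 : EuclideanSpace ℝ ι) √Q)) =
      (fun z : Fin (r + 1) → ℝ => ∑ i, z i ^ 2) ⁻¹' Set.Iio Q := by
    ext z
    simp only [Set.mem_preimage, mem_ball_zero_iff, LinearIsometryEquiv.norm_map, Set.mem_Iio]
    rw [Real.lt_sqrt (norm_nonneg _), EuclideanSpace.real_norm_sq_eq]
  have e3 : (Measure.pi fun _ : Fin (r + 1) => gaussianReal 0 1)
      ((fun z : Fin (r + 1) → ℝ => ∑ i, z i ^ 2) ⁻¹' Set.Iio Q) =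
      chiSqLaw (r + 1) (Set.Iic Q) := by
    rw [← Measure.map_apply (by fun_prop) measurableSet_Iio]
    change chiSqLaw (r + 1) (Set.Iio Q) = _
    rw [← Set.Iio_union_right]
    exact (measure_congr (union_ae_eq_left_of_ae_eq_empty
      (ae_eq_empty.2 (chiSqLaw_singleton r Q)))).symm
  rw [e2, e3]
  refine (ENNReal.ofReal_le_ofReal (le_chiSqLaw_Iic_quantile (r + 1) hu)).trans ?_
  rw [measureReal_def, ENNReal.ofReal_toReal (measure_ne_top _ _)]

theorem exists_lt_measure_ball {E : Type*} [NormedAddCommGroup E] [MeasurableSpace E] {μ : Measure E}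
    {q : ℝ} {u : ℝ≥0∞} (hu : u < μ (Metric.ball 0 q)) :
    ∃ κ, 0 < κ ∧ κ < q ∧ u < μ (Metric.ball 0 κ) := by
  have hq : 0 < q := by
    by_contra! h
    simp [Metric.ball_eq_empty.2 h] at hu
  have hU : Metric.ball (0 : E) q = ⋃ k : ℕ, Metric.ball 0 (q - q / (k + 2)) := by
    ext x
    simp only [mem_ball_zero_iff, Set.mem_iUnion]
    constructor
    · intro hx
      have h : Tendsto (fun k : ℕ => q - q / ((k : ℝ) + 2)) atTop (𝓝 (q - 0)) := by
        refine tendsto_const_nhds.sub (tendsto_const_nhds.div_atTop ?_)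
        exact tendsto_atTop_add_const_right _ _ tendsto_natCast_atTop_atTop
      rw [sub_zero] at h
      exact (h.eventually (lt_mem_nhds hx)).exists
    · rintro ⟨k, hk⟩
      have : 0 < q / ((k : ℝ) + 2) := by positivity
      linarith
  have hmono : Monotone fun k : ℕ => Metric.ball (0 : E) (q - q / (k + 2)) := by
    intro a b hab
    refine Metric.ball_subset_ball ?_
    have : q / ((b : ℝ) + 2) ≤ q / ((a : ℝ) + 2) := by gcongr
    linarith
  rw [hU, hmono.measure_iUnion] at hu
  obtain ⟨k, hk⟩ := lt_iSup_iff.1 hu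
  have h1 : 0 < q / ((k : ℝ) + 2) := by positivity
  have h2 : q / ((k : ℝ) + 2) < q := by
    rw [div_lt_iff₀ (by positivity)]
    nlinarith [Nat.cast_nonneg (α := ℝ) k]
  exact ⟨_, by linarith, by linarith, hk⟩

open scoped MatrixOrder in
open Matrix in
/-- Every coordinate of a Gaussian vector is at most its standard deviation times the norm of the
underlying standard Gaussian vector. -/
theorem stdGaussian_ball_le_multivariateGaussian {ι : Type*} [Fintype ι] [DecidableEq ι]
    {C : Matrix ι ι ℝ} (hC : C.PosSemidef) (hpos : ∀ l, 0 < C l l) (κ : ℝ) :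
    stdGaussian (EuclideanSpace ℝ ι) (Metric.ball 0 κ) ≤
      multivariateGaussian 0 C {x | ∀ l, -(κ * √(C l l)) < x l} := by
  have hms : MeasurableSet {x : EuclideanSpace ℝ ι | ∀ l, -(κ * √(C l l)) < x l} := by
    have : {x : EuclideanSpace ℝ ι | ∀ l, -(κ * √(C l l)) < x l} =
        ⋂ l, {x | -(κ * √(C l l)) < x l} := by
      ext; simp
    rw [this]
    exact MeasurableSet.iInter fun l => measurableSet_lt (by fun_prop) (by fun_prop)
  rw [multivariateGaussian, Measure.map_apply (by fun_prop) hms]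
  refine measure_mono fun x hx l => ?_
  rw [mem_ball_zero_iff] at hx
  have hsym : (CFC.sqrt C).IsHermitian := (CFC.sqrt_nonneg C).isSelfAdjoint
  have hsq : CFC.sqrt C * CFC.sqrt C = C := CFC.sqrt_mul_sqrt_self _ hC.nonneg
  have hrow : ∑ j, CFC.sqrt C l j ^ 2 = C l l := by
    conv_rhs => rw [← hsq, Matrix.mul_apply]
    refine Finset.sum_congr rfl fun j _ => ?_
    have := hsym.apply l j
    simp only [star_trivial] at this
    rw [sq, this]
  have hcs := Finset.sum_mul_sq_le_sq_mul_sq Finset.univ (fun j => CFC.sqrt C l j) fun j => x j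
  rw [hrow, ← EuclideanSpace.real_norm_sq_eq] at hcs
  have hval : (0 + toEuclideanCLM (𝕜 := ℝ) (CFC.sqrt C) x) l = ∑ j, CFC.sqrt C l j * x j := by
    simp [Matrix.mulVec, dotProduct]
  have habs : |∑ j, CFC.sqrt C l j * x j| ≤ √(C l l) * ‖x‖ := by
    rw [← Real.sqrt_sq_eq_abs, ← Real.sqrt_sq (norm_nonneg x), ← Real.sqrt_mul (hpos l).le]
    exact Real.sqrt_le_sqrt hcs
  change -(κ * √(C l l)) < (0 + toEuclideanCLM (𝕜 := ℝ) (CFC.sqrt C) x) l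
  rw [hval]
  have h1 := neg_abs_le (∑ j, CFC.sqrt C l j * x j)
  have h2 : √(C l l) * ‖x‖ < κ * √(C l l) := by
    rw [mul_comm]
    exact mul_lt_mul_of_pos_right hx (Real.sqrt_pos.2 (hpos l))
  linarith

end ChiSquare

/-! ### Convergence in probability along a sequence of spaces -/

section HighProbability

variable {Ω : ℕ → Type*} [∀ ν, MeasurableSpace (Ω ν)]

/-- The filter of the events whose probability tends to one along a sequence of probability spaces.
Convergence along it is convergence in probability. -/
def highProb (P : ∀ ν, Measure (Ω ν)) : Filter (Σ ν, Ω ν) where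
  sets := {A | Tendsto (fun ν => P ν {ω | (⟨ν, ω⟩ : Σ ν, Ω ν) ∉ A}) atTop (𝓝 0)}
  univ_sets := by simp
  sets_of_superset := fun {A B} hA hAB =>
    tendsto_of_tendsto_of_tendsto_of_le_of_le tendsto_const_nhds hA (fun _ => zero_le)
      fun ν => measure_mono fun ω hω h => hω (hAB h)
  inter_sets := fun {A B} hA hB => by
    have h := Tendsto.add hA hB
    rw [add_zero] at h
    refine tendsto_of_tendsto_of_tendsto_of_le_of_le tendsto_const_nhds h (fun _ => zero_le)
      fun ν => (measure_mono fun ω hω => ?_).trans (measure_union_le _ _)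
    simp only [Set.mem_inter_iff, not_and_or, Set.mem_ofPred_eq] at hω
    exact hω

variable {P : ∀ ν, Measure (Ω ν)}

theorem eventually_highProb {p : (Σ ν, Ω ν) → Prop} :
    (∀ᶠ x in highProb P, p x) ↔ Tendsto (fun ν => P ν {ω | ¬ p ⟨ν, ω⟩}) atTop (𝓝 0) :=
  Iff.rfl

theorem tendsto_fst_highProb : Tendsto Sigma.fst (highProb P) atTop := by
  intro A hA
  refine tendsto_const_nhds.congr' ?_
  filter_upwards [hA] with ν hν
  simp [hν]

theorem eventually_highProb_of_ae {p : (Σ ν, Ω ν) → Prop} (h : ∀ ν, ∀ᵐ ω ∂P ν, p ⟨ν, ω⟩) :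
    ∀ᶠ x in highProb P, p x := by
  rw [eventually_highProb]
  refine tendsto_const_nhds.congr fun ν => ?_
  exact (ae_iff.1 (h ν)).symm

/-- Markov's inequality: convergence in mean implies convergence in probability. -/
theorem tendsto_highProb_of_lintegral {U : ∀ ν, Ω ν → ℝ} (hU : ∀ ν, Measurable (U ν))
    (h0 : ∀ ν ω, 0 ≤ U ν ω) {b c : ℕ → ℝ} (hc : ∀ ν, 0 ≤ c ν)
    (hb : ∀ᶠ ν in atTop, ∫⁻ ω, ENNReal.ofReal (U ν ω) ∂P ν ≤ ENNReal.ofReal (b ν))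
    (hcb : Tendsto (fun ν => c ν * b ν) atTop (𝓝 0)) :
    Tendsto (fun x : Σ ν, Ω ν => c x.1 * U x.1 x.2) (highProb P) (𝓝 0) := by
  rw [Metric.tendsto_nhds]
  intro ε hε
  rw [eventually_highProb]
  have hlim : Tendsto (fun ν => ENNReal.ofReal (c ν * b ν) / ENNReal.ofReal ε) atTop (𝓝 0) := by
    have h1 := ENNReal.Tendsto.div_const (ENNReal.tendsto_ofReal hcb)
      (Or.inr (ENNReal.ofReal_pos.2 hε).ne')
    simpa using h1
  refine tendsto_of_tendsto_of_tendsto_of_le_of_le' tendsto_const_nhds hlim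
    (Eventually.of_forall fun _ => zero_le) ?_
  filter_upwards [hb] with ν hν
  have hset : {ω | ¬ dist (c ν * U ν ω) 0 < ε} ⊆
      {ω | ENNReal.ofReal ε ≤ ENNReal.ofReal (c ν * U ν ω)} := by
    intro ω hω
    simp only [Set.mem_ofPred_eq, dist_zero_right, Real.norm_eq_abs, not_lt,
      abs_of_nonneg (mul_nonneg (hc ν) (h0 ν ω))] at hω ⊢
    exact ENNReal.ofReal_le_ofReal hω
  refine (measure_mono hset).trans ?_
  refine (meas_ge_le_lintegral_div (((hU ν).const_mul _).ennreal_ofReal).aemeasurable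
    (ENNReal.ofReal_pos.2 hε).ne' ENNReal.ofReal_ne_top).trans ?_
  gcongr
  simp only [ENNReal.ofReal_mul (hc ν)]
  rw [lintegral_const_mul _ (hU ν).ennreal_ofReal]
  gcongr

/-- Chebyshev's inequality: convergence in mean square implies convergence in probability. -/
theorem tendsto_highProb_of_lintegral_sq {U : ∀ ν, Ω ν → ℝ} (hU : ∀ ν, Measurable (U ν))
    {b c : ℕ → ℝ}
    (hb : ∀ᶠ ν in atTop, ∫⁻ ω, ENNReal.ofReal (U ν ω ^ 2) ∂P ν ≤ ENNReal.ofReal (b ν))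
    (hcb : Tendsto (fun ν => c ν ^ 2 * b ν) atTop (𝓝 0)) :
    Tendsto (fun x : Σ ν, Ω ν => c x.1 * U x.1 x.2) (highProb P) (𝓝 0) := by
  have h := tendsto_highProb_of_lintegral (fun ν => (hU ν).pow_const 2) (fun ν ω => sq_nonneg _)
    (fun ν => sq_nonneg (c ν)) hb hcb
  have h2 := (Real.continuous_sqrt.tendsto 0).comp h
  rw [Real.sqrt_zero] at h2
  refine (tendsto_zero_iff_abs_tendsto_zero _).2 (h2.congr fun x => ?_)
  simp only [Function.comp_apply]
  rw [← mul_pow, Real.sqrt_sq_eq_abs]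

/-- The product of a sequence bounded in mean and of one that vanishes in probability vanishes in
probability. -/
theorem tendsto_highProb_mul_of_lintegral {U : ∀ ν, Ω ν → ℝ} (hU : ∀ ν, Measurable (U ν))
    (h0 : ∀ ν ω, 0 ≤ U ν ω) {b : ℝ}
    (hb : ∀ᶠ ν in atTop, ∫⁻ ω, ENNReal.ofReal (U ν ω) ∂P ν ≤ ENNReal.ofReal b)
    {V : (Σ ν, Ω ν) → ℝ} (hV : Tendsto V (highProb P) (𝓝 0)) :
    Tendsto (fun x : Σ ν, Ω ν => U x.1 x.2 * V x) (highProb P) (𝓝 0) := by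
  rw [Metric.tendsto_nhds]
  intro ε hε
  rw [eventually_highProb, ENNReal.tendsto_nhds_zero]
  intro η hη
  -- by Markov's inequality `U` is at most `K` except on an event of probability `η / 2`
  obtain ⟨K, hK0, hK⟩ : ∃ K : ℝ, 0 < K ∧ ENNReal.ofReal b / ENNReal.ofReal K ≤ η / 2 := by
    have h1 : Tendsto (fun K : ℕ => ENNReal.ofReal b / ENNReal.ofReal (K : ℝ)) atTop (𝓝 0) := by
      simp only [ENNReal.ofReal_natCast]
      exact ENNReal.Tendsto.const_div ENNReal.tendsto_nat_nhds_top (Or.inr ENNReal.ofReal_ne_top)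
        |>.trans (by simp)
    have h2 := (ENNReal.tendsto_nhds_zero.1 h1) (η / 2) (ENNReal.half_pos hη.ne')
    obtain ⟨K, hK, hK1⟩ := (h2.and (eventually_gt_atTop 0)).exists
    exact ⟨K, by exact_mod_cast hK1, hK⟩
  have hV' : ∀ᶠ x in highProb P, dist (V x) 0 < ε / K :=
    (Metric.tendsto_nhds.1 hV) _ (div_pos hε hK0)
  rw [eventually_highProb, ENNReal.tendsto_nhds_zero] at hV'
  filter_upwards [hb, hV' (η / 2) (ENNReal.half_pos hη.ne')] with ν hν hVν
  have hsub : {ω | ¬ dist (U ν ω * V ⟨ν, ω⟩) 0 < ε} ⊆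
      {ω | ENNReal.ofReal K ≤ ENNReal.ofReal (U ν ω)} ∪ {ω | ¬ dist (V ⟨ν, ω⟩) 0 < ε / K} := by
    intro ω hω
    by_contra hcon
    simp only [Set.mem_union, Set.mem_ofPred_eq, not_or, not_le, not_not, dist_zero_right,
      Real.norm_eq_abs, abs_mul, abs_of_nonneg (h0 ν ω)] at hcon hω
    have h1 : U ν ω < K := (ENNReal.ofReal_lt_ofReal_iff hK0).1 hcon.1
    refine hω ?_
    calc U ν ω * |V ⟨ν, ω⟩| ≤ K * |V ⟨ν, ω⟩| :=
          mul_le_mul_of_nonneg_right h1.le (abs_nonneg _)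
      _ < K * (ε / K) := mul_lt_mul_of_pos_left hcon.2 hK0
      _ = ε := by field_simp
  refine (measure_mono hsub).trans ((measure_union_le _ _).trans ?_)
  rw [← ENNReal.add_halves η]
  refine add_le_add (le_trans ?_ hK) hVν
  refine (meas_ge_le_lintegral_div (hU ν).ennreal_ofReal.aemeasurable
    (ENNReal.ofReal_pos.2 hK0).ne' ENNReal.ofReal_ne_top).trans ?_
  gcongr

end HighProbability

/-! ### The value of the optimal weights -/

section OptimalWeights

open scoped BigOperators

variable {m : ℕ} {n : Fin m → ℕ}

/-- A lower bound for the linear functional `a` at weights that are optimal for the perturbed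
functional `D`. The competitor tilts the uniform weights by a small multiple of `a`; constants
added to `D` on each source are immaterial. -/
theorem sum_mul_weights_ge {q : ℕ} {α : ℝ} (hn : ∀ p, 0 < n p)
    (hQ : 0 ≤ chiSqQuantile q (1 - α)) {D a w : ∀ p, Fin (n p) → ℝ}
    (hw : w ∈ ambiguitySet q α n)
    (hmax : IsMaxOn (fun w : ∀ p, Fin (n p) → ℝ => ∑ p, ∑ j, D p j * w p j)
      (ambiguitySet q α n) w) (e : Fin m → ℝ) {τ ε : ℝ} (hε : ε ≤ 1 / 2)
    (hτε : ∀ p j, |τ / n p * (a p j - 𝔼 j', a p j')| ≤ ε)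
    (hτQ : τ ^ 2 * (∑ p, 1 / (n p : ℝ) * 𝔼 j, (a p j - 𝔼 j', a p j') ^ 2) * (1 + 4 * ε) ≤
      chiSqQuantile q (1 - α)) :
    ∑ p, 𝔼 j, a p j + τ * (∑ p, 1 / (n p : ℝ) * 𝔼 j, (a p j - 𝔼 j', a p j') ^ 2) -
      ∑ p, 2 * √(chiSqQuantile q (1 - α) * (chiSqQuantile q (1 - α) + 2) / n p) *
        √(𝔼 j, (D p j - a p j + e p) ^ 2) ≤ ∑ p, ∑ j, a p j * w p j := by
  have hnr : ∀ p, (0 : ℝ) < n p := fun p => by exact_mod_cast hn p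
  have hexp : ∀ p (f : Fin (n p) → ℝ), ∑ j, f j = n p * 𝔼 j, f j := fun p f => by
    rw [Fintype.expect_eq_sum_div_card, Fintype.card_fin, mul_div_cancel₀ _ (hnr p).ne']
  set C := chiSqQuantile q (1 - α) * (chiSqQuantile q (1 - α) + 2) with hC
  have hC0 : 0 ≤ C := mul_nonneg hQ (by linarith)
  let δ : ∀ p, Fin (n p) → ℝ := fun p j => τ / n p * (a p j - 𝔼 j', a p j')
  have hδ0 : ∀ p, ∑ j, δ p j = 0 := fun p => by
    have hne : Nonempty (Fin (n p)) := ⟨⟨0, hn p⟩⟩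
    simp only [δ, ← Finset.mul_sum]
    rw [hexp, Finset.expect_sub_distrib]
    simp
  have hδsq : ∑ p, ∑ j, δ p j ^ 2 =
      τ ^ 2 * ∑ p, 1 / (n p : ℝ) * 𝔼 j, (a p j - 𝔼 j', a p j') ^ 2 := by
    rw [Finset.mul_sum]
    refine Finset.sum_congr rfl fun p _ => ?_
    simp only [δ, mul_pow, ← Finset.mul_sum]
    rw [hexp]
    have := (hnr p).ne'
    field_simp
  have hmem := mem_ambiguitySet (α := α) (q := q) hn hδ0 hε hτε (by rw [hδsq]; exact hτQ)
  set w₀ : ∀ p, Fin (n p) → ℝ := fun p j => (1 + δ p j) / n p with hw₀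
  have hopt : ∑ p, ∑ j, D p j * w₀ p j ≤ ∑ p, ∑ j, D p j * w p j := hmax hmem
  have hgain : ∑ p, ∑ j, a p j * w₀ p j = ∑ p, 𝔼 j, a p j +
      τ * (∑ p, 1 / (n p : ℝ) * 𝔼 j, (a p j - 𝔼 j', a p j') ^ 2) := by
    rw [Finset.mul_sum, ← Finset.sum_add_distrib]
    refine Finset.sum_congr rfl fun p _ => ?_
    have hne : Nonempty (Fin (n p)) := ⟨⟨0, hn p⟩⟩
    have h1 : ∀ j, a p j * w₀ p j = 1 / n p * a p j + τ / n p ^ 2 * (a p j - 𝔼 j', a p j') ^ 2 +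
        (𝔼 j', a p j') * (1 / n p * δ p j) := fun j => by
      simp only [hw₀, δ]
      have := (hnr p).ne'
      field_simp
      ring
    simp only [h1, Finset.sum_add_distrib, ← Finset.mul_sum, hδ0]
    rw [hexp, hexp p fun j => (a p j - 𝔼 j', a p j') ^ 2]
    have := (hnr p).ne'
    field_simp
    ring
  have hb1 := (ambiguitySet_bounds hn hQ hw).2
  have hb2 := (ambiguitySet_bounds hn hQ hmem).2
  -- the error of the estimated functional on the difference of the two weights
  have herr : ∀ p, |∑ j, (D p j - a p j) * (w p j - w₀ p j)| ≤
      2 * √(C / n p) * √(𝔼 j, (D p j - a p j + e p) ^ 2) := by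
    intro p
    have hs : ∑ j, (w p j - w₀ p j) = 0 := by
      rw [Finset.sum_sub_distrib, (hw.1 p).2, (hmem.1 p).2, sub_self]
    have h1 : ∑ j, (D p j - a p j) * (w p j - w₀ p j) =
        ∑ j, (D p j - a p j + e p) * (w p j - w₀ p j) := by
      simp only [add_mul _ (e p), Finset.sum_add_distrib, ← Finset.mul_sum, hs, mul_zero, add_zero]
    have h2 := Finset.sum_mul_sq_le_sq_mul_sq Finset.univ (fun j => D p j - a p j + e p)
      fun j => w p j - w₀ p j
    have h3 : ∑ j, (w p j - w₀ p j) ^ 2 ≤ 4 * C / n p ^ 2 := by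
      rw [le_div_iff₀ (by have := hnr p; positivity), Finset.sum_mul]
      calc ∑ j, (w p j - w₀ p j) ^ 2 * (n p : ℝ) ^ 2
          ≤ ∑ j, (2 * (n p * w p j - 1) ^ 2 + 2 * (n p * w₀ p j - 1) ^ 2) :=
            Finset.sum_le_sum fun j _ => by
              nlinarith [sq_nonneg ((n p * w p j - 1) + (n p * w₀ p j - 1))]
        _ ≤ 2 * C + 2 * C := by
            rw [Finset.sum_add_distrib, ← Finset.mul_sum, ← Finset.mul_sum]
            linarith [hb1 p, hb2 p]
        _ = 4 * C := by ring
    rw [h1]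
    refine abs_le_of_sq_le_sq ?_ (by positivity)
    have hE : 0 ≤ 𝔼 j, (D p j - a p j + e p) ^ 2 := Finset.expect_nonneg fun j _ => sq_nonneg _
    have hCn : 0 ≤ C / n p := div_nonneg hC0 (hnr p).le
    rw [mul_pow, mul_pow, Real.sq_sqrt hCn, Real.sq_sqrt hE]
    refine h2.trans ?_
    rw [hexp]
    calc n p * (𝔼 j, (D p j - a p j + e p) ^ 2) * ∑ j, (w p j - w₀ p j) ^ 2
        ≤ n p * (𝔼 j, (D p j - a p j + e p) ^ 2) * (4 * C / n p ^ 2) :=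
          mul_le_mul_of_nonneg_left h3 (mul_nonneg (hnr p).le hE)
      _ = 2 ^ 2 * (C / n p) * 𝔼 j, (D p j - a p j + e p) ^ 2 := by
          have := (hnr p).ne'
          field_simp
          ring
  have hsplit : ∑ p, ∑ j, a p j * w p j = ∑ p, ∑ j, a p j * w₀ p j +
      (∑ p, ∑ j, D p j * w p j - ∑ p, ∑ j, D p j * w₀ p j) -
      ∑ p, ∑ j, (D p j - a p j) * (w p j - w₀ p j) := by
    simp only [← Finset.sum_sub_distrib, ← Finset.sum_add_distrib]
    exact Finset.sum_congr rfl fun p _ => Finset.sum_congr rfl fun j _ => by ring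
  have hle : ∑ p, ∑ j, (D p j - a p j) * (w p j - w₀ p j) ≤
      ∑ p, 2 * √(C / n p) * √(𝔼 j, (D p j - a p j + e p) ^ 2) :=
    Finset.sum_le_sum fun p _ => (le_abs_self _).trans (herr p)
  rw [hsplit, hgain]
  linarith

end OptimalWeights

/-! ### Asymptotic negligibility of the errors -/

section Asymptotics

open scoped BigOperators

variable {m : ℕ} {S : Fin m → Type*} [∀ p, MeasurableSpace (S p)] {c : Fin m → ℕ}
  {F : ∀ p, Measure (S p)} [∀ p, IsProbabilityMeasure (F p)] {h : Sample S c → ℝ}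
  {Ω : ℕ → Type*} [∀ ν, MeasurableSpace (Ω ν)] {P : ∀ ν, Measure (Ω ν)}
  [∀ ν, IsProbabilityMeasure (P ν)] {n : ℕ → Fin m → ℕ} {N : ℕ → ℝ} {R : ℕ → ℕ}
  {X : ∀ ν, Ω ν → Sample S (n ν)}

theorem lintegral_comp_data {ν : ℕ} (hX : Measurable (X ν))
    (hXlaw : (P ν).map (X ν) = productLaw (n ν) F)
    {g : Sample S (n ν) → ℝ≥0∞} (hg : Measurable g) :
    ∫⁻ ω, g (X ν ω) ∂P ν = ∫⁻ x, g x ∂productLaw (n ν) F := by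
  rw [← hXlaw, lintegral_map hg hX]

theorem tendsto_div_of_tendsto_div
    (hR : Tendsto (fun ν => (R ν : ℝ) / N ν) atTop atTop) :
    Tendsto (fun ν => N ν / R ν) atTop (𝓝 0) := by
  refine hR.inv_tendsto_atTop.congr fun ν => ?_
  simp

/-- The second-stage simulation error vanishes at the scale of the statistical error. -/
theorem tendsto_simulation_error (hT : TieL2 F h) (hn : ∀ ν p, 0 < n ν p) (hN0 : ∀ ν, 0 ≤ N ν)
    (hR : Tendsto (fun ν => (R ν : ℝ) / N ν) atTop atTop)
    (hX : ∀ ν, Measurable (X ν)) (hXlaw : ∀ ν, (P ν).map (X ν) = productLaw (n ν) F)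
    {W : ∀ ν, Ω ν → ∀ p, Fin (n ν p) → ℝ} (hW : ∀ ν, Measurable (W ν))
    (hWs : ∀ ν, ∀ᵐ ω ∂P ν, ∀ p, W ν ω p ∈ stdSimplex ℝ (Fin (n ν p))) {C : ℝ} (hC : 0 ≤ C)
    (hWC : ∀ ν, ∀ᵐ ω ∂P ν, ∀ p j, n ν p * W ν ω p j ≤ C)
    {Z : ∀ ν, Fin (R ν) → Ω ν → Sample S c} (hZ : ∀ ν r, Measurable (Z ν r))
    (hcond : ∀ ν, IsCondIID (Z ν) (fun ω => (X ν ω, W ν ω))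
      (fun y => productLaw c (weightedEdf y.1 y.2)) (P ν)) :
    Tendsto (fun x : Σ ν, Ω ν => √(N x.1) * (1 / (R x.1 : ℝ) * ∑ r, h (Z x.1 r x.2) -
      wMean h (X x.1 x.2) (W x.1 x.2))) (highProb P) (𝓝 0) := by
  have hh := hT.1
  have hNR := tendsto_div_of_tendsto_div hR
  refine tendsto_highProb_of_lintegral_sq
    (U := fun ν ω => 1 / (R ν : ℝ) * ∑ r, h (Z ν r ω) - wMean h (X ν ω) (W ν ω))
    (c := fun ν => √(N ν)) (b := fun ν => C ^ Fintype.card (Σ p, Fin (c p)) / R ν * tieBound F h)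
    (fun ν => ?_) ?_ ?_
  · have h1 : Measurable fun ω => wMean h (X ν ω) (W ν ω) := measurable_wMean hh (hX ν) (hW ν)
    have h2 : Measurable fun ω => 1 / (R ν : ℝ) * ∑ r, h (Z ν r ω) :=
      (Finset.measurable_sum _ fun r _ => hh.comp (hZ ν r)).const_mul _
    exact h2.sub h1
  · filter_upwards [hR.eventually_gt_atTop 0] with ν hν
    have hRpos : 0 < R ν := by
      by_contra! h0
      simp [Nat.le_zero.1 h0] at hν
    rw [ENNReal.ofReal_mul (by positivity)]
    exact (lintegral_simulation_error_le hh (hX ν) (hXlaw ν) (hn ν) hRpos (hW ν) (hWs ν) hC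
      (hWC ν) (hcond ν)).trans (by gcongr; exact lintegral_expect_sq_le hT (n ν) (hn ν))
  · have h3 := hNR.mul_const (C ^ Fintype.card (Σ p, Fin (c p)) * tieBound F h)
    rw [zero_mul] at h3
    refine h3.congr fun ν => ?_
    rw [Real.sq_sqrt (hN0 ν)]
    ring

/-- The slot means converge in mean square over the data to the projections. -/
theorem tendsto_slotMean_error (hT : TieL2 F h) (hh4 : MemLp h 4 (productLaw c F))
    (s : Σ p, Fin (c p)) (hN : Tendsto N atTop atTop) {b : ℝ} (hb : 0 < b)
    (hbn : ∀ᶠ ν in atTop, ∀ p, b * N ν ≤ n ν p)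
    (hX : ∀ ν, Measurable (X ν)) (hXlaw : ∀ ν, (P ν).map (X ν) = productLaw (n ν) F) :
    Tendsto (fun x : Σ ν, Ω ν => 𝔼 j,
      (slotMean h (X x.1 x.2) s j - proj F h s (X x.1 x.2 s.1 j)) ^ 2) (highProb P) (𝓝 0) := by
  have hh := hT.1
  have hinv : Tendsto (fun ν => (N ν)⁻¹) atTop (𝓝 0) := hN.inv_tendsto_atTop
  have hNpos := hN.eventually_gt_atTop 0
  obtain ⟨K, hK, hS⟩ := exists_slotMean_bound hT hh4 s
  have hm : ∀ ν, Measurable fun x : Sample S (n ν) => 𝔼 j,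
      (slotMean h x s j - proj F h s (x s.1 j)) ^ 2 := fun ν => by
    have h1 := measurable_proj F hh s
    have h2 := fun j => measurable_slotMean (n := n ν) hh s j
    simp only [Fintype.expect_eq_sum_div_card]
    fun_prop
  have := tendsto_highProb_of_lintegral (P := P) (c := fun _ => 1) (b := fun ν => K / (b * N ν))
    (fun ν => (hm ν).comp (hX ν)) (fun ν ω => Finset.expect_nonneg fun j _ => sq_nonneg _)
    (fun _ => zero_le_one) ?_ ?_
  · simpa using this
  · filter_upwards [hbn, hNpos] with ν h1 h2
    simp only [Function.comp_apply]
    rw [lintegral_comp_data (hX ν) (hXlaw ν) (hm ν).ennreal_ofReal]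
    exact hS (n ν) (b * N ν) (by positivity) h1
  · have h3 := hinv.mul_const (K / b)
    rw [zero_mul] at h3
    refine h3.congr fun ν => ?_
    rw [one_mul, div_mul_eq_div_div]
    ring

/-- The mean performance at a reweighted empirical model is, up to a term negligible at the scale of
the statistical error, linear in the weights, uniformly over the ambiguity set. -/
theorem tendsto_linearization_error (hT : TieL2 F h) (hh4 : MemLp h 4 (productLaw c F))
    (s₁ : Σ p, Fin (c p)) (hn : ∀ ν p, 0 < n ν p)
    (hN : Tendsto N atTop atTop) (hN0 : ∀ ν, 0 ≤ N ν) {b : ℝ} (hb : 0 < b)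
    (hbn : ∀ᶠ ν in atTop, ∀ p, b * N ν ≤ n ν p)
    (hX : ∀ ν, Measurable (X ν)) (hXlaw : ∀ ν, (P ν).map (X ν) = productLaw (n ν) F)
    {W : ∀ ν, Ω ν → ∀ p, Fin (n ν p) → ℝ}
    (hWs : ∀ ν, ∀ᵐ ω ∂P ν, ∀ p, W ν ω p ∈ stdSimplex ℝ (Fin (n ν p))) {C : ℝ}
    (hWC : ∀ ν, ∀ᵐ ω ∂P ν, ∀ p, ∑ j, (n ν p * W ν ω p j - 1) ^ 2 ≤ C) :
    Tendsto (fun x : Σ ν, Ω ν => √(N x.1) * (wMean h (X x.1 x.2) (W x.1 x.2) - meanPerf h F -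
      ∑ p, ∑ j, inflSum F h p (X x.1 x.2 p j) * W x.1 x.2 p j)) (highProb P) (𝓝 0) := by
  have hh := hT.1
  obtain ⟨K₁, hK₁, hV⟩ := exists_vStat_bound hT hh4 s₁
  set M := Fintype.card (Σ p, Fin (c p)) with hM
  have hinv : Tendsto (fun ν => (N ν)⁻¹) atTop (𝓝 0) := hN.inv_tendsto_atTop
  have hNpos := hN.eventually_gt_atTop 0
  -- the remainder of the empirical mean
  have t1 : Tendsto (fun x : Σ ν, Ω ν => √(N x.1) * (𝔼 J : Idx (n x.1) c, h (pick (X x.1 x.2) J) -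
      meanPerf h F - ∑ p, 𝔼 j, inflSum F h p (X x.1 x.2 p j))) (highProb P) (𝓝 0) := by
    have hm : ∀ ν, Measurable fun x : Sample S (n ν) => 𝔼 J : Idx (n ν) c, h (pick x J) -
        meanPerf h F - ∑ p, 𝔼 j, inflSum F h p (x p j) := fun ν => by
      have := fun p => measurable_inflSum (F := F) hh p
      simp only [Fintype.expect_eq_sum_div_card]
      fun_prop
    refine tendsto_highProb_of_lintegral_sq (c := fun ν => √(N ν))
      (b := fun ν => K₁ / (b * N ν) ^ 2) (fun ν => (hm ν).comp (hX ν)) ?_ ?_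
    · filter_upwards [hbn, hNpos] with ν h1 h2
      simp only [Function.comp_apply]
      rw [lintegral_comp_data (hX ν) (hXlaw ν) ((hm ν).pow_const 2).ennreal_ofReal]
      exact hV (n ν) (b * N ν) (by positivity) h1
    · have h3 := hinv.mul_const (K₁ / b ^ 2)
      rw [zero_mul] at h3
      refine h3.congr' ?_
      filter_upwards [hNpos] with ν h2
      rw [Real.sq_sqrt (hN0 ν)]
      field_simp
  have t2 : ∀ s : Σ p, Fin (c p), Tendsto (fun x : Σ ν, Ω ν => 𝔼 j,
      (slotMean h (X x.1 x.2) s j - proj F h s (X x.1 x.2 s.1 j)) ^ 2) (highProb P) (𝓝 0) :=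
    fun s => tendsto_slotMean_error hT hh4 s hN hb hbn hX hXlaw
  -- the products of two or more deviations of the weights, of root mean square `O(1 / N)`
  have t3 : Tendsto (fun x : Σ ν, Ω ν => (N x.1)⁻¹ * 𝔼 J : Idx (n x.1) c,
      h (pick (X x.1 x.2) J) ^ 2) (highProb P) (𝓝 0) := by
    have hm : ∀ ν, Measurable fun x : Sample S (n ν) => 𝔼 J : Idx (n ν) c, h (pick x J) ^ 2 :=
      fun ν => by
        simp only [Fintype.expect_eq_sum_div_card]
        fun_prop
    refine tendsto_highProb_of_lintegral (c := fun ν => (N ν)⁻¹) (b := fun _ => tieBound F h)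
      (fun ν => (hm ν).comp (hX ν)) (fun ν ω => Finset.expect_nonneg fun j _ => sq_nonneg _)
      (fun ν => inv_nonneg.2 (hN0 ν)) ?_ ?_
    · refine Eventually.of_forall fun ν => ?_
      simp only [Function.comp_apply]
      rw [lintegral_comp_data (hX ν) (hXlaw ν) (hm ν).ennreal_ofReal]
      exact lintegral_expect_sq_le hT (n ν) (hn ν)
    · simpa using hinv.mul_const (tieBound F h)
  have hlim : Tendsto (fun x : Σ ν, Ω ν => |√(N x.1) * (𝔼 J : Idx (n x.1) c,
      h (pick (X x.1 x.2) J) - meanPerf h F - ∑ p, 𝔼 j, inflSum F h p (X x.1 x.2 p j))| +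
      ∑ s : (Σ p, Fin (c p)), √(C / b) * √(𝔼 j,
        (slotMean h (X x.1 x.2) s j - proj F h s (X x.1 x.2 s.1 j)) ^ 2) +
      M * (C / b) * √((N x.1)⁻¹ * 𝔼 J : Idx (n x.1) c, h (pick (X x.1 x.2) J) ^ 2))
      (highProb P) (𝓝 (|0| + ∑ s : (Σ p, Fin (c p)), √(C / b) * √0 + M * (C / b) * √0)) :=
    (t1.abs.add (tendsto_finsetSum _ fun s _ => ((t2 s).sqrt).const_mul _)).add
      (t3.sqrt.const_mul _)
  simp only [abs_zero, Real.sqrt_zero, mul_zero, Finset.sum_const_zero, add_zero] at hlim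
  refine squeeze_zero_norm' ?_ hlim
  have hsmall : ∀ᶠ ν in atTop, M * (C / (b * N ν)) ≤ 1 := by
    have h3 := hinv.mul_const (M * (C / b))
    rw [zero_mul] at h3
    filter_upwards [h3.eventually_le_const zero_lt_one] with ν hν
    refine le_trans (le_of_eq ?_) hν
    rw [div_mul_eq_div_div]
    ring
  filter_upwards [tendsto_fst_highProb.eventually (hbn.and (hNpos.and hsmall)),
    eventually_highProb_of_ae (P := P) (p := fun x => ∀ p, W x.1 x.2 p ∈
      stdSimplex ℝ (Fin (n x.1 p))) hWs, 
    eventually_highProb_of_ae (P := P) (p := fun x => ∀ p, ∑ j,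
      (n x.1 p * W x.1 x.2 p j - 1) ^ 2 ≤ C) hWC] with x h1 h2 h3
  obtain ⟨h1, h4, h5⟩ := h1
  have h6 := abs_wMean_sub_le (F := F) h (X x.1 x.2) h2 h3 (by positivity) h1 h5
  rw [Real.norm_eq_abs, abs_mul, abs_of_nonneg (Real.sqrt_nonneg _), abs_mul,
    abs_of_nonneg (Real.sqrt_nonneg (N x.1))]
  have hs := Real.sq_sqrt (hN0 x.1)
  have hs0 := Real.sqrt_pos.2 h4
  refine (mul_le_mul_of_nonneg_left h6 hs0.le).trans (le_of_eq ?_)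
  have e1 : √(N x.1) * √(C / (b * N x.1)) = √(C / b) := by
    rw [← Real.sqrt_mul (hN0 x.1)]
    congr 1
    field_simp
  have e2 : √(N x.1) * (M * (C / (b * N x.1))) = M * (C / b) * √((N x.1)⁻¹) := by
    rw [Real.sqrt_inv]
    field_simp
    rw [hs]
    ring
  rw [mul_add, mul_add, Finset.mul_sum, Real.sqrt_mul (inv_nonneg.2 (hN0 x.1)),
    ← mul_assoc (√(N x.1)) _ (√(𝔼 J : Idx (n x.1) c, h (pick (X x.1 x.2) J) ^ 2)), e2]
  simp only [← mul_assoc (√(N x.1)) (√(C / (b * N x.1))), e1]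
  ring

/-- The estimated influence functions converge in mean square over the data, up to an additive
constant on each source. -/
theorem tendsto_influenceEstimate_error [∀ p, MeasurableEq (S p)] [∀ p, NullSingletonClass (F p)]
    (hT : TieL2 F h) (hh4 : MemLp h 4 (productLaw c F)) (hn : ∀ ν p, 0 < n ν p)
    (hN : Tendsto N atTop atTop) {b : ℝ} (hb : 0 < b)
    (hbn : ∀ᶠ ν in atTop, ∀ p, b * N ν ≤ n ν p) {β : Fin m → ℝ}
    (hβ : ∀ p, Tendsto (fun ν => (n ν p : ℝ) / N ν) atTop (𝓝 (β p)))
    (hR : Tendsto (fun ν => (R ν : ℝ) / N ν) atTop atTop)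
    (hX : ∀ ν, Measurable (X ν)) (hXlaw : ∀ ν, (P ν).map (X ν) = productLaw (n ν) F)
    {Z : ∀ ν, Fin (R ν) → Ω ν → Sample S c} (hZ : ∀ ν r, Measurable (Z ν r))
    (hcond : ∀ ν, IsCondIID (Z ν) (X ν) (fun x => productLaw c (edf x)) (P ν)) (p : Fin m) :
    Tendsto (fun x : Σ ν, Ω ν => 𝔼 j,
      (influenceEstimate h (X x.1 x.2) (fun r => Z x.1 r x.2) p j -
        inflSum F h p (X x.1 x.2 p j) +
        (c p : ℝ) * (1 / (R x.1 : ℝ) * ∑ r, h (Z x.1 r x.2) - meanPerf h F)) ^ 2)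
      (highProb P) (𝓝 0) := by
  have hh := hT.1
  have hNpos := hN.eventually_gt_atTop 0
  have hRpos : ∀ᶠ ν in atTop, 0 < R ν := by
    filter_upwards [hR.eventually_gt_atTop 0] with ν hν
    by_contra! h0
    simp [Nat.le_zero.1 h0] at hν
  have hZm : ∀ ν, Measurable fun ω r => Z ν r ω := fun ν => measurable_pi_iff.2 (hZ ν)
  have hnR : Tendsto (fun ν => (n ν p : ℝ) / R ν) atTop (𝓝 0) := by
    refine ((hβ p).div_atTop hR).congr' ?_
    filter_upwards [hNpos] with ν hν
    rw [div_div_div_cancel_right₀ hν.ne']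
  -- the simulation errors of the slot estimates
  have t1 : ∀ (g : Sample S c → ℝ), TieL2 F g → ∀ t : Fin (c p),
      Tendsto (fun x : Σ ν, Ω ν => 𝔼 j, (slotEstimate g (X x.1 x.2) (fun r => Z x.1 r x.2) ⟨p, t⟩ j -
        slotMean g (X x.1 x.2) ⟨p, t⟩ j) ^ 2) (highProb P) (𝓝 0) := by
    intro g hg t
    have hm : ∀ ν, Measurable fun ω => 𝔼 j, (slotEstimate g (X ν ω) (fun r => Z ν r ω) ⟨p, t⟩ j -
        slotMean g (X ν ω) ⟨p, t⟩ j) ^ 2 := fun ν => by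
      have h1 := fun j => (measurable_slotEstimate (n := n ν) (R := R ν) hg.1 ⟨p, t⟩ j).comp
        ((hX ν).prodMk (hZm ν))
      have h2 := fun j => (measurable_slotMean (n := n ν) hg.1 ⟨p, t⟩ j).comp (hX ν)
      simp only [Fintype.expect_eq_sum_div_card]
      exact (Finset.measurable_sum _ fun j _ => ((h1 j).sub (h2 j)).pow_const 2).div_const _
    have := tendsto_highProb_of_lintegral (P := P) (c := fun _ => 1)
      (b := fun ν => (n ν p : ℝ) / R ν * tieBound F g) hm
      (fun ν ω => Finset.expect_nonneg fun j _ => sq_nonneg _) (fun _ => zero_le_one) ?_ ?_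
    · simpa using this
    · filter_upwards [hRpos] with ν hν
      rw [ENNReal.ofReal_mul (by positivity)]
      exact (lintegral_slotEstimate_error_le hg.1 (hX ν) (hXlaw ν) (hn ν) hν (hcond ν)
        ⟨p, t⟩).trans (by gcongr; exact lintegral_expect_sq_le hg (n ν) (hn ν))
    · simpa using hnR.mul_const (tieBound F g)
  have t2 : ∀ t : Fin (c p), Tendsto (fun x : Σ ν, Ω ν => 𝔼 j,
      (slotMean h (X x.1 x.2) ⟨p, t⟩ j - proj F h ⟨p, t⟩ (X x.1 x.2 p j)) ^ 2)
      (highProb P) (𝓝 0) := fun t => tendsto_slotMean_error hT hh4 ⟨p, t⟩ hN hb hbn hX hXlaw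
  have t3 : ∀ t : Fin (c p), Tendsto (fun x : Σ ν, Ω ν =>
      (1 / (R x.1 : ℝ) * ∑ r, h (Z x.1 r x.2)) ^ 2 *
        𝔼 j, (slotEstimate (fun _ => 1) (X x.1 x.2) (fun r => Z x.1 r x.2) ⟨p, t⟩ j -
          slotMean (fun _ => 1) (X x.1 x.2) ⟨p, t⟩ j) ^ 2) (highProb P) (𝓝 0) := by
    intro t
    refine tendsto_highProb_mul_of_lintegral
      (U := fun ν ω => (1 / (R ν : ℝ) * ∑ r, h (Z ν r ω)) ^ 2) (b := tieBound F h)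
      (fun ν => ((Finset.measurable_sum _ fun r _ => hh.comp (hZ ν r)).const_mul _).pow_const 2)
      (fun ν ω => sq_nonneg _) ?_ (t1 _ (tieL2_const 1) t)
    filter_upwards [hRpos] with ν hν
    exact (lintegral_sq_outputMean_le hh (hX ν) (hXlaw ν) (hn ν) hν (hcond ν)).trans
      (lintegral_expect_sq_le hT (n ν) (hn ν))
  have hlim := (tendsto_finsetSum Finset.univ fun t _ =>
    ((t1 h hT t).add (t2 t)).add (t3 t)).const_mul (3 * (c p : ℝ))
  simp only [add_zero, Finset.sum_const_zero, mul_zero] at hlim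
  refine squeeze_zero' (Eventually.of_forall fun x => Finset.expect_nonneg fun j _ => sq_nonneg _)
    ?_ hlim
  filter_upwards [tendsto_fst_highProb.eventually hRpos] with x hx
  exact expect_sq_influenceEstimate_sub_le F h (hn x.1) hx (X x.1 x.2) (fun r => Z x.1 r x.2) p

end Asymptotics

/-! ### Consistency of empirical variances -/

section LawOfLargeNumbers

open scoped BigOperators

variable {m : ℕ} {S : Fin m → Type*} [∀ p, MeasurableSpace (S p)]
  {F : ∀ p, Measure (S p)} [∀ p, IsProbabilityMeasure (F p)]
  {Ω : ℕ → Type*} [∀ ν, MeasurableSpace (Ω ν)] {P : ∀ ν, Measure (Ω ν)}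
  [∀ ν, IsProbabilityMeasure (P ν)] {n : ℕ → Fin m → ℕ} {N : ℕ → ℝ}
  {X : ∀ ν, Ω ν → Sample S (n ν)}

/-- The weak law of large numbers for the data of one source. -/
theorem tendsto_expect_data (hn : ∀ ν p, 0 < n ν p)
    (hX : ∀ ν, Measurable (X ν)) (hXlaw : ∀ ν, (P ν).map (X ν) = productLaw (n ν) F) (p : Fin m)
    (hnt : Tendsto (fun ν => (n ν p : ℝ)) atTop atTop)
    {f : S p → ℝ} (hf : Measurable f) (hf2 : MemLp f 2 (F p)) :
    Tendsto (fun x : Σ ν, Ω ν => 𝔼 j, f (X x.1 x.2 p j)) (highProb P) (𝓝 (∫ y, f y ∂F p)) := by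
  have hm : ∀ ν, Measurable fun x : Sample S (n ν) =>
      1 / (n ν p : ℝ) * ∑ j, f (x p j) - ∫ y, f y ∂F p := fun ν => by fun_prop
  have h := tendsto_highProb_of_lintegral_sq (P := P) (c := fun _ => 1)
    (b := fun ν => (∫ y, f y ^ 2 ∂F p) / n ν p) (fun ν => (hm ν).comp (hX ν)) ?_ ?_
  · rw [← tendsto_sub_nhds_zero_iff]
    refine h.congr fun x => ?_
    simp only [Function.comp_apply, one_mul]
    rw [Fintype.expect_eq_sum_div_card, Fintype.card_fin, one_div, div_eq_inv_mul]
  · refine Eventually.of_forall fun ν => ?_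
    simp only [Function.comp_apply]
    rw [lintegral_comp_data (hX ν) (hXlaw ν) ((hm ν).pow_const 2).ennreal_ofReal]
    have hmp := measurePreserving_eval
      (fun p => Measure.pi fun _ : Fin (n ν p) => F p) p
    have hm2 : Measurable fun y : Fin (n ν p) → S p =>
        ENNReal.ofReal ((1 / (n ν p : ℝ) * ∑ j, f (y j) - ∫ y, f y ∂F p) ^ 2) := by fun_prop
    exact (hmp.lintegral_comp hm2).le.trans (lintegral_sq_average_sub_le hf2 (hn ν p))
  · simpa using hnt.const_div_atTop (∫ y, f y ^ 2 ∂F p)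

/-- The empirical variances are consistent. -/
theorem tendsto_sum_expect_sq_sub (hn : ∀ ν p, 0 < n ν p)
    (hX : ∀ ν, Measurable (X ν)) (hXlaw : ∀ ν, (P ν).map (X ν) = productLaw (n ν) F)
    (hnt : ∀ p, Tendsto (fun ν => (n ν p : ℝ)) atTop atTop) {γ : Fin m → ℝ}
    (hγ : ∀ p, Tendsto (fun ν => N ν / n ν p) atTop (𝓝 (γ p)))
    {a : ∀ p, S p → ℝ} (ha : ∀ p, Measurable (a p)) (ha4 : ∀ p, MemLp (a p) 4 (F p))
    (ha0 : ∀ p, ∫ y, a p y ∂F p = 0) :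
    Tendsto (fun x : Σ ν, Ω ν => N x.1 * ∑ p, 1 / (n x.1 p : ℝ) *
      𝔼 j, (a p (X x.1 x.2 p j) - 𝔼 j', a p (X x.1 x.2 p j')) ^ 2) (highProb P)
      (𝓝 (∑ p, γ p * ∫ y, a p y ^ 2 ∂F p)) := by
  have hsq : ∀ p, MemLp (fun y => a p y ^ 2) 2 (F p) := fun p => by
    refine (memLp_two_iff_integrable_sq ((ha p).pow_const 2).aestronglyMeasurable).2 ?_
    have := (ha4 p).integrable_norm_pow (by norm_num)
    refine this.congr (ae_of_all _ fun y => ?_)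
    simp only [Real.norm_eq_abs]
    rw [← pow_mul]
    norm_num
    exact Even.pow_abs (by decide) _
  have h1 : ∀ p, Tendsto (fun x : Σ ν, Ω ν => N x.1 / n x.1 p *
      (𝔼 j, a p (X x.1 x.2 p j) ^ 2 - (𝔼 j, a p (X x.1 x.2 p j)) ^ 2)) (highProb P)
      (𝓝 (γ p * (∫ y, a p y ^ 2 ∂F p - (∫ y, a p y ∂F p) ^ 2))) := fun p =>
    ((hγ p).comp tendsto_fst_highProb).mul
      ((tendsto_expect_data hn hX hXlaw p (hnt p) ((ha p).pow_const 2) (hsq p)).sub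
        ((tendsto_expect_data hn hX hXlaw p (hnt p) (ha p)
          ((ha4 p).mono_exponent (by norm_num))).pow 2))
  have h2 := tendsto_finsetSum Finset.univ fun p _ => h1 p
  simp only [ha0, ne_eq, OfNat.ofNat_ne_zero, not_false_eq_true, zero_pow, sub_zero] at h2
  refine h2.congr fun x => ?_
  rw [Finset.mul_sum]
  refine Finset.sum_congr rfl fun p _ => ?_
  have hne : Nonempty (Fin (n x.1 p)) := ⟨⟨0, hn x.1 p⟩⟩
  have e : 𝔼 j, (a p (X x.1 x.2 p j) - 𝔼 j', a p (X x.1 x.2 p j')) ^ 2 =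
      𝔼 j, a p (X x.1 x.2 p j) ^ 2 - (𝔼 j, a p (X x.1 x.2 p j)) ^ 2 := by
    have e1 : ∀ j, (a p (X x.1 x.2 p j) - 𝔼 j', a p (X x.1 x.2 p j')) ^ 2 =
        a p (X x.1 x.2 p j) ^ 2 - (2 * 𝔼 j', a p (X x.1 x.2 p j')) * a p (X x.1 x.2 p j) +
        (𝔼 j', a p (X x.1 x.2 p j')) ^ 2 := fun j => by ring
    simp only [e1, Finset.expect_add_distrib, Finset.expect_sub_distrib, ← Finset.mul_expect,
      Fintype.expect_const]
    ring
  rw [e]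
  ring

/-- The tilts of the uniform weights in the direction `a` are uniformly small. -/
theorem eventually_tilt_le (hn : ∀ ν p, 0 < n ν p) (hN0 : ∀ ν, 0 ≤ N ν)
    (hX : ∀ ν, Measurable (X ν)) (hXlaw : ∀ ν, (P ν).map (X ν) = productLaw (n ν) F)
    (hnt : ∀ p, Tendsto (fun ν => (n ν p : ℝ)) atTop atTop) {γ : Fin m → ℝ}
    (hγ : ∀ p, Tendsto (fun ν => N ν / n ν p) atTop (𝓝 (γ p)))
    {a : ∀ p, S p → ℝ} (ha : ∀ p, Measurable (a p)) (ha4 : ∀ p, MemLp (a p) 4 (F p))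
    (t : ℝ) {ε : ℝ} (hε : 0 < ε) :
    ∀ᶠ x : Σ ν, Ω ν in highProb P, ∀ p j, |t * √(N x.1) / n x.1 p *
      (a p (X x.1 x.2 p j) - 𝔼 j', a p (X x.1 x.2 p j'))| ≤ ε := by
  refine eventually_all.2 fun p => ?_
  have hm : ∀ ν, Measurable fun x : Sample S (n ν) => 𝔼 j, a p (x p j) ^ 4 := fun ν => by
    simp only [Fintype.expect_eq_sum_div_card]
    have := ha p
    fun_prop
  have hint : Integrable (fun y => a p y ^ 4) (F p) := by
    refine ((ha4 p).integrable_norm_pow (by norm_num)).congr (ae_of_all _ fun y => ?_)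
    simp only [Real.norm_eq_abs]
    exact Even.pow_abs (by decide) _
  have hlim : Tendsto (fun x : Σ ν, Ω ν => 16 * t ^ 4 * (N x.1 ^ 2 / n x.1 p ^ 3) *
      𝔼 j, a p (X x.1 x.2 p j) ^ 4) (highProb P) (𝓝 0) := by
    refine tendsto_highProb_of_lintegral
      (c := fun ν => 16 * t ^ 4 * (N ν ^ 2 / n ν p ^ 3)) (b := fun _ => ∫ y, a p y ^ 4 ∂F p)
      (fun ν => (hm ν).comp (hX ν))
      (fun ν ω => Finset.expect_nonneg fun j _ => by positivity) (fun ν => by positivity) ?_ ?_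
    · refine Eventually.of_forall fun ν => ?_
      have hne : Nonempty (Fin (n ν p)) := ⟨⟨0, hn ν p⟩⟩
      simp only [Function.comp_apply]
      rw [lintegral_comp_data (hX ν) (hXlaw ν) (hm ν).ennreal_ofReal]
      refine (lintegral_ofReal_expect_le (g := fun j (x : Sample S (n ν)) => a p (x p j) ^ 4)
        (b := fun _ => ∫ y, a p y ^ 4 ∂F p) (fun j x => by positivity)
        (fun j => by have := ha p; fun_prop) (fun j => integral_nonneg fun y => by positivity)
        fun j => ?_).trans (by simp)
      have hm4 : Measurable fun y => ENNReal.ofReal (a p y ^ 4) := by have := ha p; fun_prop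
      refine ((measurePreserving_eval_eval (n ν) F p j).lintegral_comp hm4).le.trans ?_
      rw [ofReal_integral_eq_lintegral_ofReal hint (ae_of_all _ fun y => by positivity)]
    · have h1 := (((hγ p).pow 2).mul (hnt p).inv_tendsto_atTop).const_mul (16 * t ^ 4)
      have h2 := h1.mul_const (∫ y, a p y ^ 4 ∂F p)
      simp only [mul_zero, zero_mul] at h2
      refine h2.congr fun ν => ?_
      simp only [Pi.inv_apply]
      have : (n ν p : ℝ) ≠ 0 := by exact_mod_cast (hn ν p).ne'
      field_simp
  filter_upwards [hlim.eventually_lt_const (pow_pos hε 4)] with x hx j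
  have hne : Nonempty (Fin (n x.1 p)) := ⟨⟨0, hn x.1 p⟩⟩
  have hnr : (0 : ℝ) < n x.1 p := by exact_mod_cast hn x.1 p
  set y : Fin (n x.1 p) → ℝ := fun j => a p (X x.1 x.2 p j)
  change 16 * t ^ 4 * (N x.1 ^ 2 / n x.1 p ^ 3) * 𝔼 j, y j ^ 4 < ε ^ 4 at hx
  change |t * √(N x.1) / n x.1 p * (y j - 𝔼 j', y j')| ≤ ε
  have jensen : ∀ f : Fin (n x.1 p) → ℝ, (𝔼 j, f j) ^ 2 ≤ 𝔼 j, f j ^ 2 := fun f => by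
    have := sq_expect_le (fun _ => (1 : ℝ)) f
    simpa using this
  have h1 : (𝔼 j', y j') ^ 4 ≤ 𝔼 j, y j ^ 4 := by
    calc (𝔼 j', y j') ^ 4 = ((𝔼 j', y j') ^ 2) ^ 2 := by ring
      _ ≤ (𝔼 j, y j ^ 2) ^ 2 := pow_le_pow_left₀ (sq_nonneg _) (jensen y) 2
      _ ≤ 𝔼 j, (y j ^ 2) ^ 2 := jensen _
      _ = _ := by simp only [← pow_mul]
  have h2 : y j ^ 4 ≤ n x.1 p * 𝔼 j, y j ^ 4 := by
    have e : (n x.1 p : ℝ) * 𝔼 j, y j ^ 4 = ∑ j, y j ^ 4 := by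
      rw [Fintype.expect_eq_sum_div_card, Fintype.card_fin, mul_div_cancel₀ _ hnr.ne']
    rw [e]
    exact Finset.single_le_sum (f := fun j => y j ^ 4) (fun j _ => by positivity)
      (Finset.mem_univ j)
  have hE : 0 ≤ 𝔼 j, y j ^ 4 := Finset.expect_nonneg fun j _ => by positivity
  have h3 : (y j - 𝔼 j', y j') ^ 4 ≤ 16 * (n x.1 p * 𝔼 j, y j ^ 4) := by
    have h4 : (1 : ℝ) ≤ n x.1 p := by exact_mod_cast hn x.1 p
    have h5 : (y j - 𝔼 j', y j') ^ 4 ≤ 8 * (y j ^ 4 + (𝔼 j', y j') ^ 4) := by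
      have e1 : (y j - 𝔼 j', y j') ^ 2 ≤ 2 * (y j ^ 2 + (𝔼 j', y j') ^ 2) := by
        nlinarith [sq_nonneg (y j + 𝔼 j', y j')]
      have e2 := pow_le_pow_left₀ (sq_nonneg _) e1 2
      nlinarith [sq_nonneg (y j ^ 2 - (𝔼 j', y j') ^ 2)]
    nlinarith
  refine le_of_lt (lt_of_pow_lt_pow_left₀ 4 hε.le (lt_of_le_of_lt ?_ hx))
  rw [Even.pow_abs (by decide), mul_pow, div_pow, mul_pow]
  have hs : √(N x.1) ^ 4 = N x.1 ^ 2 := by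
    rw [show (4 : ℕ) = 2 * 2 from rfl, pow_mul, Real.sq_sqrt (hN0 x.1)]
  rw [hs]
  calc t ^ 4 * N x.1 ^ 2 / n x.1 p ^ 4 * (y j - 𝔼 j', y j') ^ 4
      ≤ t ^ 4 * N x.1 ^ 2 / n x.1 p ^ 4 * (16 * (n x.1 p * 𝔼 j, y j ^ 4)) :=
        mul_le_mul_of_nonneg_left h3 (by positivity)
    _ = _ := by field_simp

end LawOfLargeNumbers

/-! ### Coverage for one pair of solutions -/

section Coverage

open scoped BigOperators

variable {k m : ℕ} {S : Fin m → Type*} [∀ p, MeasurableSpace (S p)] [∀ p, MeasurableEq (S p)]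
  {T : Fin k → Fin m → ℕ} {h : ∀ i, Sample S (T i) → ℝ}
  {F : ∀ p, Measure (S p)} [∀ p, IsProbabilityMeasure (F p)] [∀ p, NullSingletonClass (F p)]
  {Ω : ℕ → Type*} [∀ ν, MeasurableSpace (Ω ν)] {P : ∀ ν, Measure (Ω ν)}
  [∀ ν, IsProbabilityMeasure (P ν)] {n : ℕ → Fin m → ℕ} {N : ℕ → ℝ} {R₁ R₂ : ℕ → ℕ} {α : ℝ}

/-- On events of probability tending to one, the bound for the pair `(i, l)` covers the difference of
the mean performances as soon as the linear statistic of the data is not too far below zero, the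
margin being the square root of the chi-square quantile times its standard deviation. -/
theorem eventually_le_Uhat (hT : ∀ i, TieL2 F (h i))
    (hh4 : ∀ i, MemLp (h i) 4 (productLaw (T i) F)) (hTpos : ∀ i p, 0 < T i p) (hm : 0 < m)
    (hn : ∀ ν p, 0 < n ν p) (hN : Tendsto N atTop atTop) (hN0 : ∀ ν, 0 ≤ N ν)
    {β : Fin m → ℝ} (hβ0 : ∀ p, 0 < β p)
    (hβ : ∀ p, Tendsto (fun ν => (n ν p : ℝ) / N ν) atTop (𝓝 (β p)))
    (hR₁ : Tendsto (fun ν => (R₁ ν : ℝ) / N ν) atTop atTop)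
    (hR₂ : Tendsto (fun ν => (R₂ ν : ℝ) / N ν) atTop atTop)
    (hQ : 0 ≤ chiSqQuantile (k - 1) (1 - α))
    (run : ∀ ν, Run h F α (n ν) (R₁ ν) (R₂ ν) (P ν)) {i l : Fin k} (hil : i ≠ l) {v : ℝ}
    (hv : v = ∑ p, (β p)⁻¹ * ∫ y, (inflSum F (h i) p y - inflSum F (h l) p y) ^ 2 ∂F p)
    (hv0 : 0 < v) {κ' : ℝ} (hκ0 : 0 ≤ κ') (hκ' : κ' < √(chiSqQuantile (k - 1) (1 - α))) :
    ∀ᶠ x : Σ ν, Ω ν in highProb P,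
      -(κ' * √v) < √(N x.1) * ∑ p, 1 / (n x.1 p : ℝ) * ∑ j,
        (inflSum F (h i) p ((run x.1).X x.2 p j) - inflSum F (h l) p ((run x.1).X x.2 p j)) →
      meanPerf (h i) F - meanPerf (h l) F ≤ (run x.1).Uhat i l x.2 := by
  set Q := chiSqQuantile (k - 1) (1 - α) with hQdef
  set a : ∀ p, S p → ℝ := fun p y => inflSum F (h i) p y - inflSum F (h l) p y with ha
  have ham : ∀ p, Measurable (a p) := fun p =>
    (measurable_inflSum (hT i).1 p).sub (measurable_inflSum (hT l).1 p)
  have ha4 : ∀ p, MemLp (a p) 4 (F p) := fun p =>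
    (memLp_four_inflSum (hT i).1 (hh4 i) p).sub (memLp_four_inflSum (hT l).1 (hh4 l) p)
  have ha0 : ∀ p, ∫ y, a p y ∂F p = 0 := fun p => by
    simp only [ha]
    rw [integral_sub ((memLp_four_inflSum (hT i).1 (hh4 i) p).integrable (by norm_num))
      ((memLp_four_inflSum (hT l).1 (hh4 l) p).integrable (by norm_num)),
      integral_inflSum (hT i).1 (hh4 i), integral_inflSum (hT l).1 (hh4 l), sub_zero]
  have hNpos := hN.eventually_gt_atTop 0
  have hX := fun ν => (run ν).measurable_X
  have hXlaw := fun ν => (run ν).map_X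
  have hγ : ∀ p, Tendsto (fun ν => N ν / n ν p) atTop (𝓝 (β p)⁻¹) := fun p => by
    refine ((hβ p).inv₀ (hβ0 p).ne').congr fun ν => ?_
    rw [inv_div]
  have hnt : ∀ p, Tendsto (fun ν => (n ν p : ℝ)) atTop atTop := fun p => by
    refine ((hβ p).pos_mul_atTop (hβ0 p) hN).congr' ?_
    filter_upwards [hNpos] with ν hν
    field_simp
  obtain ⟨b, hb, hbn⟩ : ∃ b : ℝ, 0 < b ∧ ∀ᶠ ν in atTop, ∀ p, b * N ν ≤ n ν p := by
    have hne : Nonempty (Fin m) := ⟨⟨0, hm⟩⟩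
    obtain ⟨p₀, hp₀⟩ := Finite.exists_min β
    refine ⟨β p₀ / 2, half_pos (hβ0 p₀), eventually_all.2 fun p => ?_⟩
    have h1 : β p₀ / 2 < β p := (half_lt_self (hβ0 p₀)).trans_le (hp₀ p)
    filter_upwards [(hβ p).eventually_const_lt h1, hNpos] with ν h2 h3
    exact ((lt_div_iff₀ h3).1 h2).le
  -- the competitor uses a multiplier `κ` between `κ'` and `√Q`
  obtain ⟨κ, hκ1, hκ2⟩ := exists_between hκ'
  have hκpos : 0 < κ := hκ0.trans_lt hκ1
  have hκQ : κ ^ 2 < Q := (Real.lt_sqrt hκpos.le).1 hκ2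
  obtain ⟨ε, hε0, hε1, hε2⟩ : ∃ ε : ℝ, 0 < ε ∧ ε ≤ 1 / 2 ∧ κ ^ 2 * (1 + ε) * (1 + 4 * ε) < Q := by
    have h1 : Tendsto (fun ε : ℝ => κ ^ 2 * (1 + ε) * (1 + 4 * ε)) (𝓝[>] 0)
        (𝓝 (κ ^ 2 * (1 + 0) * (1 + 4 * 0))) :=
      (Continuous.tendsto (by fun_prop) 0).mono_left nhdsWithin_le_nhds
    have h2 := h1.eventually_lt_const (by simpa using hκQ)
    have h3 : ∀ᶠ ε : ℝ in 𝓝[>] 0, ε ≤ 1 / 2 :=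
      nhdsWithin_le_nhds ((eventually_lt_nhds (by norm_num)).mono fun _ h => le_of_lt h)
    obtain ⟨ε, h4, h5, h6⟩ := (h2.and (h3.and self_mem_nhdsWithin)).exists
    exact ⟨ε, h6, h5, h4⟩
  set σ := √v with hσ
  have hσ0 : 0 < σ := Real.sqrt_pos.2 hv0
  have hσsq : σ ^ 2 = v := Real.sq_sqrt hv0.le
  set t := κ / σ with ht
  set C := Q * (Q + 2) with hC
  have hC0 : 0 ≤ C := mul_nonneg hQ (by linarith)
  let W := fun ν => (run ν).W i l
  have hWm : ∀ ν, Measurable (W ν) := fun ν => (run ν).measurable_W i l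
  have hWU : ∀ ν, ∀ᵐ ω ∂P ν, W ν ω ∈ ambiguitySet (k - 1) α (n ν) := fun ν =>
    ((run ν).isMax_W i l hil).mono fun ω hω => hω.1
  have hWs : ∀ ν, ∀ᵐ ω ∂P ν, ∀ p, W ν ω p ∈ stdSimplex ℝ (Fin (n ν p)) := fun ν =>
    (hWU ν).mono fun ω hω => hω.1
  have hWb : ∀ ν, ∀ᵐ ω ∂P ν, ∀ p j, n ν p * W ν ω p j ≤ Q + 2 := fun ν =>
    (hWU ν).mono fun ω hω => (ambiguitySet_bounds (hn ν) hQ hω).1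
  have hWC : ∀ ν, ∀ᵐ ω ∂P ν, ∀ p, ∑ j, (n ν p * W ν ω p j - 1) ^ 2 ≤ C := fun ν =>
    (hWU ν).mono fun ω hω => (ambiguitySet_bounds (hn ν) hQ hω).2
  have hslot : ∀ u, Σ p, Fin (T u p) := fun u => ⟨⟨0, hm⟩, ⟨0, hTpos u _⟩⟩
  have hQ2 : 0 ≤ Q + 2 := by linarith
  have tL := tendsto_simulation_error (hT i) hn hN0 hR₂ hX hXlaw hWm hWs hQ2 hWb
    (fun ν r => (run ν).measurable_ZL i l r) fun ν => (run ν).cond_ZL i l hil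
  have tR := tendsto_simulation_error (hT l) hn hN0 hR₂ hX hXlaw hWm hWs hQ2 hWb
    (fun ν r => (run ν).measurable_ZR i l r) fun ν => (run ν).cond_ZR i l hil
  have lL := tendsto_linearization_error (hT i) (hh4 i) (hslot i) hn hN hN0 hb hbn hX hXlaw hWs hWC
  have lR := tendsto_linearization_error (hT l) (hh4 l) (hslot l) hn hN hN0 hb hbn hX hXlaw hWs hWC
  let b' : ∀ u : Fin k, ∀ x : Σ ν, Ω ν, ∀ p, Fin (n x.1 p) → ℝ := fun u x p j =>
    influenceEstimate (h u) ((run x.1).X x.2) (fun r => (run x.1).Z u r x.2) p j -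
      inflSum F (h u) p ((run x.1).X x.2 p j) +
      (T u p : ℝ) * (1 / (R₁ x.1 : ℝ) * ∑ r, h u ((run x.1).Z u r x.2) - meanPerf (h u) F)
  have tI : ∀ u p, Tendsto (fun x : Σ ν, Ω ν => 𝔼 j, b' u x p j ^ 2) (highProb P) (𝓝 0) :=
    fun u p => tendsto_influenceEstimate_error (hT u) (hh4 u) hn hN hb hbn hβ hR₁ hX hXlaw
      (fun ν r => (run ν).measurable_Z u r) (fun ν => (run ν).cond_Z u) p
  have tD : ∀ p, Tendsto (fun x : Σ ν, Ω ν => 𝔼 j, (b' i x p j - b' l x p j) ^ 2) (highProb P)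
      (𝓝 0) := fun p => by
    have h1 := ((tI i p).add (tI l p)).const_mul 2
    rw [add_zero, mul_zero] at h1
    refine squeeze_zero (fun x => Finset.expect_nonneg fun j _ => sq_nonneg _) (fun x => ?_) h1
    rw [← Finset.expect_add_distrib, Finset.mul_expect]
    exact Finset.expect_le_expect fun j _ => by nlinarith [sq_nonneg (b' i x p j + b' l x p j)]
  have tA := tendsto_sum_expect_sq_sub (N := N) hn hX hXlaw hnt hγ ham ha4 ha0
  rw [← hv] at tA
  have tTilt := eventually_tilt_le (N := N) hn hN0 hX hXlaw hnt hγ ham ha4 t hε0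
  have hA : ∀ᶠ x : Σ ν, Ω ν in highProb P, N x.1 * ∑ p, 1 / (n x.1 p : ℝ) *
      𝔼 j, (a p ((run x.1).X x.2 p j) - 𝔼 j', a p ((run x.1).X x.2 p j')) ^ 2 < v * (1 + ε) :=
    tA.eventually_lt_const (by nlinarith)
  -- all error terms together, and the gain of the competitor
  have tAll := (((tL.sub tR).add (lL.sub lR)).add (tA.const_mul t)).sub
    (tendsto_finsetSum Finset.univ fun p _ =>
      ((((hγ p).const_mul C).sqrt.const_mul 2).comp (tendsto_fst_highProb (P := P))).mul
        (tD p).sqrt)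
  simp only [sub_zero, add_zero, zero_add, Real.sqrt_zero, mul_zero, Finset.sum_const_zero] at tAll
  have hgain : κ' * σ < t * v := by
    rw [ht, ← hσsq]
    have : κ / σ * σ ^ 2 = κ * σ := by field_simp
    rw [this]
    exact mul_lt_mul_of_pos_right hκ1 hσ0
  filter_upwards [tAll.eventually_const_lt hgain, hA, tTilt,
    tendsto_fst_highProb.eventually hNpos,
    eventually_highProb_of_ae (P := P) (p := fun x => W x.1 x.2 ∈ ambiguitySet (k - 1) α (n x.1) ∧
      IsMaxOn (fun w : ∀ p, Fin (n x.1 p) → ℝ => ∑ p, ∑ j,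
        (influenceEstimate (h i) ((run x.1).X x.2) (fun r => (run x.1).Z i r x.2) p j
          - influenceEstimate (h l) ((run x.1).X x.2) (fun r => (run x.1).Z l r x.2) p j) * w p j)
        (ambiguitySet (k - 1) α (n x.1)) (W x.1 x.2)) fun ν => (run ν).isMax_W i l hil]
    with x hAll hAx hTilt hNx hmax hVx
  obtain ⟨hWx, hmax⟩ := hmax
  set y := (run x.1).X x.2
  set w := W x.1 x.2
  have hs0 := Real.sqrt_pos.2 hNx
  have hs2 := Real.sq_sqrt (hN0 x.1)
  set s := √(N x.1)
  have hnr : ∀ p, (0 : ℝ) < n x.1 p := fun p => by exact_mod_cast hn x.1 p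
  set A := ∑ p, 1 / (n x.1 p : ℝ) * 𝔼 j, (a p (y p j) - 𝔼 j', a p (y p j')) ^ 2 with hAdef
  have hopt := sum_mul_weights_ge (hn x.1) hQ (a := fun p j => a p (y p j)) hWx hmax
    (fun p => (T i p : ℝ) * (1 / (R₁ x.1 : ℝ) * ∑ r, h i ((run x.1).Z i r x.2) - meanPerf (h i) F) -
      (T l p : ℝ) * (1 / (R₁ x.1 : ℝ) * ∑ r, h l ((run x.1).Z l r x.2) - meanPerf (h l) F))
    (τ := t * s) hε1 hTilt ?_
  swap
  · have h1 : (t * s) ^ 2 * A * (1 + 4 * ε) = t ^ 2 * (N x.1 * A) * (1 + 4 * ε) := by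
      rw [mul_pow, hs2]
      ring
    have h2 : t ^ 2 * v = κ ^ 2 := by
      rw [ht, ← hσsq]
      field_simp
    rw [h1]
    calc t ^ 2 * (N x.1 * A) * (1 + 4 * ε) ≤ t ^ 2 * (v * (1 + ε)) * (1 + 4 * ε) := by gcongr
      _ = κ ^ 2 * (1 + ε) * (1 + 4 * ε) := by rw [← h2]; ring
      _ ≤ Q := hε2.le
  have hV : s * ∑ p, 𝔼 j, a p (y p j) = s * ∑ p, 1 / (n x.1 p : ℝ) * ∑ j, a p (y p j) := by
    congr 1
    refine Finset.sum_congr rfl fun p _ => ?_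
    rw [Fintype.expect_eq_sum_div_card, Fintype.card_fin, div_eq_inv_mul, one_div]
  have hD : s * ∑ p, 2 * √(C / n x.1 p) * √(𝔼 j, (influenceEstimate (h i) y
        (fun r => (run x.1).Z i r x.2) p j - influenceEstimate (h l) y
        (fun r => (run x.1).Z l r x.2) p j - a p (y p j) +
        ((T i p : ℝ) * (1 / (R₁ x.1 : ℝ) * ∑ r, h i ((run x.1).Z i r x.2) - meanPerf (h i) F) -
        (T l p : ℝ) * (1 / (R₁ x.1 : ℝ) * ∑ r, h l ((run x.1).Z l r x.2) - meanPerf (h l) F))) ^ 2) =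
      ∑ p, 2 * √(C * (N x.1 / n x.1 p)) * √(𝔼 j, (b' i x p j - b' l x p j) ^ 2) := by
    rw [Finset.mul_sum]
    refine Finset.sum_congr rfl fun p _ => ?_
    have e1 : √(C * (N x.1 / n x.1 p)) = s * √(C / n x.1 p) := by
      rw [← Real.sqrt_mul (hN0 x.1)]
      congr 1
      ring
    have e2 : ∀ j, influenceEstimate (h i) y (fun r => (run x.1).Z i r x.2) p j -
        influenceEstimate (h l) y (fun r => (run x.1).Z l r x.2) p j - a p (y p j) +
        ((T i p : ℝ) * (1 / (R₁ x.1 : ℝ) * ∑ r, h i ((run x.1).Z i r x.2) - meanPerf (h i) F) -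
        (T l p : ℝ) * (1 / (R₁ x.1 : ℝ) * ∑ r, h l ((run x.1).Z l r x.2) - meanPerf (h l) F)) =
        b' i x p j - b' l x p j := fun j => by
      simp only [b', ha]
      ring
    simp only [e1, e2]
    ring
  have hU : (run x.1).Uhat i l x.2 =
      1 / (R₂ x.1 : ℝ) * ∑ r, h i ((run x.1).ZL i l r x.2) -
      1 / (R₂ x.1 : ℝ) * ∑ r, h l ((run x.1).ZR i l r x.2) := by
    rw [Run.Uhat, Finset.sum_sub_distrib, mul_sub]
  have haw : ∑ p, ∑ j, a p (y p j) * w p j = ∑ p, ∑ j, inflSum F (h i) p (y p j) * w p j -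
      ∑ p, ∑ j, inflSum F (h l) p (y p j) * w p j := by
    simp only [← Finset.sum_sub_distrib, ha, sub_mul]
  have hscaled := mul_le_mul_of_nonneg_left hopt hs0.le
  rw [mul_sub, mul_add, hV, hD, haw] at hscaled
  have hgainx : s * (t * s * A) = t * (N x.1 * A) := by
    rw [← hs2]
    ring
  rw [hgainx] at hscaled
  simp only [Function.comp_apply] at hAll
  have hfinal : 0 < s * ((run x.1).Uhat i l x.2 - (meanPerf (h i) F - meanPerf (h l) F)) := by
    rw [hU]
    have hVx' : -(κ' * σ) < s * ∑ p, 1 / (n x.1 p : ℝ) * ∑ j, a p (y p j) := hVx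
    linarith
  linarith [(mul_pos_iff_of_pos_left hs0).1 hfinal]

end Coverage

/-! ### Nondegeneracy of the limit -/

section Nondegeneracy

variable {k m : ℕ} {S : Fin m → Type*} [∀ p, MeasurableSpace (S p)]
  {T : Fin k → Fin m → ℕ} {h : ∀ i, Sample S (T i) → ℝ}
  {F : ∀ p, Measure (S p)} [∀ p, IsProbabilityMeasure (F p)]

theorem memLp_four_iff_lintegral {X : Type*} [MeasurableSpace X] {μ : Measure X} {f : X → ℝ}
    (hf : Measurable f) : MemLp f 4 μ ↔ ∫⁻ x, ‖f x‖ₑ ^ 4 ∂μ < ⊤ := by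
  have h := eLpNorm_lt_top_iff_lintegral_rpow_enorm_lt_top (μ := μ) (f := f) (p := 4)
    (by norm_num) (by norm_num)
  have e : ∀ x, ‖f x‖ₑ ^ (4 : ℝ≥0∞).toReal = ‖f x‖ₑ ^ 4 := fun x => by
    rw [← ENNReal.rpow_natCast]
    norm_num
  simp only [e] at h
  exact ⟨fun hm => h.1 hm.2, fun hi => ⟨hf.aestronglyMeasurable, h.2 hi⟩⟩

/-- The influence functions are centered, so their covariances are integrals of products. -/
theorem influenceCov_apply (hT : ∀ i, TieL2 F (h i))
    (hh4 : ∀ i, MemLp (h i) 4 (productLaw (T i) F)) (p : Fin m) (i l : Fin k) :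
    influenceCov h F p i l = ∫ y, inflSum F (h i) p y * inflSum F (h l) p y ∂F p := by
  have h0 : ∀ u, ∫ y, influence (h u) F p y ∂F p = 0 := fun u => by
    rw [integral_congr_ae (influence_eq_inflSum (hT u) p), integral_inflSum (hT u).1 (hh4 u)]
  simp only [influenceCov, Matrix.of_apply, covariance, h0, sub_zero]
  refine integral_congr_ae ?_
  filter_upwards [influence_eq_inflSum (hT i) p, influence_eq_inflSum (hT l) p] with y h1 h2
  rw [h1, h2]

/-- Positive definiteness, applied to the difference of two unit vectors, makes the influence functions of
two different solutions differ. -/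
theorem integral_sq_inflSum_sub_pos (hT : ∀ i, TieL2 F (h i))
    (hh4 : ∀ i, MemLp (h i) 4 (productLaw (T i) F)) {p : Fin m}
    (hcov : (influenceCov h F p).PosDef) {i l : Fin k} (hil : i ≠ l) :
    0 < ∫ y, (inflSum F (h i) p y - inflSum F (h l) p y) ^ 2 ∂F p := by
  have h2 : ∀ u, MemLp (fun y => inflSum F (h u) p y) 2 (F p) := fun u =>
    (memLp_four_inflSum (hT u).1 (hh4 u) p).mono_exponent (by norm_num)
  let x : Fin k → ℝ := Pi.single i 1 - Pi.single l 1
  have hx : x ≠ 0 := fun hx => by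
    have := congrFun hx i
    simp [x, hil] at this
  have h3 := hcov.dotProduct_mulVec_pos hx
  have e : ∀ y, inflSum F (h i) p y - inflSum F (h l) p y =
      ∑ u, x u * inflSum F (h u) p y := fun y => by
    simp [x, sub_mul, Finset.sum_sub_distrib, Pi.single_apply]
  simp only [e]
  rw [integral_sq_sum (f := fun y u => inflSum F (h u) p y) h2 x]
  refine h3.trans_eq ?_
  simp only [dotProduct, Matrix.mulVec, influenceCov_apply hT hh4, Finset.mul_sum,
    Pi.star_apply, star_trivial]
  exact Finset.sum_congr rfl fun u _ => Finset.sum_congr rfl fun u' _ => by ring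

/-- If the sample space of a source had dimension zero, its influence functions would be
constant. -/
theorem not_posDef_influenceCov_of_subsingleton (i : Fin k) {p : Fin m} [Subsingleton (S p)] :
    ¬ (influenceCov h F p).PosDef := by
  intro hcov
  have h1 := hcov.diag_pos (i := i)
  have hne : Nonempty (S p) := nonempty_of_isProbabilityMeasure (F p)
  obtain ⟨y₀⟩ := hne
  have e : influence (h i) F p = fun _ => influence (h i) F p y₀ :=
    funext fun y => congrArg _ (Subsingleton.elim _ _)
  simp only [influenceCov, Matrix.of_apply] at h1
  rw [e, covariance_const_left] at h1
  exact lt_irrefl _ h1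

theorem posSemidef_sum_integral_mul {ι : Type*} [Fintype ι] {f : ∀ p, S p → ι → ℝ}
    (hf2 : ∀ p l, MemLp (fun y => f p y l) 2 (F p)) {γ : Fin m → ℝ} (hγ : ∀ p, 0 ≤ γ p) :
    (Matrix.of fun l l' => ∑ p, γ p * ∫ y, f p y l * f p y l' ∂F p).PosSemidef := by
  refine Matrix.PosSemidef.of_dotProduct_mulVec_nonneg ?_ fun x => ?_
  · ext l l'
    simp only [Matrix.conjTranspose_apply, Matrix.of_apply, star_trivial]
    simp only [mul_comm]
  · have e : star x ⬝ᵥ (Matrix.of fun l l' => ∑ p, γ p * ∫ y, f p y l * f p y l' ∂F p).mulVec x =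
        ∑ p, γ p * ∫ y, (∑ l, x l * f p y l) ^ 2 ∂F p := by
      simp only [integral_sq_sum (hf2 _), dotProduct, Matrix.mulVec, Matrix.of_apply,
        Finset.mul_sum, Finset.sum_mul, Pi.star_apply, star_trivial]
      rw [Finset.sum_comm]
      refine (Finset.sum_congr rfl fun l _ => Finset.sum_comm).trans ?_
      rw [Finset.sum_comm]
      refine Finset.sum_congr rfl fun p _ => ?_
      rw [Finset.sum_comm]
      exact Finset.sum_congr rfl fun l _ => Finset.sum_congr rfl fun l' _ => by ring
    rw [e]
    exact Finset.sum_nonneg fun p _ => mul_nonneg (hγ p) (integral_nonneg fun y => sq_nonneg _)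

end Nondegeneracy

/-! ### Simultaneous coverage -/

section Main

/-- A distribution with a density on a subset of a Euclidean space of positive dimension has no
atoms. -/
theorem nullSingletonClass_of_map_absolutelyContinuous {d : ℕ} (hd : 0 < d)
    {Ξ : Set (EuclideanSpace ℝ (Fin d))} {μ : Measure Ξ} (hμ : μ.map Subtype.val ≪ volume) :
    NullSingletonClass μ := by
  refine ⟨fun x => ?_⟩
  have : Nonempty (Fin d) := ⟨⟨0, hd⟩⟩
  have h1 : μ.map Subtype.val {x.1} = 0 := hμ (measure_singleton _)
  rw [Measure.map_apply measurable_subtype_coe (measurableSet_singleton _)] at h1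
  exact measure_mono_null (fun y hy => by rw [Set.mem_singleton_iff.1 hy]; rfl) h1

end Main

end InputUncertainty

end

open InputUncertainty in
theorem mainTheorem3
    {k m : ℕ} {d : Fin m → ℕ}
    -- the sample spaces and the true input distributions, which have densities
    (Ξ : ∀ p, Set (EuclideanSpace ℝ (Fin (d p))))
    (Fc : ∀ p, Measure (Ξ p)) [∀ p, IsProbabilityMeasure (Fc p)]
    (hFc : ∀ p, (Fc p).map Subtype.val ≪ volume)
    -- the simulator: input lengths, output functions, finite second moments
    (T : Fin k → Fin m → ℕ) (hT : ∀ i p, 0 < T i p)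
    (h : ∀ i, InputUncertainty.Sample (fun p => Ξ p) (T i) → ℝ) (hh : ∀ i, Measurable (h i))
    (hh2 : ∀ i, (∫⁻ z, ‖h i z‖ₑ ^ 2 ∂InputUncertainty.productLaw (T i) Fc) < ⊤)
    -- the confidence level
    (α : ℝ) (hα : α ∈ Set.Ioo (0 : ℝ) 1)
    -- the sample sizes along a sequence of experiments, and the replication numbers
    (n : ℕ → Fin m → ℕ) (hn : ∀ ν p, 0 < n ν p)
    (hn_top : Tendsto (fun ν => InputUncertainty.avgSize (n ν)) atTop atTop)
    (hβ : ∃ β : Fin m → ℝ, ∀ p, 0 < β p ∧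
      Tendsto (fun ν => (n ν p : ℝ) / InputUncertainty.avgSize (n ν)) atTop (𝓝 (β p)))
    (R₁ R₂ : ℕ → ℕ)
    (hR₁ : Tendsto (fun ν => (R₁ ν : ℝ) / InputUncertainty.avgSize (n ν)) atTop atTop)
    (hR₂ : Tendsto (fun ν => (R₂ ν : ℝ) / InputUncertainty.avgSize (n ν)) atTop atTop)
    -- nondegeneracy of the influence functions
    (hcov : ∀ p, (InputUncertainty.influenceCov h Fc p).PosDef)
    -- finite fourth moments over the ambiguity set and with reused input samples
    (hh4 : ∀ ν i, ∀ᵐ x ∂InputUncertainty.productLaw (n ν) Fc,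
      (⨆ w ∈ InputUncertainty.ambiguitySet (k - 1) α (n ν), (∫⁻ z, ‖h i z‖ₑ ^ 4
        ∂InputUncertainty.productLaw (T i) (InputUncertainty.weightedEdf x w) : ℝ≥0∞)) < ⊤)
    (hh4' : ∀ i, ∀ I : ∀ p, Fin (T i p) → Fin (T i p),
      (∫⁻ z, ‖h i (fun p t => z p (I p t))‖ₑ ^ 4 ∂InputUncertainty.productLaw (T i) Fc) < ⊤)
    -- the runs of the procedure
    {Ω : ℕ → Type*} [∀ ν, MeasurableSpace (Ω ν)] (P : ∀ ν, Measure (Ω ν))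
    [∀ ν, IsProbabilityMeasure (P ν)]
    (run : ∀ ν, InputUncertainty.Run h Fc α (n ν) (R₁ ν) (R₂ ν) (P ν))
    (i : Fin k) :
    1 - α ≤ liminf (fun ν => (P ν).real {ω | ∀ l, l ≠ i →
      InputUncertainty.meanPerf (h i) Fc - InputUncertainty.meanPerf (h l) Fc
        ≤ (run ν).Uhat i l ω}) atTop := by
  obtain ⟨β, hβ⟩ := hβ
  -- without sources the average sample size would be `0 / 0 = 0` and could not tend to infinity
  have hm : 0 < m := by
    by_contra! h0
    have hm0 : m = 0 := by omega
    have hzero : ∀ ν, avgSize (n ν) = 0 := fun ν => by simp [avgSize, hm0]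
    simp only [hzero] at hn_top
    exact not_tendsto_const_atTop _ _ hn_top
  -- a point mass in dimension zero has a density, but there the influence functions are degenerate
  have hd : ∀ p, 0 < d p := fun p => by
    by_contra! h0
    have hd0 : IsEmpty (Fin (d p)) := by rw [Nat.le_zero.1 h0]; infer_instance
    have : Subsingleton (EuclideanSpace ℝ (Fin (d p))) := ⟨fun x y => by ext j; exact hd0.elim j⟩
    exact not_posDef_influenceCov_of_subsingleton i (hcov p)
  have hatom : ∀ p, NullSingletonClass (Fc p) := fun p =>
    nullSingletonClass_of_map_absolutelyContinuous (hd p) (hFc p)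
  have hL4 : ∀ u, MemLp (h u) 4 (productLaw (T u) Fc) := fun u =>
    (memLp_four_iff_lintegral (hh u)).2 (hh4' u fun p t => t)
  have hTie : ∀ u, TieL2 Fc (h u) := fun u => ⟨hh u, fun I =>
    ((memLp_four_iff_lintegral ((hh u).comp (measurable_reuse I))).2 (hh4' u I)).mono_exponent
      (by norm_num)⟩
  have hu : 1 - α ∈ Set.Ioo (0 : ℝ) 1 := ⟨by linarith [hα.2], by linarith [hα.1]⟩
  have hQ : 0 ≤ chiSqQuantile (k - 1) (1 - α) := chiSqQuantile_nonneg _ hu.1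
  have hN0 : ∀ ν, 0 ≤ avgSize (n ν) := fun ν => by unfold avgSize; positivity
  let ι := {l : Fin k // l ≠ i}
  have hcard : Fintype.card ι = k - 1 := by simp [ι]
  -- with a single solution there is nothing to compare
  rcases Nat.eq_zero_or_pos (k - 1) with hk | hk
  · have : IsEmpty ι := Fintype.card_eq_zero_iff.1 (hcard.trans hk)
    have huniv : ∀ ν, {ω | ∀ l, l ≠ i → meanPerf (h i) Fc - meanPerf (h l) Fc ≤
        (run ν).Uhat i l ω} = Set.univ := fun ν =>
      Set.eq_univ_of_forall fun ω l hl => (this.false ⟨l, hl⟩).elim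
    simp only [huniv, probReal_univ, liminf_const]
    linarith [hα.1]
  obtain ⟨r, hr⟩ : ∃ r, k - 1 = r + 1 := ⟨k - 1 - 1, by omega⟩
  let f : ∀ p, Ξ p → ι → ℝ := fun p y l => inflSum Fc (h i) p y - inflSum Fc (h l) p y
  have hf4 : ∀ p l, MemLp (fun y => f p y l) 4 (Fc p) := fun p l =>
    (memLp_four_inflSum (hTie i).1 (hL4 i) p).sub (memLp_four_inflSum (hTie l).1 (hL4 l) p)
  have hf2 : ∀ p l, MemLp (fun y => f p y l) 2 (Fc p) := fun p l =>
    (hf4 p l).mono_exponent (by norm_num)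
  have hfm : ∀ p, Measurable (f p) := fun p => measurable_pi_iff.2 fun l =>
    (measurable_inflSum (hTie i).1 p).sub (measurable_inflSum (hTie l).1 p)
  have hf0 : ∀ p l, ∫ y, f p y l ∂Fc p = 0 := fun p l => by
    simp only [f]
    rw [integral_sub ((memLp_four_inflSum (hTie i).1 (hL4 i) p).integrable (by norm_num))
      ((memLp_four_inflSum (hTie l).1 (hL4 l) p).integrable (by norm_num)),
      integral_inflSum (hTie i).1 (hL4 i), integral_inflSum (hTie l).1 (hL4 l), sub_zero]
  let C : Matrix ι ι ℝ :=
    Matrix.of fun l l' => ∑ p, (β p)⁻¹ * ∫ y, f p y l * f p y l' ∂Fc p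
  have hC : C.PosSemidef :=
    posSemidef_sum_integral_mul hf2 fun p => inv_nonneg.2 (hβ p).1.le
  have hCdiag : ∀ l : ι, C l l = ∑ p, (β p)⁻¹ *
      ∫ y, (inflSum Fc (h i) p y - inflSum Fc (h l) p y) ^ 2 ∂Fc p := fun l => by
    simp only [C, f, Matrix.of_apply, sq]
  have hCpos : ∀ l, 0 < C l l := fun l => by
    have : Nonempty (Fin m) := ⟨⟨0, hm⟩⟩
    rw [hCdiag]
    exact Finset.sum_pos (fun p _ => mul_pos (inv_pos.2 (hβ p).1)
      (integral_sq_inflSum_sub_pos hTie hL4 (hcov p) l.2.symm)) Finset.univ_nonempty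
  let V : ∀ ν, Sample (fun p => Ξ p) (n ν) → EuclideanSpace ℝ ι := fun ν x =>
    WithLp.toLp 2 fun l => √(avgSize (n ν)) * ∑ p, 1 / (n ν p : ℝ) * ∑ j, f p (x p j) l
  have hVm : ∀ ν, Measurable (V ν) := fun ν => by
    have := fun p l => (measurable_pi_apply l).comp (hfm p)
    have h1 : ∀ p l, Measurable fun y => f p y l := this
    refine (WithLp.measurable_toLp 2 _).comp (measurable_pi_iff.2 fun l => ?_)
    have h2 := fun p => h1 p l
    fun_prop
  have hγ : ∀ p, Tendsto (fun ν => avgSize (n ν) / n ν p) atTop (𝓝 (β p)⁻¹) := fun p => by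
    refine ((hβ p).2.inv₀ (hβ p).1.ne').congr fun ν => ?_
    rw [inv_div]
  have hnt : ∀ p, Tendsto (fun ν => n ν p) atTop atTop := fun p => by
    rw [← tendsto_natCast_atTop_iff (R := ℝ)]
    refine ((hβ p).2.pos_mul_atTop (hβ p).1 hn_top).congr' ?_
    filter_upwards [hn_top.eventually_gt_atTop 0] with ν hν
    field_simp
  refine le_of_forall_lt fun c hc => ?_
  obtain ⟨c', hcc', hc'⟩ := exists_between (max_lt hc hu.1)
  have hc'0 : 0 < c' := (le_max_right _ _).trans_lt hcc'
  have hcc : c < c' := (le_max_left _ _).trans_lt hcc'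
  obtain ⟨c₁, hc1, hc1'⟩ := exists_between hcc
  have hball := le_stdGaussian_ball (ι := ι) (r := r) (hcard.trans hr) hu
  rw [← hr] at hball
  -- a slightly smaller ball leaves room for the errors of estimation
  obtain ⟨κ, hκ0, hκ1, hκ2⟩ := exists_lt_measure_ball
    (((ENNReal.ofReal_lt_ofReal_iff hu.1).2 hc').trans_le hball)
  let G : Set (EuclideanSpace ℝ ι) := {x | ∀ l, -(κ * √(C l l)) < x l}
  have hG : IsOpen G := by
    have : G = ⋂ l, {x : EuclideanSpace ℝ ι | -(κ * √(C l l)) < x l} := by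
      ext; simp [G]
    rw [this]
    exact isOpen_iInter_of_finite fun l => isOpen_lt continuous_const (by fun_prop)
  have hclt := tendsto_sourceAverages hfm hf2 hf0 hN0 hnt hγ (C := C) (fun _ _ => rfl) hC hVm
    (fun _ _ _ => rfl) hG
  have hlarge := eventually_lt_of_lt_liminf
    ((hκ2.trans_le (stdGaussian_ball_le_multivariateGaussian hC hCpos κ)).trans_le hclt)
  have hbad : ∀ᶠ x : Σ ν, Ω ν in highProb P, ∀ l : ι,
      -(κ * √(C l l)) < V x.1 ((run x.1).X x.2) l →
      meanPerf (h i) Fc - meanPerf (h l) Fc ≤ (run x.1).Uhat i l x.2 :=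
    eventually_all.2 fun l => eventually_le_Uhat hTie hL4 hT hm hn hn_top hN0 (fun p => (hβ p).1)
      (fun p => (hβ p).2) hR₁ hR₂ hQ run l.2.symm (hCdiag l) (hCpos l) hκ0.le hκ1
  rw [eventually_highProb, ENNReal.tendsto_nhds_zero] at hbad
  refine hc1.trans_le (le_liminf_of_le ?_ ?_)
  · exact isCoboundedUnder_ge_of_le atTop (x := 1) fun ν => measureReal_le_one
  filter_upwards [hlarge, hbad (ENNReal.ofReal (c' - c₁)) (ENNReal.ofReal_pos.2 (by linarith))]
    with ν h1 h2
  rw [← (run ν).map_X, Measure.map_apply (run ν).measurable_X (hVm ν hG.measurableSet)] at h1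
  have hsub : (run ν).X ⁻¹' (V ν ⁻¹' G) ⊆ {ω | ∀ l, l ≠ i →
      meanPerf (h i) Fc - meanPerf (h l) Fc ≤ (run ν).Uhat i l ω} ∪
      {ω | ¬ ∀ l : ι, -(κ * √(C l l)) < V ν ((run ν).X ω) l →
        meanPerf (h i) Fc - meanPerf (h l) Fc ≤ (run ν).Uhat i l ω} := by
    intro ω hω
    by_cases hb : ∀ l : ι, -(κ * √(C l l)) < V ν ((run ν).X ω) l →
        meanPerf (h i) Fc - meanPerf (h l) Fc ≤ (run ν).Uhat i l ω
    · exact Or.inl fun l hl => hb ⟨l, hl⟩ (hω ⟨l, hl⟩)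
    · exact Or.inr hb
  have h3 := h1.trans_le ((measure_mono hsub).trans ((measure_union_le _ _).trans
    (add_le_add_right h2 _)))
  rw [← ENNReal.ofReal_toReal (measure_ne_top (P ν) {ω | ∀ l, l ≠ i →
      meanPerf (h i) Fc - meanPerf (h l) Fc ≤ (run ν).Uhat i l ω}),
    ← ENNReal.ofReal_add ENNReal.toReal_nonneg (by linarith)] at h3
  have h4 := (ENNReal.ofReal_lt_ofReal_iff_of_nonneg hc'0.le).1 h3
  rw [measureReal_def]
  linarith
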